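/- Let $\mathbb X$ be a Polish space with its Borel $\sigma$-algebra, $\alpha$ a diffuse (atomless) probability measure on $\mathbb X$, $\phi>0$, $\sigma\in(0,1)$, $d\ge 1$ and $n_1,\dots,n_d\ge 1$. Write $\mathrm{Gamma}(a,b)$ for the gamma law with shape $a$ and rate $b$. *Prior.* Let $\tilde\eta=\sum_{i\ge1}J_i\delta_{\tilde x_i}$ be a completely random measure on $\mathbb X$ (without fixed atoms and drift, i.e. the points $(J_i,\tilde x_i)$ with $J_i>0$ form a Poisson process) with Lévy intensity $\nu^*(ds)\,\alpha(dx)$, where $$\nu^*(ds)=\frac{\sigma\,\Gamma(\phi)}{\Gamma(\sigma+\phi)\,\Gamma(1-\sigma)}\,s^{-1-\sigma}\,ds,\qquad s>0 .$$ Let the scores $m_{j,i}$ ($1\le j\le d$, $i\ge1$) be i.i.d. $\mathrm{Gamma}(\phi,1)$, independent of $(J_i,\tilde x_i)_{i\ge1}$, and put $\tilde\mu_j=\sum_{i\ge1}m_{j,i}J_i\delta_{\tilde x_i}$ and $\tilde p_j=\tilde\mu_j/\tilde\mu_j(\mathbb X)$. *Data.* Conditionally on $(\tilde\mu_1,\dots,\tilde\mu_d)$,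 let the observations $X_{i,j}$ ($1\le j\le d$, $1\le i\le n_j$) be independent with $X_{i,j}\sim\tilde p_j$, and let $\bm X_j=(X_{1,j},\dots,X_{n_j,j})$. Let $U_j=G_j/\tilde\mu_j(\mathbb X)$, where $G_1,\dots,G_d$ are independent, $G_j\sim\mathrm{Gamma}(n_j,1)$, and $(G_1,\dots,G_d)$ is independent of the random measures and of the observations. Let $X_1^*,\dots,X_k^*$ be the distinct values among all the observations, $n_{\ell,j}$ the number of $i$ with $X_{i,j}=X_\ell^*$, and $n_{\ell,\bullet}=\sum_{j=1}^d n_{\ell,j}$. *Claim.* Almost surely $U_j>0$ for all $j$, and the conditional law of $(\tilde\mu_1,\dots,\tilde\mu_d)$ given $\{\bm X_j,U_j\}_{j=1}^d$ (there is a version of the regular conditional law for which this holds at all values of the observations and all positive values of the $U_j$) is the law of $$(\tilde\mu_1',\dots,\tilde\mu_d')+\sum_{\ell=1}^k (T_{\ell,1},\dots,T_{\ell,d})\,\sigma_\ell\,\delta_{X_\ell^*},$$ where, for the given values of the $\bm X_j$ and $U_j$, the two summands are independent and (i) $\tilde\mu_j'=\sum_{i\ge1}m'_{j,i}J_i'\delta_{\tilde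 x_i'}$, where $\tilde\eta'=\sum_{i\ge1}J_i'\delta_{\tilde x_i'}$ is a completely random measure (in the same sense) with Lévy intensity $$\nu'(ds)\,\alpha(dx)=\frac{s^{-1-\sigma}\,\sigma\,\Gamma(\phi)}{\Gamma(\phi+\sigma)\,\Gamma(1-\sigma)}\prod_{j=1}^d\frac{1}{(sU_j+1)^{\phi}}\,ds\,\alpha(dx),\qquad s>0,$$ and, conditionally on $(J_i',\tilde x_i')_{i\ge1}$, the $m'_{j,i}$ are independent with $m'_{j,i}\sim\mathrm{Gamma}(\phi,\,U_jJ_i'+1)$; (ii) $\sigma_1,\dots,\sigma_k$ are independent positive random variables, $\sigma_\ell$ having a density on $(0,\infty)$ proportional to $$s^{\,n_{\ell,\bullet}-1-\sigma}\prod_{j=1}^d\frac{1}{(sU_j+1)^{\,n_{\ell,j}+\phi}},$$ and, conditionally on $\sigma_1,\dots,\sigma_k$, the $T_{\ell,j}$ ($1\le\ell\le k$, $1\le j\le d$) are independent with $T_{\ell,j}\sim\mathrm{Gamma}(\phi+n_{\ell,j},\,\sigma_\ell U_j+1)$. -/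

import Mathlib

open MeasureTheory ProbabilityTheory Set
open scoped ENNReal

universe u v

noncomputable section

/-! ### Poisson processes, completely random measures, compound random measures -/

/-- A random measure `N` on `E` is a Poisson process with intensity `Λ`: the mass of every
measurable set of finite intensity has a Poisson law, and the masses of pairwise disjoint
measurable sets are mutually independent. -/
structure IsPoissonProcess {Ω E : Type*} [MeasurableSpace Ω] [MeasurableSpace E]
    (P : Measure Ω) (N : Ω → Measure E) (Λ : Measure E) : Prop where
  measurable : Measurable N
  poisson : ∀ B : Set E, MeasurableSet B → Λ B ≠ ∞ →
    HasLaw (fun ω => N ω B)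
      ((poissonMeasure (Λ B).toNNReal).map (fun r : ℕ => (r : ℝ≥0∞))) P
  indep : ∀ (r : ℕ) (B : Fin r → Set E), (∀ a, MeasurableSet (B a)) →
    Pairwise (fun a b => Disjoint (B a) (B b)) → iIndepFun (fun a ω => N ω (B a)) P

/-- The point process `∑_{i : J i > 0} δ_{(J i, x i)}` of the (positive) heights and of the
locations of `∑_i J i δ_{x i}`. -/
def pointProcess {X : Type*} [MeasurableSpace X] (J : ℕ → ℝ) (x : ℕ → X) : Measure (ℝ × X) :=
  Measure.sum (fun i => if 0 < J i then Measure.dirac (J i, x i) else 0)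

/-- The random measure `∑_i J i δ_{x i}`, with heights `J i ≥ 0`, is a completely random measure
(without fixed atoms and without drift) with Lévy intensity `Λ(ds, dx)`: its heights and locations
form a Poisson process with intensity `Λ`. A height equal to `0` contributes nothing. -/
structure IsCRM {Ω X : Type*} [MeasurableSpace Ω] [MeasurableSpace X] (P : Measure Ω)
    (Λ : Measure (ℝ × X)) (J : ℕ → Ω → ℝ) (x : ℕ → Ω → X) : Prop where
  measurable_height : ∀ i, Measurable (J i)
  measurable_location : ∀ i, Measurable (x i)
  nonneg : ∀ i, ∀ᵐ ω ∂P, 0 ≤ J i ω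
  poisson : IsPoissonProcess P (fun ω => pointProcess (fun i => J i ω) (fun i => x i ω)) Λ

/-- Conditionally on all heights and locations `(J, x)`, the scores `m j i` are independent, and
`m j i` has the law `h (J i) j`: for all `A`, `N` and `B`,
`P((J, x) ∈ A, m j i ∈ B j i for all j and i < N) = E[1_{(J, x) ∈ A} ∏_j ∏_{i < N} h (J i) j (B j i)]`.
If `h` does not depend on its first argument, the score vectors `(m j i)_j` are thus i.i.d. in `i`
with law the product of the `h j`, and independent of `(J, x)`. -/
structure HasScores {Ω X : Type*} [MeasurableSpace Ω] [MeasurableSpace X] {d : ℕ} (P : Measure Ω)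
    (h : ℝ → Fin d → Measure ℝ) (J : ℕ → Ω → ℝ) (x : ℕ → Ω → X) (m : Fin d → ℕ → Ω → ℝ) :
    Prop where
  measurable : ∀ j i, Measurable (m j i)
  cond : ∀ A : Set ((ℕ → ℝ) × (ℕ → X)), MeasurableSet A →
    ∀ (N : ℕ) (B : Fin d → ℕ → Set ℝ), (∀ j i, MeasurableSet (B j i)) →
      P ({ω | ((fun i => J i ω), (fun i => x i ω)) ∈ A} ∩
          {ω | ∀ j, ∀ i < N, m j i ω ∈ B j i}) =
        ∫⁻ ω in {ω | ((fun i => J i ω), (fun i => x i ω)) ∈ A},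
          ∏ j, ∏ i ∈ Finset.range N, h (J i ω) j (B j i) ∂P

/-- The vector of random measures `μ_j = ∑_i m_{j,i} J_i δ_{x_i}`. -/
def compound {Ω X : Type*} [MeasurableSpace X] {d : ℕ} (J : ℕ → Ω → ℝ) (x : ℕ → Ω → X)
    (m : Fin d → ℕ → Ω → ℝ) (ω : Ω) (j : Fin d) : Measure X :=
  Measure.sum (fun i => ENNReal.ofReal (m j i ω * J i ω) • Measure.dirac (x i ω))

/-! ### Sampling from the normalized measures, and the latent variables -/

/-- Conditionally on the random measures `μ_1, …, μ_d`, the observations `obs j i`, `i < n j`, are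
independent, and `obs j i` has the law `μ_j / μ_j(X)`: for all `A` and `B`,
`P(μ ∈ A, obs j i ∈ B j i for all j, i) = E[1_{μ ∈ A} ∏_j ∏_i μ_j(B j i) / μ_j(X)]`. -/
structure IsNormalizedSample {Ω X : Type*} [MeasurableSpace Ω] [MeasurableSpace X] {d : ℕ}
    (P : Measure Ω) (μ : Ω → Fin d → Measure X) (n : Fin d → ℕ)
    (obs : Ω → (j : Fin d) → Fin (n j) → X) : Prop where
  measurable : Measurable obs
  cond : ∀ A : Set (Fin d → Measure X), MeasurableSet A →
    ∀ B : (j : Fin d) → Fin (n j) → Set X, (∀ j i, MeasurableSet (B j i)) →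
      P ({ω | μ ω ∈ A} ∩ {ω | ∀ j i, obs ω j i ∈ B j i}) =
        ∫⁻ ω in {ω | μ ω ∈ A}, ∏ j, ∏ i, ((μ ω j univ)⁻¹ • μ ω j) (B j i) ∂P

/-- The variables `G_1, …, G_d` are independent, `G_j` has the law `Gamma(n_j, 1)`, and
`(G_1, …, G_d)` is independent of the random measures and of the observations. -/
structure IsGammaAuxiliary {Ω X : Type*} [MeasurableSpace Ω] [MeasurableSpace X] {d : ℕ}
    (P : Measure Ω) (μ : Ω → Fin d → Measure X) (n : Fin d → ℕ)
    (obs : Ω → (j : Fin d) → Fin (n j) → X) (G : Ω → Fin d → ℝ) : Prop where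
  measurable : Measurable G
  law : ∀ j, HasLaw (fun ω => G ω j) (gammaMeasure (n j) 1) P
  indep : iIndepFun (fun j ω => G ω j) P
  indep_model : IndepFun G (fun ω => (μ ω, obs ω)) P

/-- The latent variables `U_j = G_j / μ_j(X)`. -/
def latent {Ω X : Type*} [MeasurableSpace X] {d : ℕ} (μ : Ω → Fin d → Measure X)
    (G : Ω → Fin d → ℝ) (ω : Ω) (j : Fin d) : ℝ :=
  G ω j / (μ ω j univ).toReal

/-! ### Gamma scores and stable directing Lévy measure -/

/-- The directing Lévy measure
`ν*(ds) = σ Γ(φ) / (Γ(σ + φ) Γ(1 - σ)) s^{-1-σ} ds` on `(0, ∞)`. -/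
def stableLevy (φ σ : ℝ) : Measure ℝ :=
  (volume.restrict (Ioi 0)).withDensity (fun s => ENNReal.ofReal
    (σ * Real.Gamma φ / (Real.Gamma (σ + φ) * Real.Gamma (1 - σ)) * s ^ (-1 - σ)))

/-- The updated Lévy measure
`ν'(ds) = s^{-1-σ} σ Γ(φ) / (Γ(φ + σ) Γ(1 - σ)) ∏_j (s u_j + 1)^{-φ} ds` on `(0, ∞)`. -/
def updatedLevy {d : ℕ} (φ σ : ℝ) (u : Fin d → ℝ) : Measure ℝ :=
  (volume.restrict (Ioi 0)).withDensity (fun s => ENNReal.ofReal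
    (s ^ (-1 - σ) * σ * Real.Gamma φ / (Real.Gamma (φ + σ) * Real.Gamma (1 - σ)) *
      ∏ j, 1 / (s * u j + 1) ^ φ))

/-- The number `n_{ℓ,j}` of observations of the `j`-th sample that are equal to `y`. -/
def freq {X : Type*} {d : ℕ} {n : Fin d → ℕ} (obs : (j : Fin d) → Fin (n j) → X) (y : X)
    (j : Fin d) : ℕ :=
  Set.ncard {i | obs j i = y}

/-- The measure on `(0, ∞)` with density
`s^{c_• - 1 - σ} ∏_j (s u_j + 1)^{-(c_j + φ)}`, where `c_• = ∑_j c_j`. -/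
def fixedJumpWeight {d : ℕ} (φ σ : ℝ) (u : Fin d → ℝ) (c : Fin d → ℕ) : Measure ℝ :=
  (volume.restrict (Ioi 0)).withDensity (fun s => ENNReal.ofReal
    (s ^ (((∑ j, c j : ℕ) : ℝ) - 1 - σ) * ∏ j, 1 / (s * u j + 1) ^ ((c j : ℝ) + φ)))

/-- The probability law with density proportional to that of `fixedJumpWeight`. -/
def fixedJumpLaw {d : ℕ} (φ σ : ℝ) (u : Fin d → ℝ) (c : Fin d → ℕ) : Measure ℝ :=
  (fixedJumpWeight φ σ u c univ)⁻¹ • fixedJumpWeight φ σ u c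

/-- Random elements on a probability space `(Ω, P)` that represent the posterior for the values `u`
of the latent variables and for `k` distinct observed values with frequencies
`c ℓ j`. The heights `J`, locations `x` and scores `m` describe the part without fixed atoms; the
variables `s ℓ` (common to the groups) and `T ℓ j` give the jumps at the distinct values. -/
structure IsPosteriorRepresentation {Ω X : Type*} [MeasurableSpace Ω] [MeasurableSpace X]
    {d k : ℕ} (P : Measure Ω) (α : Measure X) (φ σ : ℝ) (u : Fin d → ℝ) (c : Fin k → Fin d → ℕ)
    (J : ℕ → Ω → ℝ) (x : ℕ → Ω → X) (m : Fin d → ℕ → Ω → ℝ)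
    (s : Fin k → Ω → ℝ) (T : Fin k → Fin d → Ω → ℝ) : Prop where
  /-- `∑_i J_i δ_{x_i}` is a completely random measure with Lévy intensity `ν'(ds) α(dx)`. -/
  crm : IsCRM P ((updatedLevy φ σ u).prod α) J x
  /-- Given the heights, the scores are independent with law `Gamma(φ, u_j J_i + 1)`. -/
  scores : HasScores P (fun t j => gammaMeasure φ (u j * t + 1)) J x m
  measurable_jump : ∀ ℓ j, Measurable (T ℓ j)
  measurable_common : ∀ ℓ, Measurable (s ℓ)
  /-- The law of `σ_ℓ` has density proportional to
  `s^{n_{ℓ•} - 1 - σ} ∏_j (s u_j + 1)^{-(n_{ℓ,j} + φ)}`. -/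
  common_law : ∀ ℓ, HasLaw (s ℓ) (fixedJumpLaw φ σ u (c ℓ)) P
  common_indep : iIndepFun s P
  /-- Given `σ_1, …, σ_k`, all the `T_{ℓ,j}` are independent, with law
  `Gamma(φ + n_{ℓ,j}, σ_ℓ u_j + 1)`. -/
  jumps : ∀ A : Set (Fin k → ℝ), MeasurableSet A →
    ∀ B : Fin k → Fin d → Set ℝ, (∀ ℓ j, MeasurableSet (B ℓ j)) →
      P ({ω | (fun ℓ => s ℓ ω) ∈ A} ∩ {ω | ∀ ℓ j, T ℓ j ω ∈ B ℓ j}) =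
        ∫⁻ ω in {ω | (fun ℓ => s ℓ ω) ∈ A},
          ∏ ℓ, ∏ j, gammaMeasure (φ + c ℓ j) (s ℓ ω * u j + 1) (B ℓ j) ∂P
  /-- The two parts are independent of each other. -/
  indep : IndepFun
    (fun ω => ((fun i => J i ω), (fun i => x i ω), (fun j i => m j i ω)))
    (fun ω => ((fun ℓ => s ℓ ω), (fun ℓ j => T ℓ j ω))) P

/-- The vector of random measures `∑_ℓ (T_{ℓ,1}, …, T_{ℓ,d}) σ_ℓ δ_{y_ℓ}`. -/
def fixedPart {Ω X : Type*} [MeasurableSpace X] {d k : ℕ} (y : Fin k → X)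
    (s : Fin k → Ω → ℝ) (T : Fin k → Fin d → Ω → ℝ) (ω : Ω) (j : Fin d) : Measure X :=
  ∑ ℓ, ENNReal.ofReal (T ℓ j ω * s ℓ ω) • Measure.dirac (y ℓ)

end

open Filter Topology

/-! Everything is computed with Laplace functionals E[exp(-∑_j μ_j(f_j))], f bounded, measurable and
nonnegative. They determine a finite measure on vectors of measures (`measure_ext_of_laplaceTest`)
and detect measurable dependence on a parameter (`measurable_measure_of_laplaceTest`). Integrating
out the gamma scores and applying the Laplace functional of a Poisson process gives, under the
prior, exp(-∫ ψ(f(y)) α(dy)) with ψ(t) = ∫ (1 - ∏_j (1 + s t_j)^{-φ}) ν*(ds).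

For fixed masses T_j = μ_j(X), the variable U_j has law Gamma(n_j, T_j), and the factor T_j^{n_j} of
its density cancels the T_j^{-n_j} that comes from normalizing the sample
(`inv_pow_mul_gammaMeasure_preimage`). So the joint law of the observations and of U = u, weighted
by a Laplace functional in f, reduces to unnormalized moments E[exp(-∑_j μ_j(f_j + u_j)) ∏
μ_j(B_{j,i})].

These moments come from differentiating the Laplace functional once for each observation, in the
direction 1_B e_j (`integral_laplaceTest_mul_prod`). A derivative either falls on exp(-∫ ψ dα),
which produces a fresh point with law α and a new block, or on the moment κ_c(t) = ∫ ∏_j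
E[(sM)^{c_j} e^{-s t_j M}] ν*(ds) of an existing block, M being Gamma(φ, 1), which raises c_j by
one. Since α is diffuse, a fresh point never falls on an old one. Against a measure that does not
depend on f, the density is therefore, up to a factor depending on u only, exp(-∫ ψ(f + u) dα) ∏_ℓ
κ_{n_ℓ}(f(X_ℓ*) + u) (`setLIntegral_laplaceTest_joint`), and the conditional Laplace functional is
the quotient of its values at f and at 0 (`hasCondDistrib_of_laplaceTest`).

The quotient factorizes. Its first factor is the Laplace functional of the prior tilted by exp(-∑_j
u_j μ_j(X)); the tilt multiplies the Poisson intensity by ∏_j (1 + s u_j)^{-φ} and moves the gamma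
rates from 1 to u_j J_i + 1 (`IsTilted.isCRM`, `IsTilted.hasScores`). The quotients κ_{n_ℓ}(f + u) /
κ_{n_ℓ}(u) are the Laplace transforms of the vectors T_ℓ σ_ℓ (`lintegral_jumpModel`). The product
form is the independence of the summands (`exists_posteriorRepresentation`). -/

/-! ### The exponential on [0, ∞] and measures determined by moments -/

/-- The function `x ↦ e^{-x}` on `[0, ∞]`. -/
noncomputable def expNeg (x : ℝ≥0∞) : ℝ≥0∞ := (EReal.exp (x : EReal))⁻¹

theorem expNeg_zero : expNeg 0 = 1 := by simp [expNeg]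

theorem expNeg_top : expNeg ∞ = 0 := by simp [expNeg]

theorem expNeg_add (x y : ℝ≥0∞) : expNeg (x + y) = expNeg x * expNeg y := by
  unfold expNeg
  rw [EReal.coe_ennreal_add, EReal.exp_add, ENNReal.mul_inv]
  · left; simp
  · right; simp

theorem expNeg_sum {ι : Type*} (s : Finset ι) (f : ι → ℝ≥0∞) :
    expNeg (∑ i ∈ s, f i) = ∏ i ∈ s, expNeg (f i) := by
  classical
  induction s using Finset.induction_on with
  | empty => simp [expNeg_zero]
  | insert a s ha ih => rw [Finset.sum_insert ha, Finset.prod_insert ha, expNeg_add, ih]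

theorem expNeg_le_one (x : ℝ≥0∞) : expNeg x ≤ 1 := by
  unfold expNeg
  rw [ENNReal.inv_le_one, EReal.one_le_exp_iff]
  exact EReal.coe_ennreal_nonneg x

theorem expNeg_ofReal {x : ℝ} (hx : 0 ≤ x) :
    expNeg (ENNReal.ofReal x) = ENNReal.ofReal (Real.exp (-x)) := by
  unfold expNeg
  rw [EReal.coe_ennreal_ofReal, max_eq_left hx, EReal.exp_coe, Real.exp_neg,
    ENNReal.ofReal_inv_of_pos (Real.exp_pos x)]

theorem expNeg_eq {x : ℝ≥0∞} (hx : x ≠ ∞) :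
    expNeg x = ENNReal.ofReal (Real.exp (-x.toReal)) := by
  rw [← expNeg_ofReal ENNReal.toReal_nonneg, ENNReal.ofReal_toReal hx]

theorem continuous_expNeg : Continuous expNeg :=
  continuous_inv.comp (EReal.expOrderIso.continuous.comp continuous_coe_ennreal_ereal)

theorem measurable_expNeg : Measurable expNeg := continuous_expNeg.measurable

theorem antitone_expNeg : Antitone expNeg := fun _ _ h =>
  ENNReal.inv_le_inv.2 (EReal.exp_monotone (EReal.coe_ennreal_le_coe_ennreal_iff.2 h))

theorem injective_expNeg : Function.Injective expNeg := by
  intro x y h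
  have := inv_injective h
  exact EReal.coe_ennreal_injective (EReal.exp_strictMono.injective this)

theorem expNeg_ne_top (x : ℝ≥0∞) : expNeg x ≠ ∞ :=
  ne_top_of_le_ne_top ENNReal.one_ne_top (expNeg_le_one x)

theorem measurableEmbedding_expNeg : MeasurableEmbedding expNeg :=
  measurable_expNeg.measurableEmbedding injective_expNeg

/-- Finite measures on a cube depend measurably on a parameter if their moments do. -/
theorem measurable_measure_cube {A ι : Type*} [MeasurableSpace A] [Fintype ι]
    (R : A → Measure (ι → unitInterval)) [∀ a, IsFiniteMeasure (R a)]
    (h : ∀ k : ι → ℕ, Measurable fun a => ∫ y, ∏ i, ((y i : ℝ)) ^ k i ∂(R a)) :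
    Measurable R := by
  classical
  have hcont : ∀ F : C(ι → unitInterval, ℝ), Measurable fun a => ∫ y, F y ∂(R a) := by
    -- The continuous functions whose integrals depend measurably on the parameter form a closed
    -- subspace. It contains the monomials in the coordinates, so by Stone-Weierstrass it is
    -- everything.
    let V : Submodule ℝ C(ι → unitInterval, ℝ) :=
      { carrier := {F | Measurable fun a => ∫ y, F y ∂(R a)}
        add_mem' := by
          intro F G hF hG
          have : (fun a => ∫ y, (F + G) y ∂(R a)) =
              fun a => ∫ y, F y ∂(R a) + ∫ y, G y ∂(R a) := by
            ext a
            exact integral_add (F.continuous.integrable_of_hasCompactSupport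
              (HasCompactSupport.of_compactSpace _)) (G.continuous.integrable_of_hasCompactSupport
              (HasCompactSupport.of_compactSpace _))
          change Measurable fun a => ∫ y, (F + G) y ∂(R a)
          rw [this]
          exact Measurable.add hF hG
        zero_mem' := by simp
        smul_mem' := by
          intro c F hF
          have : (fun a => ∫ y, (c • F) y ∂(R a)) = fun a => c * ∫ y, F y ∂(R a) := by
            ext a
            exact integral_const_mul c _
          change Measurable fun a => ∫ y, (c • F) y ∂(R a)
          rw [this]
          exact Measurable.const_mul hF c }
    have hVc : IsClosed (V : Set C(ι → unitInterval, ℝ)) := by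
      refine isClosed_of_closure_subset fun F hF => ?_
      obtain ⟨Fn, hFn, hlim⟩ := mem_closure_iff_seq_limit.1 hF
      refine measurable_of_tendsto_metrizable (f := fun n a => ∫ y, Fn n y ∂(R a))
        (fun n => hFn n) (tendsto_pi_nhds.2 fun a => ?_)
      have h1 := ContinuousMap.tendsto_iff_tendstoUniformly.1 hlim
      -- From some index on the functions lie within 1 of `F`, which gives the constant bound ‖F‖ +
      -- 1 for dominated convergence.
      obtain ⟨N, hN⟩ := eventually_atTop.1 (Metric.tendstoUniformly_iff.1 h1 1 one_pos)
      refine tendsto_integral_filter_of_dominated_convergence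
        (fun _ => ‖F‖ + 1) (Eventually.of_forall fun n =>
          (Fn n).continuous.aestronglyMeasurable) ?_ (integrable_const _)
        (Eventually.of_forall fun y => h1.tendsto_at y)
      filter_upwards [eventually_ge_atTop N] with n hn
      refine Eventually.of_forall fun y => ?_
      have h2 := hN n hn y
      rw [dist_eq_norm] at h2
      have h3 := F.norm_coe_le_norm y
      have h4 := norm_sub_norm_le (Fn n y) (F y)
      rw [norm_sub_rev] at h4
      linarith
    let co : ι → C(ι → unitInterval, ℝ) := fun i => ⟨fun y => (y i : ℝ), by fun_prop⟩
    let Al : Subalgebra ℝ C(ι → unitInterval, ℝ) := Algebra.adjoin ℝ (range co)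
    have hsep : Al.SeparatesPoints := by
      intro x y hxy
      obtain ⟨i, hi⟩ := Function.ne_iff.1 hxy
      refine ⟨co i, ⟨co i, Algebra.subset_adjoin ⟨i, rfl⟩, rfl⟩, ?_⟩
      simpa [co] using fun h => hi (Subtype.ext h)
    have htop := ContinuousMap.subalgebra_topologicalClosure_eq_top_of_separatesPoints Al hsep
    have hAlV : (Al : Set C(ι → unitInterval, ℝ)) ⊆ V := by
      have h1 : Subalgebra.toSubmodule Al ≤ V := by
        rw [Algebra.adjoin_eq_span, Submodule.span_le]
        intro F hF
        have : ∃ k : ι → ℕ, F = ∏ i, co i ^ k i := by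
          induction hF using Submonoid.closure_induction with
          | mem x hx =>
            obtain ⟨i, rfl⟩ := hx
            refine ⟨Pi.single i 1, ?_⟩
            rw [Finset.prod_eq_single i]
            · simp
            · intro j _ hj; simp [hj]
            · simp
          | one => exact ⟨0, by simp⟩
          | mul x y _ _ hx hy =>
            obtain ⟨k, rfl⟩ := hx
            obtain ⟨l, rfl⟩ := hy
            exact ⟨k + l, by simp [pow_add, Finset.prod_mul_distrib]⟩
        obtain ⟨k, rfl⟩ := this
        have := h k
        simpa [V, co] using this
      exact h1
    intro F
    have : F ∈ Al.topologicalClosure := by rw [htop]; trivial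
    exact closure_minimal hAlV hVc this
  -- Closed sets form a π-system that generates the Borel sets, and the indicator of each is a limit
  -- of the continuous functions `apprSeq`.
  refine Measurable.measure_of_isPiSystem (S := {C | IsClosed C})
    (by rw [← borel_eq_generateFrom_isClosed]; exact BorelSpace.measurable_eq)
    isPiSystem_isClosed ?_ ?_
  · intro C hC
    have hl : ∀ a, Tendsto (fun n => ∫⁻ x, hC.apprSeq n x ∂(R a)) atTop (𝓝 (R a C)) := fun a =>
      HasOuterApproxClosed.tendsto_lintegral_apprSeq hC (R a)
    refine measurable_of_tendsto_metrizable (f := fun n a => ∫⁻ x, hC.apprSeq n x ∂(R a))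
      (fun n => ?_) (tendsto_pi_nhds.2 hl)
    have h1 := (hcont ⟨fun y => (hC.apprSeq n y : ℝ),
      NNReal.continuous_coe.comp (hC.apprSeq n).continuous⟩).ennreal_ofReal
    convert! h1 using 1
    ext a
    have h2 : Continuous fun y => (hC.apprSeq n y : ℝ) :=
      NNReal.continuous_coe.comp (hC.apprSeq n).continuous
    change _ = ENNReal.ofReal (∫ y, (hC.apprSeq n y : ℝ) ∂(R a))
    rw [ofReal_integral_eq_lintegral_ofReal (h2.integrable_of_hasCompactSupport
      (HasCompactSupport.of_compactSpace _)) (Eventually.of_forall fun y => NNReal.coe_nonneg _)]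
    simp
  · have := hcont 1
    simp only [ContinuousMap.one_apply, integral_const, smul_eq_mul, mul_one] at this
    have h2 := this.ennreal_ofReal
    simpa [Measure.real] using h2

/-- Finite measures depend measurably on a parameter if the moments of a generating family of
bounded functions do. -/
theorem measurable_measure_of_moments {A S ι : Type*} [MeasurableSpace A] [mS : MeasurableSpace S]
    (g : ι → S → ℝ≥0∞) (hg : ∀ i, Measurable (g i)) (hg1 : ∀ i s, g i s ≤ 1)
    (hgen : mS = ⨆ i, MeasurableSpace.comap (g i) inferInstance)
    (R : A → Measure S) [∀ a, IsFiniteMeasure (R a)]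
    (h : ∀ (t : Finset ι) (k : ι → ℕ), Measurable fun a => ∫⁻ s, ∏ i ∈ t, g i s ^ k i ∂(R a)) :
    Measurable R := by
  classical
  refine Measurable.measure_of_isPiSystem
    (S := piiUnionInter (fun i => {s | MeasurableSet[MeasurableSpace.comap (g i) inferInstance] s})
      univ) ?_ (isPiSystem_piiUnionInter _ (fun i =>
        @MeasurableSpace.isPiSystem_measurableSet _ (MeasurableSpace.comap (g i) inferInstance)) _)
    ?_ ?_
  · have := generateFrom_piiUnionInter_measurableSet
      (fun i => MeasurableSpace.comap (g i) inferInstance) univ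
    rw [hgen]
    simpa using this.symm
  · rintro s ⟨t, -, f, hf, rfl⟩
    choose! C hC hCf using hf
    -- A set of the π-system involves finitely many of the functions only. They map into a
    -- finite-dimensional cube, where the moments of the image measure are the given ones.
    let G : S → (t → unitInterval) := fun s i =>
      ⟨(g i s).toReal, ENNReal.toReal_nonneg, ENNReal.toReal_le_of_le_ofReal zero_le_one
        (by simpa using hg1 i s)⟩
    have hG : Measurable G := measurable_pi_lambda _ fun i =>
      ((hg i).ennreal_toReal).subtype_mk
    have hm : Measurable fun a => (R a).map G := by
      refine measurable_measure_cube _ fun k => ?_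
      convert! (h t (fun i => if hi : i ∈ t then k ⟨i, hi⟩ else 0)).ennreal_toReal using 1
      ext a
      have hk : Measurable fun y : t → unitInterval => ∏ i, (y i : ℝ) ^ k i :=
        Finset.measurable_prod _ fun i _ =>
          (measurable_subtype_coe.comp (measurable_pi_apply i)).pow_const _
      rw [integral_map hG.aemeasurable hk.aestronglyMeasurable, ← integral_toReal]
      · refine integral_congr_ae (Eventually.of_forall fun s => ?_)
        simp only [ENNReal.toReal_prod, ENNReal.toReal_pow, G]
        rw [← Finset.prod_coe_sort t]
        simp
      · exact (Finset.measurable_prod _ fun i _ => (hg i).pow_const _).aemeasurable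
      · refine Eventually.of_forall fun s => lt_of_le_of_lt (Finset.prod_le_one' fun i _ =>
          pow_le_one' (hg1 i s) _) ENNReal.one_lt_top
    have hB : MeasurableSet {y : t → unitInterval | ∀ i : t, ENNReal.ofReal (y i) ∈ C i} := by
      rw [Set.ofPred_forall]
      exact MeasurableSet.iInter fun i => (by fun_prop :
        Measurable fun y : t → unitInterval => ENNReal.ofReal (y i)) (hC i i.2)
    have := (Measure.measurable_coe hB).comp hm
    convert! this using 1
    ext a
    rw [Function.comp_apply, Measure.map_apply hG hB]
    congr 1
    ext s
    simp only [mem_preimage, Set.mem_ofPred_eq, G, mem_iInter, Subtype.forall]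
    refine forall₂_congr fun i hi => ?_
    rw [ENNReal.ofReal_toReal (ne_top_of_le_ne_top ENNReal.one_ne_top (hg1 i s)), ← hCf i hi]
    rfl
  · simpa using h ∅ 0

/-- Finite measures are determined by the moments of a generating family of bounded functions. -/
theorem measure_ext_of_moments {S ι : Type*} [mS : MeasurableSpace S]
    (g : ι → S → ℝ≥0∞) (hg : ∀ i, Measurable (g i)) (hg1 : ∀ i s, g i s ≤ 1)
    (hgen : mS = ⨆ i, MeasurableSpace.comap (g i) inferInstance)
    (ρ ρ' : Measure S) [IsFiniteMeasure ρ] [IsFiniteMeasure ρ']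
    (h : ∀ (t : Finset ι) (k : ι → ℕ),
      ∫⁻ s, ∏ i ∈ t, g i s ^ k i ∂ρ = ∫⁻ s, ∏ i ∈ t, g i s ^ k i ∂ρ') : ρ = ρ' := by
  -- Uniqueness follows from measurability: a measurable function on a two-point space with the
  -- trivial σ-algebra is constant, and here equal moments are measurable because they are constant.
  let _ : MeasurableSpace Bool := ⊥
  let R : Bool → Measure S := fun b => cond b ρ ρ'
  have : ∀ b, IsFiniteMeasure (R b) := by rintro (_ | _) <;> assumption
  have hR : Measurable R := measurable_measure_of_moments g hg hg1 hgen R fun t k => by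
    have : (fun a => ∫⁻ s, ∏ i ∈ t, g i s ^ k i ∂(R a)) =
        fun _ => ∫⁻ s, ∏ i ∈ t, g i s ^ k i ∂ρ := by
      ext a
      cases a
      · exact (h t k).symm
      · rfl
    rw [this]
    exact measurable_const
  ext B hB
  have h1 : Measurable fun b => R b B := (Measure.measurable_coe hB).comp hR
  have h2 : MeasurableSet[⊥] ((fun b => R b B) ⁻¹' {R true B}) := h1 (measurableSet_singleton _)
  rcases MeasurableSpace.measurableSet_bot_iff.1 h2 with h3 | h3
  · have : true ∈ ((fun b => R b B) ⁻¹' {R true B}) := rfl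
    rw [h3] at this
    exact this.elim
  · have : false ∈ ((fun b => R b B) ⁻¹' {R true B}) := by rw [h3]; trivial
    exact (show R false B = R true B from this).symm

/-- `expNeg` is a measurable embedding, so no information is lost when an unbounded evaluation is
replaced by one with values in [0, 1]. -/
theorem comap_expNeg_comp {S : Type*} (f : S → ℝ≥0∞) :
    MeasurableSpace.comap (fun s => expNeg (f s)) inferInstance =
      MeasurableSpace.comap f inferInstance := by
  conv_rhs => rw [← measurableEmbedding_expNeg.comap_eq, MeasurableSpace.comap_comp]
  rfl

/-! ### Laplace functionals of vectors of measures -/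

/-- Nonnegative bounded measurable vectors of functions. -/
structure IsTest {X : Type*} [MeasurableSpace X] {d : ℕ} (f : Fin d → X → ℝ) : Prop where
  measurable : ∀ j, Measurable (f j)
  nonneg : ∀ j x, 0 ≤ f j x
  bounded : ∃ M, ∀ j x, f j x ≤ M

/-- The function `e^{-∑_j μ_j(f_j)}` of a vector of measures. -/
noncomputable def laplaceTest {X : Type*} [MeasurableSpace X] {d : ℕ} (f : Fin d → X → ℝ)
    (μ : Fin d → Measure X) : ℝ≥0∞ :=
  expNeg (∑ j, ∫⁻ x, ENNReal.ofReal (f j x) ∂(μ j))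

theorem measurable_laplaceTest {X : Type*} [MeasurableSpace X] {d : ℕ} {f : Fin d → X → ℝ}
    (hf : IsTest f) : Measurable (laplaceTest f) := by
  refine measurable_expNeg.comp (Finset.measurable_sum _ fun j _ => ?_)
  exact (Measure.measurable_lintegral (hf.measurable j).ennreal_ofReal).comp (measurable_pi_apply j)

theorem laplaceTest_le_one {X : Type*} [MeasurableSpace X] {d : ℕ} (f : Fin d → X → ℝ)
    (μ : Fin d → Measure X) : laplaceTest f μ ≤ 1 := expNeg_le_one _

theorem measurable_expNeg_apply {X : Type*} [MeasurableSpace X] {d : ℕ} (j : Fin d) {B : Set X}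
    (hB : MeasurableSet B) : Measurable fun μ : Fin d → Measure X => expNeg (μ j B) :=
  measurable_expNeg.comp ((Measure.measurable_coe hB).comp (measurable_pi_apply j))

/-- The evaluations at measurable sets generate the σ-algebra; composing with `expNeg` makes the
generators bounded, as the moment criteria require. -/
theorem measurableSpace_pi_measure_eq (X : Type*) [MeasurableSpace X] (d : ℕ) :
    (MeasurableSpace.pi : MeasurableSpace (Fin d → Measure X)) =
      ⨆ i : Fin d × {B : Set X // MeasurableSet B}, MeasurableSpace.comap
        (fun μ : Fin d → Measure X => expNeg (μ i.1 i.2.1)) inferInstance := by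
  simp_rw [comap_expNeg_comp, iSup_prod, iSup_subtype]
  change ⨆ j, MeasurableSpace.comap _ (⨆ B, ⨆ _, _) = _
  simp_rw [MeasurableSpace.comap_iSup, MeasurableSpace.comap_comp]
  rfl

/-- Exponents add up: the test function in coordinate j is the sum of the k_i 1_{B_i} over the pairs
with index j. Hence the moments of the generating family are themselves Laplace functionals. -/
theorem exists_isTest_prod_expNeg {X : Type*} [MeasurableSpace X] {d : ℕ}
    (t : Finset (Fin d × {B : Set X // MeasurableSet B}))
    (k : Fin d × {B : Set X // MeasurableSet B} → ℕ) :
    ∃ f : Fin d → X → ℝ, IsTest f ∧ ∀ μ : Fin d → Measure X,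
      ∏ i ∈ t, expNeg (μ i.1 i.2.1) ^ k i = laplaceTest f μ := by
  classical
  refine ⟨fun j x => ∑ i ∈ t, if i.1 = j then (k i : ℝ) * indicator i.2.1 1 x else 0,
    ⟨fun j => Finset.measurable_sum _ fun i _ => ?_, fun j x => Finset.sum_nonneg fun i _ => ?_,
      ∑ i ∈ t, (k i : ℝ), fun j x => Finset.sum_le_sum fun i _ => ?_⟩, fun μ => ?_⟩
  · split_ifs
    · exact (measurable_one.indicator i.2.2).const_mul _
    · exact measurable_const
  · split_ifs
    · exact mul_nonneg (by positivity) (indicator_nonneg (by simp) _)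
    · exact le_rfl
  · split_ifs
    · exact mul_le_of_le_one_right (by positivity) (indicator_le_self' (by simp) _)
    · positivity
  · unfold laplaceTest
    have h1 : ∀ i, expNeg (μ i.1 i.2.1) ^ k i = expNeg ((k i : ℝ≥0∞) * μ i.1 i.2.1) := by
      intro i
      rw [← nsmul_eq_mul, ← Finset.card_range (k i), ← Finset.sum_const, expNeg_sum]
      simp
    simp_rw [h1, ← expNeg_sum]
    congr 1
    have h2 : ∀ j x, ENNReal.ofReal
        (∑ i ∈ t, if i.1 = j then (k i : ℝ) * indicator i.2.1 1 x else 0) =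
        ∑ i ∈ t, if i.1 = j then (k i : ℝ≥0∞) * indicator i.2.1 1 x else 0 := by
      intro j x
      rw [ENNReal.ofReal_sum_of_nonneg]
      · refine Finset.sum_congr rfl fun i _ => ?_
        by_cases hx : x ∈ i.2.1 <;> split_ifs <;> simp [hx]
      · intro i _
        split_ifs
        · exact mul_nonneg (by positivity) (indicator_nonneg (by simp) _)
        · exact le_rfl
    have h3 : ∀ (j : Fin d) (i : Fin d × {B : Set X // MeasurableSet B}),
        Measurable fun x => if i.1 = j then (k i : ℝ≥0∞) * indicator i.2.1 1 x else 0 := by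
      intro j i
      split_ifs
      · exact (measurable_one.indicator i.2.2).const_mul _
      · exact measurable_const
    simp_rw [h2]
    simp_rw [lintegral_finsetSum t (fun i _ => h3 _ i)]
    rw [Finset.sum_comm]
    refine Finset.sum_congr rfl fun i _ => ?_
    rw [Finset.sum_eq_single i.1]
    · simp only [if_true]
      rw [lintegral_const_mul _ (measurable_one.indicator i.2.2), lintegral_indicator_one i.2.2]
    · intro j _ hj
      simp [hj.symm]
    · simp

theorem measurable_measure_of_laplaceTest {A X : Type*} [MeasurableSpace A] [MeasurableSpace X]
    {d : ℕ} (R : A → Measure (Fin d → Measure X)) [∀ a, IsFiniteMeasure (R a)]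
    (h : ∀ f, IsTest f → Measurable fun a => ∫⁻ μ, laplaceTest f μ ∂(R a)) : Measurable R := by
  have hm : ∀ i : Fin d × {B : Set X // MeasurableSet B},
      Measurable fun μ : Fin d → Measure X => expNeg (μ i.1 i.2.1) :=
    fun i => measurable_expNeg_apply i.1 i.2.2
  refine measurable_measure_of_moments _ hm
    (fun _ _ => expNeg_le_one _) (measurableSpace_pi_measure_eq X d) R fun t k => ?_
  obtain ⟨f, hf, hfe⟩ := exists_isTest_prod_expNeg t k
  simp_rw [hfe]
  exact h f hf

theorem measure_ext_of_laplaceTest {X : Type*} [MeasurableSpace X] {d : ℕ}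
    (ρ ρ' : Measure (Fin d → Measure X)) [IsFiniteMeasure ρ] [IsFiniteMeasure ρ']
    (h : ∀ f, IsTest f → ∫⁻ μ, laplaceTest f μ ∂ρ = ∫⁻ μ, laplaceTest f μ ∂ρ') : ρ = ρ' := by
  have hm : ∀ i : Fin d × {B : Set X // MeasurableSet B},
      Measurable fun μ : Fin d → Measure X => expNeg (μ i.1 i.2.1) :=
    fun i => measurable_expNeg_apply i.1 i.2.2
  refine measure_ext_of_moments _ hm
    (fun _ _ => expNeg_le_one _) (measurableSpace_pi_measure_eq X d) ρ ρ' fun t k => ?_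
  obtain ⟨f, hf, hfe⟩ := exists_isTest_prod_expNeg t k
  simp_rw [hfe]
  exact h f hf

/-! ### Poisson processes and their Laplace functionals -/

theorem lintegral_pi_prod {ι : Type*} [Fintype ι] {Y : ι → Type*} [∀ i, MeasurableSpace (Y i)]
    (μ : ∀ i, Measure (Y i)) [∀ i, IsProbabilityMeasure (μ i)] (f : ∀ i, Y i → ℝ≥0∞)
    (hf : ∀ i, Measurable (f i)) :
    ∫⁻ y, ∏ i, f i (y i) ∂(Measure.pi μ) = ∏ i, ∫⁻ y, f i y ∂(μ i) := by
  rw [lintegral_prod_eq_prod_lintegral_of_indepFun Finset.univ (X := fun i (y : ∀ i, Y i) => f i (y i))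
    (iIndepFun_pi fun i => (hf i).aemeasurable) fun i => (hf i).comp (measurable_pi_apply i)]
  refine Finset.prod_congr rfl fun i _ => ?_
  exact (measurePreserving_eval μ i).lintegral_comp (hf i)

theorem expNeg_nat_mul (t : ℝ≥0∞) (k : ℕ) : expNeg (t * k) = expNeg t ^ k := by
  rw [mul_comm, ← nsmul_eq_mul, ← Finset.card_range k, ← Finset.sum_const, expNeg_sum]
  simp

theorem tendsto_one_sub_expNeg {ι : Type*} {l : Filter ι} {f : ι → ℝ≥0∞} {x : ℝ≥0∞}
    (h : Tendsto f l (𝓝 x)) : Tendsto (fun i => 1 - expNeg (f i)) l (𝓝 (1 - expNeg x)) :=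
  ENNReal.Tendsto.sub tendsto_const_nhds ((continuous_expNeg.tendsto x).comp h)
    (Or.inl ENNReal.one_ne_top)

/-- The exponential series with terms (rc)^k / k!. With c = e^{-t} it gives the Laplace transform of
the Poisson law. -/
theorem lintegral_pow_poissonMeasure (r : NNReal) {c : ℝ≥0∞} (hc : c ≤ 1) :
    ∫⁻ k, c ^ k ∂(poissonMeasure r) = expNeg (r * (1 - c)) := by
  have hct : c ≠ ∞ := ne_top_of_le_ne_top ENNReal.one_ne_top hc
  lift c to NNReal using hct
  have hc' : c ≤ 1 := by exact_mod_cast hc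
  rw [lintegral_countable']
  have h1 : (r : ℝ≥0∞) * (1 - c) = ENNReal.ofReal ((r : ℝ) * (1 - c)) := by
    rw [ENNReal.ofReal_mul (NNReal.coe_nonneg r), ENNReal.ofReal_sub _ (NNReal.coe_nonneg c)]
    simp
  have hc1 : (0 : ℝ) ≤ 1 - c := sub_nonneg.2 (by exact_mod_cast hc')
  rw [h1, expNeg_ofReal (mul_nonneg (NNReal.coe_nonneg r) hc1)]
  have h2 : ∀ k : ℕ, (c : ℝ≥0∞) ^ k * poissonMeasure r {k} =
      ENNReal.ofReal (Real.exp (-r) * ((r * c : ℝ) ^ k / k.factorial)) := by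
    intro k
    rw [poissonMeasure_singleton, ← ENNReal.ofReal_coe_nnreal, ← ENNReal.ofReal_pow (NNReal.coe_nonneg c),
      ← ENNReal.ofReal_mul (by positivity)]
    congr 1
    ring
  simp_rw [h2]
  have h3 := (NormedSpace.expSeries_div_hasSum_exp (r * c : ℝ)).mul_left (Real.exp (-r))
  rw [← ENNReal.ofReal_tsum_of_nonneg (fun k => by positivity) h3.summable, h3.tsum_eq,
    ← Real.exp_eq_exp_ℝ, ← Real.exp_add]
  congr 2
  ring

theorem lintegral_expNeg_mul_of_hasLaw_poisson {Ω : Type*} [MeasurableSpace Ω] {P : Measure Ω}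
    {Y : Ω → ℝ≥0∞} {r : NNReal}
    (h : HasLaw Y ((poissonMeasure r).map (fun k : ℕ => (k : ℝ≥0∞))) P) (t : ℝ≥0∞) :
    ∫⁻ ω, expNeg (t * Y ω) ∂P = expNeg (r * (1 - expNeg t)) := by
  have hm : Measurable fun y : ℝ≥0∞ => expNeg (t * y) := measurable_expNeg.comp (by fun_prop)
  have h1 := lintegral_map' (μ := P) (f := fun y : ℝ≥0∞ => expNeg (t * y)) hm.aemeasurable
    h.aemeasurable
  rw [← h1, h.map_eq, lintegral_map hm (by fun_prop)]
  simp_rw [expNeg_nat_mul]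
  exact lintegral_pow_poissonMeasure r (expNeg_le_one t)

namespace IsPoissonProcess

variable {Ω E : Type*} [MeasurableSpace Ω] [MeasurableSpace E] {P : Measure Ω}
  {N : Ω → Measure E} {Λ : Measure E}

theorem measurable_apply (h : IsPoissonProcess P N Λ) {B : Set E} (hB : MeasurableSet B) :
    Measurable fun ω => N ω B := (Measure.measurable_coe hB).comp h.measurable

/-- Independence over disjoint sets, after an enumeration of the index set by `Fin`, the only index
type for which `IsPoissonProcess` states independence. -/
theorem lintegral_prod_expNeg (h : IsPoissonProcess P N Λ) {ι : Type*} (s : Finset ι)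
    (B : ι → Set E) (t : ι → ℝ≥0∞) (hB : ∀ i ∈ s, MeasurableSet (B i))
    (hd : (s : Set ι).PairwiseDisjoint B) (hΛ : ∀ i ∈ s, Λ (B i) ≠ ∞) :
    ∫⁻ ω, ∏ i ∈ s, expNeg (t i * N ω (B i)) ∂P =
      ∏ i ∈ s, expNeg ((1 - expNeg (t i)) * Λ (B i)) := by
  let e := s.equivFin
  have h1 : iIndepFun (fun a ω => N ω (B (e.symm a))) P := by
    refine h.indep _ (fun a => B (e.symm a)) (fun a => hB _ (e.symm a).2) fun a b hab => ?_
    exact hd (e.symm a).2 (e.symm b).2 fun h => hab (e.symm.injective (Subtype.ext h))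
  have h2 : iIndepFun (fun a ω => expNeg (t (e.symm a) * N ω (B (e.symm a)))) P :=
    h1.comp (fun a y => expNeg (t (e.symm a) * y)) fun a => measurable_expNeg.comp (by fun_prop)
  have h3 : ∀ ω, ∏ i ∈ s, expNeg (t i * N ω (B i)) =
      ∏ a, expNeg (t (e.symm a) * N ω (B (e.symm a))) := fun ω => by
    rw [← Finset.prod_coe_sort s]
    exact (Equiv.prod_comp e.symm (fun i : s => expNeg (t i * N ω (B i)))).symm
  simp_rw [h3]
  rw [lintegral_prod_eq_prod_lintegral_of_indepFun Finset.univ _ h2 fun a =>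
    measurable_expNeg.comp ((h.measurable_apply (hB _ (e.symm a).2)).const_mul _)]
  rw [← Finset.prod_coe_sort s, ← Equiv.prod_comp e.symm]
  refine Finset.prod_congr rfl fun a _ => ?_
  rw [lintegral_expNeg_mul_of_hasLaw_poisson (h.poisson _ (hB _ (e.symm a).2)
    (hΛ _ (e.symm a).2)), ENNReal.coe_toNNReal (hΛ _ (e.symm a).2), mul_comm]

theorem laplace_simpleFunc (h : IsPoissonProcess P N Λ) (f : SimpleFunc E ℝ≥0∞)
    (hf : Λ (Function.support f) ≠ ∞) :
    ∫⁻ ω, expNeg (∫⁻ x, f x ∂(N ω)) ∂P = expNeg (∫⁻ x, 1 - expNeg (f x) ∂Λ) := by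
  classical
  -- The value 0 is discarded: its fibre may have infinite intensity, and it contributes nothing to
  -- either side.
  have h1 : ∀ ω, ∫⁻ x, f x ∂(N ω) = ∑ y ∈ f.range.erase 0, y * N ω (f ⁻¹' {y}) := fun ω => by
    rw [SimpleFunc.lintegral_eq_lintegral]
    exact SimpleFunc.lintegral_eq_of_subset' _ (by simp [Finset.erase_eq])
  have h2 : ∫⁻ x, 1 - expNeg (f x) ∂Λ =
      ∑ y ∈ f.range.erase 0, (1 - expNeg y) * Λ (f ⁻¹' {y}) := by
    have h3 := SimpleFunc.map_lintegral (μ := Λ) (fun y : ℝ≥0∞ => 1 - expNeg y) f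
    rw [← SimpleFunc.lintegral_eq_lintegral] at h3
    refine h3.trans (Finset.sum_erase _ ?_).symm
    simp [expNeg_zero]
  simp_rw [h1, h2, expNeg_sum]
  refine h.lintegral_prod_expNeg _ _ _ (fun y _ => f.measurableSet_fiber y) ?_ fun y hy => ?_
  · intro y _ z _ hyz
    exact Disjoint.preimage _ (by simpa using hyz)
  · refine ne_top_of_le_ne_top hf (measure_mono fun x hx => ?_)
    rw [Function.mem_support, show f x = y from hx]
    exact (Finset.mem_erase.1 hy).1

/-- The Laplace functional of a Poisson process. -/
theorem laplace [IsProbabilityMeasure P] [SigmaFinite Λ] (h : IsPoissonProcess P N Λ)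
    {f : E → ℝ≥0∞} (hf : Measurable f) :
    ∫⁻ ω, expNeg (∫⁻ x, f x ∂(N ω)) ∂P = expNeg (∫⁻ x, 1 - expNeg (f x) ∂Λ) := by
  -- Cutting the simple approximations off on the spanning sets gives supports of finite intensity
  -- and keeps the convergence monotone. The left side then converges by domination by 1, the right
  -- side by monotone convergence.
  let F : ℕ → SimpleFunc E ℝ≥0∞ := fun n => (SimpleFunc.eapprox f n).restrict (spanningSets Λ n)
  have hF : ∀ n x, F n x = (spanningSets Λ n).indicator (SimpleFunc.eapprox f n) x := fun n x => by
    rw [SimpleFunc.restrict_apply _ (measurableSet_spanningSets Λ n)]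
  have hmono : ∀ x, Monotone fun n => F n x := by
    intro x n m hnm
    simp only [hF]
    exact (indicator_le_indicator_of_subset (monotone_spanningSets Λ hnm) (fun _ => zero_le)
      x).trans (indicator_le_indicator (SimpleFunc.monotone_eapprox f hnm x))
  have hlim : ∀ x, Tendsto (fun n => F n x) atTop (𝓝 (f x)) := by
    intro x
    have h1 : Tendsto (fun n => SimpleFunc.eapprox f n x) atTop (𝓝 (f x)) := by
      rw [← SimpleFunc.iSup_eapprox_apply hf x]
      exact tendsto_atTop_iSup fun n m hnm => SimpleFunc.monotone_eapprox f hnm x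
    refine h1.congr' ?_
    filter_upwards [eventually_ge_atTop (spanningSetsIndex Λ x)] with n hn
    rw [hF, indicator_of_mem (mem_spanningSets_of_index_le Λ x hn)]
  have hL : Tendsto (fun n => ∫⁻ ω, expNeg (∫⁻ x, F n x ∂(N ω)) ∂P) atTop
      (𝓝 (∫⁻ ω, expNeg (∫⁻ x, f x ∂(N ω)) ∂P)) := by
    refine tendsto_lintegral_of_dominated_convergence (fun _ => 1) (fun n => ?_)
      (fun n => Eventually.of_forall fun ω => expNeg_le_one _) (by simp)
      (Eventually.of_forall fun ω => ?_)
    · exact measurable_expNeg.comp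
        ((Measure.measurable_lintegral (F n).measurable).comp h.measurable)
    · exact (continuous_expNeg.tendsto _).comp (lintegral_tendsto_of_tendsto_of_monotone
        (fun n => (F n).measurable.aemeasurable) (Eventually.of_forall hmono)
        (Eventually.of_forall hlim))
  have hR : Tendsto (fun n => expNeg (∫⁻ x, 1 - expNeg (F n x) ∂Λ)) atTop
      (𝓝 (expNeg (∫⁻ x, 1 - expNeg (f x) ∂Λ))) := by
    refine (continuous_expNeg.tendsto _).comp (lintegral_tendsto_of_tendsto_of_monotone
        (fun n => (measurable_const.sub (measurable_expNeg.comp (F n).measurable)).aemeasurable)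
        (Eventually.of_forall fun x n m hnm => ?_) (Eventually.of_forall fun x => ?_))
    · exact tsub_le_tsub_left (antitone_expNeg (hmono x hnm)) 1
    · exact tendsto_one_sub_expNeg (hlim x)
  refine tendsto_nhds_unique hL (hR.congr fun n => ?_)
  refine (h.laplace_simpleFunc (F n) (ne_top_of_le_ne_top
    (measure_spanningSets_lt_top Λ n).ne (measure_mono fun x hx => ?_))).symm
  by_contra hx'
  exact hx (by rw [hF, indicator_of_notMem hx'])

/-- A random measure with the Laplace functional of a Poisson process is a Poisson process. -/
theorem of_laplace [IsProbabilityMeasure P] (hN : Measurable N)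
    (h : ∀ (r : ℕ) (B : Fin r → Set E) (k : Fin r → ℕ), (∀ a, MeasurableSet (B a)) →
      Pairwise (fun a b => Disjoint (B a) (B b)) →
      ∫⁻ ω, ∏ a, expNeg (k a * N ω (B a)) ∂P = ∏ a, expNeg ((1 - expNeg (k a)) * Λ (B a))) :
    IsPoissonProcess P N Λ := by
  have hm : ∀ B, MeasurableSet B → Measurable fun ω => N ω B := fun B hB =>
    (Measure.measurable_coe hB).comp hN
  have h1 : ∀ (B : Set E) (k : ℕ), MeasurableSet B →
      ∫⁻ ω, expNeg (k * N ω B) ∂P = expNeg ((1 - expNeg k) * Λ B) := by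
    intro B k hB
    simpa using h 1 (fun _ => B) (fun _ => k) (fun _ => hB)
      (fun a b hab => (hab (Subsingleton.elim _ _)).elim)
  refine ⟨hN, fun B hB hΛ => ⟨(hm B hB).aemeasurable, ?_⟩, fun r B hB hd => ?_⟩
  · have := Measure.isProbabilityMeasure_map (μ := P) (hm B hB).aemeasurable
    have : IsProbabilityMeasure ((poissonMeasure (Λ B).toNNReal).map (fun r : ℕ => (r : ℝ≥0∞))) :=
      Measure.isProbabilityMeasure_map (by fun_prop)
    -- Natural multiples in the exponent suffice, since they give the moments of the bounded
    -- variable e^{-N(B)}.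
    refine measure_ext_of_moments (ι := Unit) (fun _ => expNeg) (fun _ => measurable_expNeg)
      (fun _ => expNeg_le_one) (by rw [iSup_const]; exact measurableEmbedding_expNeg.comap_eq.symm)
      _ _ fun t k => ?_
    have h2 : ∀ s : ℝ≥0∞, ∏ i ∈ t, expNeg s ^ k i = expNeg ((∑ i ∈ t, k i : ℕ) * s) := by
      intro s
      rw [mul_comm, expNeg_nat_mul, Finset.prod_pow_eq_pow_sum]
    have hmm : Measurable fun s => expNeg ((∑ i ∈ t, k i : ℕ) * s) :=
      measurable_expNeg.comp (measurable_id.const_mul _)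
    simp_rw [h2]
    rw [lintegral_map hmm (hm B hB), h1 B _ hB, lintegral_map hmm (by fun_prop)]
    simp_rw [expNeg_nat_mul]
    rw [lintegral_pow_poissonMeasure _ (expNeg_le_one _), ENNReal.coe_toNNReal hΛ, mul_comm]
  · rw [iIndepFun_iff_map_fun_eq_pi_map fun a => (hm _ (hB a)).aemeasurable]
    have hmp : Measurable fun ω a => N ω (B a) := measurable_pi_lambda _ fun a => hm _ (hB a)
    have := Measure.isProbabilityMeasure_map (μ := P) hmp.aemeasurable
    have : ∀ a, IsProbabilityMeasure (P.map fun ω => N ω (B a)) := fun a =>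
      Measure.isProbabilityMeasure_map (hm _ (hB a)).aemeasurable
    refine measure_ext_of_moments (ι := Fin r) (fun a (y : Fin r → ℝ≥0∞) => expNeg (y a))
      (fun a => measurable_expNeg.comp (measurable_pi_apply a))
      (fun a y => expNeg_le_one (y a)) ?_ _ _ fun t k => ?_
    · simp_rw [comap_expNeg_comp]
      rfl
    -- Exponents are extended by 0 outside `t`, so that the transform over all r sets applies.
    · let k' : Fin r → ℕ := fun a => if a ∈ t then k a else 0
      have h2 : ∀ y : Fin r → ℝ≥0∞,
          ∏ a ∈ t, expNeg (y a) ^ k a = ∏ a, expNeg (k' a * y a) := by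
        intro y
        simp_rw [mul_comm _ (y _), expNeg_nat_mul, k']
        simp [Finset.prod_ite_mem, pow_ite]
      have hmm : ∀ a, Measurable fun s => expNeg (k' a * s) := fun a =>
        measurable_expNeg.comp (measurable_id.const_mul _)
      simp_rw [h2]
      have hmm' : Measurable fun y : Fin r → ℝ≥0∞ => ∏ a, expNeg (k' a * y a) :=
        Finset.measurable_prod _ fun a _ => (hmm a).comp (measurable_pi_apply a)
      rw [lintegral_map hmm' hmp, h r B k' hB hd, lintegral_pi_prod _ _ hmm]
      refine Finset.prod_congr rfl fun a _ => ?_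
      rw [lintegral_map (hmm a) (hm _ (hB a)), h1 _ _ (hB a)]

end IsPoissonProcess

/-! ### Gamma laws -/

/-- Gamma conjugacy: the factor e^{-tv} moves the rate from r to r + v, and the normalizing
constants r^a and (r + v)^a leave the quotient in front. -/
theorem expNeg_mul_gammaPDF {a r v : ℝ} (hr : 0 < r) (hv : 0 ≤ v) (t : ℝ) :
    expNeg (ENNReal.ofReal (t * v)) * gammaPDF a r t =
      ENNReal.ofReal ((r / (r + v)) ^ a) * gammaPDF a (r + v) t := by
  rcases lt_or_ge t 0 with ht | ht
  · simp [gammaPDF_of_neg ht]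
  · have hrv : 0 < r + v := by linarith
    rw [gammaPDF_of_nonneg ht, gammaPDF_of_nonneg ht, expNeg_ofReal (mul_nonneg ht hv),
      ← ENNReal.ofReal_mul (Real.exp_pos _).le, ← ENNReal.ofReal_mul (by positivity)]
    congr 1
    rw [Real.div_rpow hr.le hrv.le]
    have h1 : Real.exp (-((r + v) * t)) = Real.exp (-(t * v)) * Real.exp (-(r * t)) := by
      rw [← Real.exp_add]; congr 1; ring
    have h2 : (r + v) ^ a ≠ 0 := (Real.rpow_pos_of_pos hrv a).ne'
    rw [h1]
    field_simp

/-- Keeping the set B yields at once the normalizing factor of a tilted score (B everything) and its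
tilted law. This is where the posterior rates of the scores come from. -/
theorem setLIntegral_expNeg_gammaMeasure {a r v : ℝ} (hr : 0 < r) (hv : 0 ≤ v) {B : Set ℝ}
    (hB : MeasurableSet B) :
    ∫⁻ t in B, expNeg (ENNReal.ofReal (t * v)) ∂(gammaMeasure a r) =
      ENNReal.ofReal ((r / (r + v)) ^ a) * gammaMeasure a (r + v) B := by
  have hp : ∀ r, Measurable (gammaPDF a r) := fun r => (measurable_gammaPDFReal a r).ennreal_ofReal
  have he : Measurable fun t : ℝ => expNeg (ENNReal.ofReal (t * v)) :=
    measurable_expNeg.comp (by fun_prop)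
  unfold gammaMeasure
  rw [setLIntegral_withDensity_eq_setLIntegral_mul _ (hp r) he hB, withDensity_apply _ hB,
    ← lintegral_const_mul _ (hp _)]
  refine lintegral_congr fun t => ?_
  rw [Pi.mul_apply, mul_comm, expNeg_mul_gammaPDF hr hv]

theorem lintegral_expNeg_gammaMeasure {a r v : ℝ} (ha : 0 < a) (hr : 0 < r) (hv : 0 ≤ v) :
    ∫⁻ t, expNeg (ENNReal.ofReal (t * v)) ∂(gammaMeasure a r) =
      ENNReal.ofReal ((r / (r + v)) ^ a) := by
  have := isProbabilityMeasure_gammaMeasure ha (show 0 < r + v by linarith)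
  have h := setLIntegral_expNeg_gammaMeasure (a := a) hr hv MeasurableSet.univ
  rwa [setLIntegral_univ, measure_univ, mul_one] at h

theorem ae_pos_gammaMeasure (a r : ℝ) : ∀ᵐ t ∂(gammaMeasure a r), 0 < t := by
  have hp : Measurable (gammaPDF a r) := (measurable_gammaPDFReal a r).ennreal_ofReal
  unfold gammaMeasure
  rw [ae_withDensity_iff hp]
  filter_upwards [compl_mem_ae_iff.2 (measure_singleton (0 : ℝ))] with t ht h
  by_contra h'
  exact h (gammaPDF_of_neg (lt_of_le_of_ne (not_lt.1 h') ht))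

/-- A linear change of variables. It serves twice: for a fixed mass it gives the law of a latent
variable, and it produces the jumps with random rate from standard gamma variables. -/
theorem gammaMeasure_map_div {a r : ℝ} (hr : 0 < r) :
    (gammaMeasure a 1).map (fun t => t / r) = gammaMeasure a r := by
  have hp : ∀ r, Measurable (gammaPDF a r) := fun r => (measurable_gammaPDFReal a r).ennreal_ofReal
  ext B hB
  have hm : Measurable fun t : ℝ => t / r := by fun_prop
  unfold gammaMeasure
  rw [Measure.map_apply hm hB, withDensity_apply _ (hm hB), withDensity_apply _ hB]
  have hv : (volume : Measure ℝ) = ENNReal.ofReal r • Measure.map (r * ·) volume := by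
    conv_lhs => rw [← Real.smul_map_volume_mul_left hr.ne', abs_of_pos hr]
  have hi : Measurable fun t => ((fun t : ℝ => t / r) ⁻¹' B).indicator (gammaPDF a 1) (r * t) :=
    ((hp 1).indicator (hm hB)).comp (by fun_prop : Measurable fun t : ℝ => r * t)
  conv_lhs => rw [hv]
  rw [← lintegral_indicator (hm hB), lintegral_smul_measure,
    lintegral_map ((hp 1).indicator (hm hB)) (by fun_prop), ← lintegral_indicator hB, smul_eq_mul,
    ← lintegral_const_mul _ hi]
  refine lintegral_congr fun t => ?_
  have hmem : r * t ∈ (fun t => t / r) ⁻¹' B ↔ t ∈ B := by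
    rw [mem_preimage, mul_div_cancel_left₀ _ hr.ne']
  by_cases ht : t ∈ B
  · rw [indicator_of_mem (hmem.2 ht), indicator_of_mem ht]
    rcases lt_or_ge t 0 with h0 | h0
    · rw [gammaPDF_of_neg h0, gammaPDF_of_neg (mul_neg_of_pos_of_neg hr h0), mul_zero]
    · rw [gammaPDF_of_nonneg h0, gammaPDF_of_nonneg (mul_nonneg hr.le h0),
        ← ENNReal.ofReal_mul hr.le]
      congr 1
      rw [Real.mul_rpow hr.le h0, Real.rpow_sub_one hr.ne', Real.one_rpow]
      field_simp
  · rw [indicator_of_notMem (fun h => ht (hmem.1 h)), indicator_of_notMem ht, mul_zero]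

/-! ### Point processes and scores -/

theorem measurable_pointProcess {Ω X : Type*} [MeasurableSpace Ω] [MeasurableSpace X]
    {J : ℕ → Ω → ℝ} {x : ℕ → Ω → X} (hJ : ∀ i, Measurable (J i)) (hx : ∀ i, Measurable (x i)) :
    Measurable fun ω => pointProcess (fun i => J i ω) (fun i => x i ω) := by
  refine Measure.measurable_of_measurable_coe _ fun B hB => ?_
  unfold pointProcess
  simp_rw [Measure.sum_apply _ hB]
  refine Measurable.tsum fun i => ?_
  have : (fun ω => (if 0 < J i ω then Measure.dirac (J i ω, x i ω) else 0 : Measure (ℝ × X)) B) =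
      fun ω => if 0 < J i ω then B.indicator 1 (J i ω, x i ω) else 0 := by
    ext ω
    split_ifs
    · rw [Measure.dirac_apply' _ hB]
    · rfl
  rw [this]
  exact Measurable.ite (measurableSet_lt measurable_const (hJ i))
    ((measurable_one.indicator hB).comp ((hJ i).prodMk (hx i))) measurable_const

theorem lintegral_pointProcess {X : Type*} [MeasurableSpace X] (J : ℕ → ℝ) (x : ℕ → X)
    {g : ℝ × X → ℝ≥0∞} (hg : Measurable g) :
    ∫⁻ p, g p ∂(pointProcess J x) = ∑' i, if 0 < J i then g (J i, x i) else 0 := by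
  unfold pointProcess
  rw [lintegral_sum_measure]
  refine tsum_congr fun i => ?_
  split_ifs
  · exact lintegral_dirac' _ hg
  · simp

theorem measurable_compound {Ω X : Type*} [MeasurableSpace Ω] [MeasurableSpace X] {d : ℕ}
    {J : ℕ → Ω → ℝ} {x : ℕ → Ω → X} {m : Fin d → ℕ → Ω → ℝ} (hJ : ∀ i, Measurable (J i))
    (hx : ∀ i, Measurable (x i)) (hm : ∀ j i, Measurable (m j i)) :
    Measurable (compound J x m) := by
  refine measurable_pi_lambda _ fun j => Measure.measurable_of_measurable_coe _ fun B hB => ?_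
  unfold compound
  simp_rw [Measure.sum_apply _ hB, Measure.smul_apply, Measure.dirac_apply' _ hB, smul_eq_mul]
  exact Measurable.tsum fun i => ((hm j i).mul (hJ i)).ennreal_ofReal.mul
    ((measurable_one.indicator hB).comp (hx i))

theorem lintegral_compound {Ω X : Type*} [MeasurableSpace X] {d : ℕ}
    (J : ℕ → Ω → ℝ) (x : ℕ → Ω → X) (m : Fin d → ℕ → Ω → ℝ) (ω : Ω) (j : Fin d)
    {f : X → ℝ≥0∞} (hf : Measurable f) :
    ∫⁻ y, f y ∂(compound J x m ω j) = ∑' i, ENNReal.ofReal (m j i ω * J i ω) * f (x i ω) := by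
  unfold compound
  rw [lintegral_sum_measure]
  refine tsum_congr fun i => ?_
  rw [lintegral_smul_measure, lintegral_dirac' _ hf, smul_eq_mul]

namespace HasScores

variable {Ω X : Type*} [MeasurableSpace Ω] [MeasurableSpace X] {d : ℕ} {P : Measure Ω}
  [IsProbabilityMeasure P] {ν : Fin d → Measure ℝ} [∀ j, IsProbabilityMeasure (ν j)]
  {J : ℕ → Ω → ℝ} {x : ℕ → Ω → X} {m : Fin d → ℕ → Ω → ℝ}

/-- Scores whose law does not depend on the heights are i.i.d. and independent of the heights and
locations. -/
theorem map_eq_prod (h : HasScores P (fun _ => ν) J x m) (hJ : ∀ i, Measurable (J i))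
    (hx : ∀ i, Measurable (x i)) (N : ℕ) :
    P.map (fun ω => (((fun i => J i ω), (fun i => x i ω)),
      fun p : Fin d × Fin N => m p.1 p.2 ω)) =
      (P.map fun ω => ((fun i => J i ω), (fun i => x i ω))).prod (Measure.pi fun p => ν p.1) := by
  have hY : Measurable fun ω => ((fun i => J i ω), (fun i => x i ω)) :=
    (measurable_pi_lambda _ hJ).prodMk (measurable_pi_lambda _ hx)
  have hM : Measurable fun ω => fun p : Fin d × Fin N => m p.1 p.2 ω :=
    measurable_pi_lambda _ fun p => h.measurable _ _
  have := Measure.isProbabilityMeasure_map (μ := P) hY.aemeasurable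
  symm
  refine Measure.prod_eq_generateFrom (C := {A | MeasurableSet A})
    (D := pi univ '' pi univ fun _ : Fin d × Fin N => {B : Set ℝ | MeasurableSet B})
    MeasurableSpace.generateFrom_measurableSet generateFrom_pi
    MeasurableSpace.isPiSystem_measurableSet isPiSystem_pi
    ⟨fun _ => univ, fun _ => MeasurableSet.univ, fun _ => measure_lt_top _ _, iUnion_const _⟩
    ⟨fun _ => univ, fun _ => ⟨fun _ => univ, by simp, pi_univ _⟩,
      fun _ => measure_lt_top _ _, iUnion_const _⟩ ?_
  rintro A hA' _ ⟨B, hB, rfl⟩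
  have hA : MeasurableSet A := by simpa using hA'
  have hB' : ∀ p, MeasurableSet (B p) := fun p => by simpa using hB p (mem_univ p)
  let B' : Fin d → ℕ → Set ℝ := fun j i => if hi : i < N then B (j, ⟨i, hi⟩) else univ
  have hB'm : ∀ j i, MeasurableSet (B' j i) := fun j i => by
    simp only [B']
    split_ifs
    · exact hB' _
    · exact MeasurableSet.univ
  rw [Measure.map_apply (hY.prodMk hM) (hA.prod (MeasurableSet.univ_pi hB')),
    Measure.map_apply hY hA, Measure.pi_pi]
  have h1 := h.cond A hA N B' hB'm
  have h2 : (fun ω => (((fun i => J i ω), (fun i => x i ω)),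
      fun p : Fin d × Fin N => m p.1 p.2 ω)) ⁻¹' A ×ˢ univ.pi B =
      {ω | ((fun i => J i ω), (fun i => x i ω)) ∈ A} ∩ {ω | ∀ j, ∀ i < N, m j i ω ∈ B' j i} := by
    ext ω
    simp only [mem_preimage, mem_prod, Set.mem_pi, mem_univ, true_implies, mem_inter_iff,
      Set.mem_ofPred_eq, Prod.forall, B']
    refine and_congr_right fun _ => forall_congr' fun j => ⟨fun H i hi => ?_, fun H i => ?_⟩
    · simpa [hi] using H ⟨i, hi⟩
    · simpa using H i i.2
  rw [h2, h1, setLIntegral_const, mul_comm, Fintype.prod_prod_type]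
  congr 1
  refine Finset.prod_congr rfl fun j _ => ?_
  rw [Finset.prod_range]
  simp [B']

/-- Fubini for the product law of `map_eq_prod`. The integrands may depend on all heights and
locations, because these are frozen while the scores are integrated out. -/
theorem lintegral_mul_prod (h : HasScores P (fun _ => ν) J x m) (hJ : ∀ i, Measurable (J i))
    (hx : ∀ i, Measurable (x i)) (N : ℕ) {F : (ℕ → ℝ) × (ℕ → X) → ℝ≥0∞} (hF : Measurable F)
    {Φ : Fin d → ℕ → (ℕ → ℝ) × (ℕ → X) → ℝ → ℝ≥0∞}
    (hΦ : ∀ j i, Measurable (Function.uncurry (Φ j i))) :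
    ∫⁻ ω, F ((fun i => J i ω), (fun i => x i ω)) * ∏ j, ∏ i ∈ Finset.range N,
        Φ j i ((fun i => J i ω), (fun i => x i ω)) (m j i ω) ∂P =
      ∫⁻ ω, F ((fun i => J i ω), (fun i => x i ω)) * ∏ j, ∏ i ∈ Finset.range N,
        ∫⁻ t, Φ j i ((fun i => J i ω), (fun i => x i ω)) t ∂(ν j) ∂P := by
  have hY : Measurable fun ω => ((fun i => J i ω), (fun i => x i ω)) :=
    (measurable_pi_lambda _ hJ).prodMk (measurable_pi_lambda _ hx)
  have hM : Measurable fun ω => fun p : Fin d × Fin N => m p.1 p.2 ω :=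
    measurable_pi_lambda _ fun p => h.measurable _ _
  have := Measure.isProbabilityMeasure_map (μ := P) hY.aemeasurable
  let H : ((ℕ → ℝ) × (ℕ → X)) × (Fin d × Fin N → ℝ) → ℝ≥0∞ := fun q =>
    F q.1 * ∏ p : Fin d × Fin N, Φ p.1 p.2 q.1 (q.2 p)
  have hH : Measurable H := (hF.comp measurable_fst).mul (Finset.measurable_prod _ fun p _ =>
    (hΦ p.1 p.2).comp (measurable_fst.prodMk ((measurable_pi_apply p).comp measurable_snd)))
  have h1 := lintegral_map (μ := P) hH (hY.prodMk hM)
  rw [h.map_eq_prod hJ hx N, lintegral_prod _ hH.aemeasurable] at h1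
  have h2 : ∀ y, ∫⁻ z, H (y, z) ∂(Measure.pi fun p : Fin d × Fin N => ν p.1) =
      F y * ∏ j, ∏ i ∈ Finset.range N, ∫⁻ t, Φ j i y t ∂(ν j) := by
    intro y
    have h3 : ∀ p : Fin d × Fin N, Measurable (Φ p.1 p.2 y) := fun p =>
      (hΦ p.1 p.2).comp (measurable_const.prodMk measurable_id)
    have h4 : Measurable fun z : Fin d × Fin N → ℝ => ∏ p : Fin d × Fin N, Φ p.1 p.2 y (z p) :=
      Finset.measurable_prod _ fun p _ => (h3 p).comp (measurable_pi_apply p)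
    simp only [H]
    rw [lintegral_const_mul _ h4, lintegral_pi_prod _ _ h3, Fintype.prod_prod_type]
    simp_rw [Finset.prod_range]
  have h5 : Measurable fun y => F y * ∏ j, ∏ i ∈ Finset.range N, ∫⁻ t, Φ j i y t ∂(ν j) :=
    hF.mul (Finset.measurable_prod _ fun j _ => Finset.measurable_prod _ fun i _ =>
      (hΦ j i).lintegral_prod_right')
  simp_rw [h2] at h1
  rw [lintegral_map h5 hY] at h1
  rw [h1]
  refine lintegral_congr fun ω => ?_
  simp only [H, Fintype.prod_prod_type, Finset.prod_range]

end HasScores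

/-! ### Integrating out the gamma scores -/

/-- The exponent `φ ∑_j log(1 + s f_j(y))` obtained by integrating out the gamma scores of a point
`(s, y)`. -/
noncomputable def levelCost {X : Type*} {d : ℕ} (φ : ℝ) (f : Fin d → X → ℝ) (p : ℝ × X) : ℝ≥0∞ :=
  ENNReal.ofReal (∑ j, φ * Real.log (1 + p.1 * f j p.2))

theorem measurable_levelCost {X : Type*} [MeasurableSpace X] {d : ℕ} (φ : ℝ) {f : Fin d → X → ℝ}
    (hf : IsTest f) : Measurable (levelCost φ f) := by
  refine (Finset.measurable_sum _ fun j _ => ?_).ennreal_ofReal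
  exact ((measurable_const.add (measurable_fst.mul
    ((hf.measurable j).comp measurable_snd))).log).const_mul _

theorem expNeg_levelCost {X : Type*} {d : ℕ} {φ : ℝ} (hφ : 0 < φ) {f : Fin d → X → ℝ}
    (hf : ∀ j x, 0 ≤ f j x) {s : ℝ} (hs : 0 ≤ s) (x : X) :
    expNeg (levelCost φ f (s, x)) = ∏ j, ENNReal.ofReal ((1 / (1 + s * f j x)) ^ φ) := by
  have h0 : ∀ j, 0 ≤ s * f j x := fun j => mul_nonneg hs (hf j x)
  have h1 : ∀ j, 0 ≤ φ * Real.log (1 + s * f j x) := fun j =>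
    mul_nonneg hφ.le (Real.log_nonneg (by linarith [h0 j]))
  unfold levelCost
  rw [ENNReal.ofReal_sum_of_nonneg fun j _ => h1 j, expNeg_sum]
  refine Finset.prod_congr rfl fun j _ => ?_
  have h2 : 0 < 1 + s * f j x := by linarith [h0 j]
  rw [expNeg_ofReal (h1 j), Real.rpow_def_of_pos (by positivity), Real.log_div one_ne_zero h2.ne',
    Real.log_one]
  congr 2
  ring

/-- `HasScores` speaks of finitely many scores at a time, so the functional is reached through
truncations to the first K atoms. -/
theorem laplaceTest_compound_tendsto {Ω X : Type*} [MeasurableSpace X] {d : ℕ} {J : ℕ → Ω → ℝ}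
    {x : ℕ → Ω → X} {m : Fin d → ℕ → Ω → ℝ} {f : Fin d → X → ℝ} (hf : IsTest f) (ω : Ω) :
    Tendsto (fun K => ∏ j, ∏ i ∈ Finset.range K,
      expNeg (ENNReal.ofReal (m j i ω * J i ω) * ENNReal.ofReal (f j (x i ω)))) atTop
      (𝓝 (laplaceTest f (compound J x m ω))) := by
  unfold laplaceTest
  simp_rw [lintegral_compound J x m ω _ (hf.measurable _).ennreal_ofReal, ← expNeg_sum]
  refine (continuous_expNeg.tendsto _).comp (tendsto_finsetSum _ fun j _ => ?_)
  exact ENNReal.tendsto_nat_tsum _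

/-- `pointProcess` leaves out the atoms of height 0; their cost is 0, so a product over all indices
may be used. -/
theorem expNeg_pointProcess_tendsto {Ω X : Type*} [MeasurableSpace X] {d : ℕ} {φ : ℝ}
    {J : ℕ → Ω → ℝ} {x : ℕ → Ω → X} {f : Fin d → X → ℝ} (hf : IsTest f) {ω : Ω}
    (hJ : ∀ i, 0 ≤ J i ω) :
    Tendsto (fun K => ∏ i ∈ Finset.range K, expNeg (levelCost φ f (J i ω, x i ω))) atTop
      (𝓝 (expNeg (∫⁻ p, levelCost φ f p
        ∂(pointProcess (fun i => J i ω) (fun i => x i ω))))) := by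
  rw [lintegral_pointProcess _ _ (measurable_levelCost φ hf)]
  simp_rw [← expNeg_sum]
  refine (continuous_expNeg.tendsto _).comp ?_
  have : (fun i => if 0 < J i ω then levelCost φ f (J i ω, x i ω) else 0) =
      fun i => levelCost φ f (J i ω, x i ω) := by
    ext i
    split_ifs with h
    · rfl
    · have h0 : J i ω = 0 := le_antisymm (not_lt.1 h) (hJ i)
      simp [levelCost, h0]
  rw [this]
  exact ENNReal.tendsto_nat_tsum _

section Tilt

variable {Ω X : Type*} [MeasurableSpace Ω] [MeasurableSpace X] {d : ℕ} {P : Measure Ω}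
  [IsProbabilityMeasure P] {φ : ℝ} {J : ℕ → Ω → ℝ} {x : ℕ → Ω → X} {m : Fin d → ℕ → Ω → ℝ}

/-- Integrating out gamma scores tilted by the Laplace test function. -/
theorem HasScores.lintegral_tilt (hφ : 0 < φ)
    (h : HasScores P (fun (_ : ℝ) (_ : Fin d) => gammaMeasure φ 1) J x m)
    (hJ : ∀ i, Measurable (J i)) (hx : ∀ i, Measurable (x i)) (hJ0 : ∀ i, ∀ᵐ ω ∂P, 0 ≤ J i ω)
    {f : Fin d → X → ℝ} (hf : IsTest f) {F : (ℕ → ℝ) × (ℕ → X) → ℝ≥0∞} (hF : Measurable F)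
    (hF1 : ∀ y, F y ≤ 1) (N : ℕ) (B : Fin d → ℕ → Set ℝ) (hB : ∀ j i, MeasurableSet (B j i)) :
    ∫⁻ ω, F ((fun i => J i ω), (fun i => x i ω)) *
        (∏ j, ∏ i ∈ Finset.range N, (B j i).indicator 1 (m j i ω)) *
        laplaceTest f (compound J x m ω) ∂P =
      ∫⁻ ω, F ((fun i => J i ω), (fun i => x i ω)) *
        (∏ j, ∏ i ∈ Finset.range N, gammaMeasure φ (1 + J i ω * f j (x i ω)) (B j i)) *
        expNeg (∫⁻ p, levelCost φ f p ∂(pointProcess (fun i => J i ω) (fun i => x i ω))) ∂P := by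
  have := isProbabilityMeasure_gammaMeasure hφ one_pos
  have hY : Measurable fun ω => ((fun i => J i ω), (fun i => x i ω)) :=
    (measurable_pi_lambda _ hJ).prodMk (measurable_pi_lambda _ hx)
  -- Scores with index at least N are unconstrained and only take part in the tilt. So the
  -- truncation level K can tend to infinity while N stays fixed.
  let B' : Fin d → ℕ → Set ℝ := fun j i => if i < N then B j i else univ
  have hB' : ∀ j i, MeasurableSet (B' j i) := fun j i => by
    simp only [B']
    split_ifs
    · exact hB j i
    · exact MeasurableSet.univ
  let Φ : Fin d → ℕ → (ℕ → ℝ) × (ℕ → X) → ℝ → ℝ≥0∞ := fun j i y t =>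
    (B' j i).indicator 1 t * expNeg (ENNReal.ofReal (t * y.1 i) * ENNReal.ofReal (f j (y.2 i)))
  have hΦ : ∀ j i, Measurable (Function.uncurry (Φ j i)) := by
    intro j i
    refine ((measurable_one.indicator (hB' j i)).comp measurable_snd).mul
      (measurable_expNeg.comp (Measurable.mul (Measurable.ennreal_ofReal ?_)
        (Measurable.ennreal_ofReal ?_)))
    · exact measurable_snd.mul ((measurable_pi_apply i).comp (measurable_fst.comp measurable_fst))
    · exact (hf.measurable j).comp ((measurable_pi_apply i).comp
        (measurable_snd.comp measurable_fst))
  have key := fun K => h.lintegral_mul_prod hJ hx K hF hΦ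
  have hind : ∀ (K : ℕ), N ≤ K → ∀ G : Fin d → ℕ → Set ℝ → ℝ≥0∞, (∀ j i, G j i univ = 1) →
      ∏ j, ∏ i ∈ Finset.range K, G j i (B' j i) = ∏ j, ∏ i ∈ Finset.range N, G j i (B j i) := by
    intro K hK G hG
    refine Finset.prod_congr rfl fun j _ => ?_
    rw [← Finset.prod_subset (Finset.range_mono hK) fun i _ hi => ?_]
    · refine Finset.prod_congr rfl fun i hi => ?_
      simp only [B', if_pos (Finset.mem_range.1 hi)]
    · simp only [B', if_neg (fun h' => hi (Finset.mem_range.2 h')), hG]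
  have hgp : ∀ v : ℝ, 0 ≤ v → IsProbabilityMeasure (gammaMeasure φ (1 + v)) := fun v hv =>
    isProbabilityMeasure_gammaMeasure hφ (by linarith)
  have hJall : ∀ᵐ ω ∂P, ∀ i, 0 ≤ J i ω := ae_all_iff.2 hJ0
  have hL : Tendsto (fun K => ∫⁻ ω, F ((fun i => J i ω), (fun i => x i ω)) *
      ∏ j, ∏ i ∈ Finset.range K, Φ j i ((fun i => J i ω), (fun i => x i ω)) (m j i ω) ∂P) atTop
      (𝓝 (∫⁻ ω, F ((fun i => J i ω), (fun i => x i ω)) *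
        (∏ j, ∏ i ∈ Finset.range N, (B j i).indicator 1 (m j i ω)) *
        laplaceTest f (compound J x m ω) ∂P)) := by
    refine tendsto_lintegral_of_dominated_convergence (fun _ => 1) (fun K => ?_) (fun K => ?_)
      (by simp) (Eventually.of_forall fun ω => ?_)
    · exact (hF.comp hY).mul (Finset.measurable_prod _ fun j _ => Finset.measurable_prod _
        fun i _ => (hΦ j i).comp (hY.prodMk (h.measurable j i)))
    · refine Eventually.of_forall fun ω => mul_le_one' (hF1 _) ?_
      refine Finset.prod_le_one' fun j _ => Finset.prod_le_one' fun i _ => ?_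
      exact mul_le_one' (indicator_le_self' (by simp) _) (expNeg_le_one _)
    · have h1 := ENNReal.Tendsto.const_mul (a := F ((fun i => J i ω), (fun i => x i ω)) *
        (∏ j, ∏ i ∈ Finset.range N, (B j i).indicator 1 (m j i ω)))
        (laplaceTest_compound_tendsto (J := J) (x := x) (m := m) hf ω)
        (Or.inr (ENNReal.mul_ne_top (ne_top_of_le_ne_top ENNReal.one_ne_top (hF1 _))
          (ne_top_of_le_ne_top ENNReal.one_ne_top (Finset.prod_le_one' fun j _ =>
            Finset.prod_le_one' fun i _ => indicator_le_self' (by simp) _))))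
      refine h1.congr' ?_
      filter_upwards [eventually_ge_atTop N] with K hK
      rw [← hind K hK (fun j i A => A.indicator 1 (m j i ω)) (by simp), mul_assoc]
      congr 1
      simp_rw [← Finset.prod_mul_distrib]
      rfl
  have hR : Tendsto (fun K => ∫⁻ ω, F ((fun i => J i ω), (fun i => x i ω)) *
      ∏ j, ∏ i ∈ Finset.range K, ∫⁻ t, Φ j i ((fun i => J i ω), (fun i => x i ω)) t
        ∂(gammaMeasure φ 1) ∂P) atTop
      (𝓝 (∫⁻ ω, F ((fun i => J i ω), (fun i => x i ω)) *
        (∏ j, ∏ i ∈ Finset.range N, gammaMeasure φ (1 + J i ω * f j (x i ω)) (B j i)) *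
        expNeg (∫⁻ p, levelCost φ f p
          ∂(pointProcess (fun i => J i ω) (fun i => x i ω))) ∂P)) := by
    refine tendsto_lintegral_of_dominated_convergence (fun _ => 1) (fun K => ?_) (fun K => ?_)
      (by simp) ?_
    · exact (hF.comp hY).mul (Finset.measurable_prod _ fun j _ => Finset.measurable_prod _
        fun i _ => (hΦ j i).lintegral_prod_right'.comp hY)
    · refine Eventually.of_forall fun ω => mul_le_one' (hF1 _) ?_
      refine Finset.prod_le_one' fun j _ => Finset.prod_le_one' fun i _ => ?_
      refine (lintegral_mono (g := fun _ => 1) fun t => ?_).trans (by simp)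
      exact mul_le_one' (indicator_le_self' (by simp) _) (expNeg_le_one _)
    · filter_upwards [hJall] with ω hω
      have h0 : ∀ j i, 0 ≤ J i ω * f j (x i ω) := fun j i => mul_nonneg (hω i) (hf.nonneg _ _)
      have h1 := ENNReal.Tendsto.const_mul (a := F ((fun i => J i ω), (fun i => x i ω)) *
        (∏ j, ∏ i ∈ Finset.range N, gammaMeasure φ (1 + J i ω * f j (x i ω)) (B j i)))
        (expNeg_pointProcess_tendsto (J := J) (x := x) (φ := φ) hf hω)
        (Or.inr (ENNReal.mul_ne_top (ne_top_of_le_ne_top ENNReal.one_ne_top (hF1 _))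
          (ne_top_of_le_ne_top ENNReal.one_ne_top (Finset.prod_le_one' fun j _ =>
            Finset.prod_le_one' fun i _ => by have := hgp _ (h0 j i); exact prob_le_one))))
      refine h1.congr' ?_
      filter_upwards [eventually_ge_atTop N] with K hK
      rw [← hind K hK (fun j i A => gammaMeasure φ (1 + J i ω * f j (x i ω)) A)
        (fun j i => by have := hgp _ (h0 j i); exact measure_univ), mul_assoc]
      congr 1
      have h2 : ∀ i, expNeg (levelCost φ f (J i ω, x i ω)) =
          ∏ j, ENNReal.ofReal ((1 / (1 + J i ω * f j (x i ω))) ^ φ) := fun i =>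
        expNeg_levelCost hφ hf.nonneg (hω i) _
      simp_rw [h2]
      rw [Finset.prod_comm (s := Finset.range K), ← Finset.prod_mul_distrib]
      refine Finset.prod_congr rfl fun j _ => ?_
      rw [← Finset.prod_mul_distrib]
      refine Finset.prod_congr rfl fun i _ => ?_
      -- For a single score the tilt splits into the gamma law with rate 1 + J f and the factor (1 +
      -- J f)^{-φ}; the product of these factors over j is e^{-levelCost} at the atom.
      rw [mul_comm, ← setLIntegral_expNeg_gammaMeasure one_pos (h0 j i) (hB' j i),
        ← lintegral_indicator (hB' j i)]
      refine lintegral_congr_ae ?_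
      filter_upwards [ae_pos_gammaMeasure φ 1] with t ht
      simp only [Φ]
      rw [← ENNReal.ofReal_mul (mul_nonneg ht.le (hω i)), mul_assoc]
      by_cases htB : t ∈ B' j i <;> simp [htB]
  exact tendsto_nhds_unique hL (by simpa only [key] using hR)

/-- Without constraints on the scores, the tilt formula turns the functional of the compound
measures into a Laplace functional of the Poisson process, evaluated at the function `levelCost`. -/
theorem lintegral_laplaceTest_compound (hφ : 0 < φ) {Λ : Measure (ℝ × X)} [SigmaFinite Λ]
    (hc : IsCRM P Λ J x) (h : HasScores P (fun (_ : ℝ) (_ : Fin d) => gammaMeasure φ 1) J x m)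
    {f : Fin d → X → ℝ} (hf : IsTest f) :
    ∫⁻ ω, laplaceTest f (compound J x m ω) ∂P =
      expNeg (∫⁻ p, 1 - expNeg (levelCost φ f p) ∂Λ) := by
  rw [← hc.poisson.laplace (measurable_levelCost φ hf)]
  have := h.lintegral_tilt hφ hc.measurable_height hc.measurable_location hc.nonneg hf
    (F := fun _ => 1) measurable_const (fun _ => le_rfl) 0 (fun _ _ => univ)
    (fun _ _ => MeasurableSet.univ)
  simpa using this

end Tilt

/-- An exponential change of measure turns a Poisson process into a Poisson process. -/
theorem IsPoissonProcess.tilt {Ω Ω' E : Type*} [MeasurableSpace Ω] [MeasurableSpace Ω']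
    [MeasurableSpace E] {P : Measure Ω} [IsProbabilityMeasure P] {P' : Measure Ω'}
    [IsProbabilityMeasure P'] {N : Ω → Measure E} {N' : Ω' → Measure E} {Λ : Measure E}
    [SigmaFinite Λ] (h : IsPoissonProcess P N Λ) (hN' : Measurable N') {g : E → ℝ≥0∞}
    (hg : Measurable g) (hfin : ∫⁻ p, 1 - expNeg (g p) ∂Λ ≠ ∞)
    (hT : ∀ k : E → ℝ≥0∞, Measurable k → ∫⁻ ω, expNeg (∫⁻ p, k p ∂(N' ω)) ∂P' =
      (expNeg (∫⁻ p, 1 - expNeg (g p) ∂Λ))⁻¹ * ∫⁻ ω, expNeg (∫⁻ p, k p + g p ∂(N ω)) ∂P) :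
    IsPoissonProcess P' N' (Λ.withDensity fun p => expNeg (g p)) := by
  have hm : ∀ f : E → ℝ≥0∞, Measurable f → Measurable fun p => expNeg (f p) := fun f hf =>
    measurable_expNeg.comp hf
  have key : ∀ k : E → ℝ≥0∞, Measurable k → ∫⁻ ω, expNeg (∫⁻ p, k p ∂(N' ω)) ∂P' =
      expNeg (∫⁻ p, 1 - expNeg (k p) ∂(Λ.withDensity fun p => expNeg (g p))) := by
    intro k hk
    rw [hT k hk, h.laplace (f := fun p => k p + g p) (hk.add hg)]
    -- The integral of the first summand cancels the normalizing constant. The second is the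
    -- exponent for the intensity e^{-g} Λ.
    have h1 : ∀ p, 1 - expNeg (k p + g p) =
        (1 - expNeg (g p)) + expNeg (g p) * (1 - expNeg (k p)) := by
      intro p
      rw [expNeg_add, ENNReal.mul_sub (fun _ _ => expNeg_ne_top _), mul_one, mul_comm,
        tsub_add_tsub_cancel (expNeg_le_one _) (mul_le_of_le_one_right' (expNeg_le_one _))]
    simp_rw [h1]
    have hs : ∀ f : E → ℝ≥0∞, Measurable f → Measurable fun p => 1 - expNeg (f p) := fun f hf =>
      measurable_const.sub (hm f hf)
    rw [lintegral_add_left (hs g hg), expNeg_add, ← mul_assoc,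
      ENNReal.inv_mul_cancel _ (expNeg_ne_top _), one_mul,
      lintegral_withDensity_eq_lintegral_mul _ (hm g hg) (hs k hk)]
    · rfl
    · rw [expNeg_eq hfin]
      simp [Real.exp_pos]
  refine IsPoissonProcess.of_laplace hN' fun r B k hB hd => ?_
  have h1 := key (fun p => ∑ a, (k a : ℝ≥0∞) * (B a).indicator 1 p)
    (Finset.measurable_sum _ fun a _ => (measurable_one.indicator (hB a)).const_mul _)
  have h2 : ∀ ν : Measure E, ∫⁻ p, ∑ a, (k a : ℝ≥0∞) * (B a).indicator 1 p ∂ν =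
      ∑ a, (k a : ℝ≥0∞) * ν (B a) := by
    intro ν
    rw [lintegral_finsetSum _ fun a _ => (measurable_one.indicator (hB a)).const_mul _]
    refine Finset.sum_congr rfl fun a _ => ?_
    rw [lintegral_const_mul _ (measurable_one.indicator (hB a)), lintegral_indicator_one (hB a)]
  -- The sets are disjoint, so at each point at most one term of the sum is nonzero.
  have h3 : ∀ p, 1 - expNeg (∑ a, (k a : ℝ≥0∞) * (B a).indicator 1 p) =
      ∑ a, (1 - expNeg (k a)) * (B a).indicator 1 p := by
    intro p
    by_cases hp : ∃ a, p ∈ B a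
    · obtain ⟨a, ha⟩ := hp
      have hne : ∀ b, b ≠ a → p ∉ B b := fun b hb hpb => Set.disjoint_left.1 (hd hb) hpb ha
      rw [Finset.sum_eq_single a (fun b _ hb => by simp [hne b hb]) (by simp),
        Finset.sum_eq_single a (fun b _ hb => by simp [hne b hb]) (by simp)]
      simp [ha]
    · push Not at hp
      simp [hp, expNeg_zero]
  simp_rw [h2, h3] at h1
  rw [lintegral_finsetSum _ fun a _ => (measurable_one.indicator (hB a)).const_mul _] at h1
  simp_rw [lintegral_const_mul _ (measurable_one.indicator (hB _)),
    lintegral_indicator_one (hB _), expNeg_sum] at h1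
  exact h1

/-! ### Moments of the jumps and the Laplace exponent -/

theorem hasDerivAt_integral_ball {Y : Type*} [MeasurableSpace Y] {μ : Measure Y}
    {F F' : ℝ → Y → ℝ} {bound : Y → ℝ} {τ δ : ℝ} (hτ : τ ∈ Metric.ball (0 : ℝ) δ)
    (hF : ∀ᶠ τ in 𝓝 τ, AEStronglyMeasurable (F τ) μ) (hint : Integrable (F τ) μ)
    (hF' : AEStronglyMeasurable (F' τ) μ)
    (hb : ∀ᵐ y ∂μ, ∀ τ ∈ Metric.ball (0 : ℝ) δ, ‖F' τ y‖ ≤ bound y) (hbi : Integrable bound μ)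
    (hd : ∀ᵐ y ∂μ, ∀ τ ∈ Metric.ball (0 : ℝ) δ, HasDerivAt (fun τ => F τ y) (F' τ y) τ) :
    HasDerivAt (fun τ => ∫ y, F τ y ∂μ) (∫ y, F' τ y ∂μ) τ :=
  (hasDerivAt_integral_of_dominated_loc_of_deriv_le (Metric.isOpen_ball.mem_nhds hτ) hF hint hF'
    hb hbi hd).2

/-- `E[(s M)^c e^{-s t M}]` for `M` with law `Gamma(φ, 1)`. -/
noncomputable def jumpFactor (φ s t : ℝ) (c : ℕ) : ℝ :=
  Real.Gamma (φ + c) / Real.Gamma φ * s ^ c * (1 + s * t) ^ (-(φ + c))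

/-- `E[∏_j (s M_j)^{c_j} e^{-s t_j M_j}]` for i.i.d. `M_j` with law `Gamma(φ, 1)`. -/
noncomputable def jumpDensity {d : ℕ} (φ : ℝ) (c : Fin d → ℕ) (s : ℝ) (t : Fin d → ℝ) : ℝ :=
  ∏ j, jumpFactor φ s (t j) (c j)

/-- The moment of order `c` of the Lévy measure of the vector, tilted by `t`. -/
noncomputable def jumpMoment {d : ℕ} (φ σ : ℝ) (c : Fin d → ℕ) (t : Fin d → ℝ) : ℝ :=
  ∫ s, jumpDensity φ c s t ∂(stableLevy φ σ)

/-- The Laplace exponent of the vector of masses. -/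
noncomputable def levyExponent {d : ℕ} (φ σ : ℝ) (t : Fin d → ℝ) : ℝ :=
  ∫ s, (1 - jumpDensity φ 0 s t) ∂(stableLevy φ σ)

instance (φ σ : ℝ) : SigmaFinite (stableLevy φ σ) := by
  unfold stableLevy; infer_instance

theorem measurable_stableDensity (φ σ : ℝ) : Measurable fun s : ℝ =>
    σ * Real.Gamma φ / (Real.Gamma (σ + φ) * Real.Gamma (1 - σ)) * s ^ (-1 - σ) :=
  (measurable_id.pow_const _).const_mul _

theorem ae_pos_stableLevy (φ σ : ℝ) : ∀ᵐ s ∂(stableLevy φ σ), 0 < s :=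
  (withDensity_absolutelyContinuous _ _).ae_le (ae_restrict_mem measurableSet_Ioi)

section

variable {φ σ : ℝ}

theorem stableConst_pos (hφ : 0 < φ) (hσ : σ ∈ Ioo (0 : ℝ) 1) :
    0 < σ * Real.Gamma φ / (Real.Gamma (σ + φ) * Real.Gamma (1 - σ)) := by
  have h1 := Real.Gamma_pos_of_pos hφ
  have h2 := Real.Gamma_pos_of_pos (add_pos hσ.1 hφ)
  have h3 := Real.Gamma_pos_of_pos (sub_pos.2 hσ.2)
  have := hσ.1
  positivity

/-- s^{-σ} is integrable at 0 because σ < 1, and s^{-1-σ} at infinity because σ > 0. The function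
min(s, 1) dominates all later integrals in s. -/
theorem integrable_min_stableLevy (hφ : 0 < φ) (hσ : σ ∈ Ioo (0 : ℝ) 1) :
    Integrable (fun s => min s 1) (stableLevy φ σ) := by
  unfold stableLevy
  have hC := stableConst_pos hφ hσ
  set C := σ * Real.Gamma φ / (Real.Gamma (σ + φ) * Real.Gamma (1 - σ)) with hCdef
  rw [integrable_withDensity_iff_integrable_smul' (measurable_stableDensity φ σ).ennreal_ofReal
    (by simp)]
  have h1 : IntegrableOn (fun s : ℝ => C * s ^ (-σ)) (Ioc 0 1) :=
    ((intervalIntegrable_iff_integrableOn_Ioc_of_le zero_le_one).1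
      (intervalIntegral.intervalIntegrable_rpow' (by linarith [hσ.2]))).const_mul C
  have h2 : IntegrableOn (fun s : ℝ => C * s ^ (-1 - σ)) (Ioi 1) :=
    (integrableOn_Ioi_rpow_of_lt (by linarith [hσ.1]) one_pos).const_mul C
  change IntegrableOn _ (Ioi (0 : ℝ))
  rw [← Ioc_union_Ioi_eq_Ioi (zero_le_one (α := ℝ))]
  refine IntegrableOn.union (h1.congr_fun (fun s hs => ?_) measurableSet_Ioc)
    (h2.congr_fun (fun s hs => ?_) measurableSet_Ioi)
  · have hs0 : 0 < s := hs.1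
    rw [ENNReal.toReal_ofReal (by positivity), smul_eq_mul, min_eq_left hs.2, mul_assoc,
      ← Real.rpow_add_one hs0.ne', show -1 - σ + 1 = -σ by ring]
  · have hs1 : (1 : ℝ) < s := hs
    have hs0 : 0 < s := by linarith
    rw [ENNReal.toReal_ofReal (by positivity), smul_eq_mul, min_eq_right hs1.le, mul_one]

/-- No power of s is integrable on the whole half-line. The infinite number of jumps is what makes
the total masses positive. -/
theorem stableLevy_univ (hφ : 0 < φ) (hσ : σ ∈ Ioo (0 : ℝ) 1) : stableLevy φ σ univ = ∞ := by
  have hC := stableConst_pos hφ hσ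
  by_contra h
  refine not_integrableOn_Ioi_rpow (-1 - σ) ?_
  unfold stableLevy at h
  rw [withDensity_apply _ MeasurableSet.univ, setLIntegral_univ] at h
  have h1 : IntegrableOn (fun s : ℝ => σ * Real.Gamma φ / (Real.Gamma (σ + φ) *
      Real.Gamma (1 - σ)) * s ^ (-1 - σ)) (Ioi 0) := by
    refine ⟨(measurable_stableDensity φ σ).aestronglyMeasurable, ?_⟩
    rw [hasFiniteIntegral_iff_ofReal]
    · exact lt_top_iff_ne_top.2 h
    · filter_upwards [ae_restrict_mem measurableSet_Ioi] with s hs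
      have : 0 < s := hs
      simp only [Pi.zero_apply]
      positivity
  have h2 : IntegrableOn _ (Ioi (0 : ℝ)) :=
    h1.const_mul (σ * Real.Gamma φ / (Real.Gamma (σ + φ) * Real.Gamma (1 - σ)))⁻¹
  refine h2.congr_fun (fun s _ => ?_) measurableSet_Ioi
  exact inv_mul_cancel_left₀ hC.ne' _

theorem jumpFactor_pos (hφ : 0 < φ) {s t : ℝ} (hs : 0 < s) (ht : 0 ≤ t) (c : ℕ) :
    0 < jumpFactor φ s t c := by
  have h1 := Real.Gamma_pos_of_pos hφ
  have h2 := Real.Gamma_pos_of_pos (show 0 < φ + c by positivity)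
  have h3 : 0 < 1 + s * t := by positivity
  unfold jumpFactor
  positivity

theorem jumpFactor_antitone (hφ : 0 < φ) {s t t' : ℝ} (hs : 0 < s) (ht : 0 ≤ t) (htt' : t ≤ t')
    (c : ℕ) : jumpFactor φ s t' c ≤ jumpFactor φ s t c := by
  have h1 := Real.Gamma_pos_of_pos hφ
  have h2 := Real.Gamma_pos_of_pos (show 0 < φ + c by positivity)
  have h3 : 0 < 1 + s * t := by positivity
  unfold jumpFactor
  refine mul_le_mul_of_nonneg_left ?_ (by positivity)
  exact Real.rpow_le_rpow_of_nonpos h3 (by gcongr) (by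
    have : 0 ≤ φ + c := by positivity
    linarith)

/-- Drop (1 + sε)^{-φ} ≤ 1; what remains is (s / (1 + sε))^c, and s / (1 + sε) is at most both s and
1/ε. -/
theorem jumpFactor_le (hφ : 0 < φ) {s ε : ℝ} (hs : 0 < s) (hε : 0 < ε) (c : ℕ) :
    jumpFactor φ s ε c ≤
      Real.Gamma (φ + c) / Real.Gamma φ * (1 + ε⁻¹) ^ c * min s 1 ^ c := by
  have h1 := Real.Gamma_pos_of_pos hφ
  have h2 := Real.Gamma_pos_of_pos (show 0 < φ + c by positivity)
  have h3 : 0 < 1 + s * ε := by positivity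
  unfold jumpFactor
  rw [neg_add, Real.rpow_add h3, mul_assoc, mul_assoc]
  refine mul_le_mul_of_nonneg_left ?_ (by positivity)
  have h4 : (1 + s * ε) ^ (-φ) ≤ 1 :=
    Real.rpow_le_one_of_one_le_of_nonpos (by nlinarith [mul_pos hs hε]) (by linarith)
  have h5 : s ^ c * ((1 + s * ε) ^ (-φ) * (1 + s * ε) ^ (-(c : ℝ))) ≤ (s / (1 + s * ε)) ^ c := by
    rw [Real.rpow_neg h3.le (c : ℝ), Real.rpow_natCast, div_pow, div_eq_mul_inv]
    have : 0 < ((1 + s * ε) ^ c)⁻¹ := by positivity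
    have h6 : (1 + s * ε) ^ (-φ) * ((1 + s * ε) ^ c)⁻¹ ≤ ((1 + s * ε) ^ c)⁻¹ :=
      mul_le_of_le_one_left this.le h4
    exact mul_le_mul_of_nonneg_left h6 (by positivity)
  refine h5.trans ?_
  rw [← mul_pow]
  refine pow_le_pow_left₀ (by positivity) ?_ c
  rw [div_le_iff₀ h3]
  have hε' : 0 < ε⁻¹ := by positivity
  rcases le_total s 1 with h | h
  · rw [min_eq_left h]
    have : 0 < s * ε := by positivity
    have h7 : s ≤ (1 + ε⁻¹) * s := by nlinarith
    nlinarith [mul_pos (mul_pos (show 0 < 1 + ε⁻¹ by positivity) hs) this]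
  · rw [min_eq_right h, mul_one]
    have : (1 + ε⁻¹) * (1 + s * ε) = 1 + s * ε + ε⁻¹ + s := by field_simp; ring
    rw [this]
    nlinarith [mul_pos hs hε]

variable {d : ℕ}

theorem jumpDensity_pos (hφ : 0 < φ) {s : ℝ} (hs : 0 < s) {t : Fin d → ℝ} (ht : ∀ j, 0 ≤ t j)
    (c : Fin d → ℕ) : 0 < jumpDensity φ c s t :=
  Finset.prod_pos fun j _ => jumpFactor_pos hφ hs (ht j) (c j)

theorem jumpDensity_antitone (hφ : 0 < φ) {s : ℝ} (hs : 0 < s) {t t' : Fin d → ℝ}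
    (ht : ∀ j, 0 ≤ t j) (htt' : ∀ j, t j ≤ t' j) (c : Fin d → ℕ) :
    jumpDensity φ c s t' ≤ jumpDensity φ c s t :=
  Finset.prod_le_prod (fun j _ => (jumpFactor_pos hφ hs ((ht j).trans (htt' j)) (c j)).le)
    fun j _ => jumpFactor_antitone hφ hs (ht j) (htt' j) (c j)

theorem measurable_jumpDensity (φ : ℝ) (c : Fin d → ℕ) :
    Measurable fun p : ℝ × (Fin d → ℝ) => jumpDensity φ c p.1 p.2 := by
  unfold jumpDensity jumpFactor
  refine Finset.measurable_prod _ fun j _ => ?_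
  have h1 : Measurable fun p : ℝ × (Fin d → ℝ) => p.2 j := (measurable_pi_apply j).comp measurable_snd
  exact ((measurable_fst.pow_const _).const_mul _).mul
    ((measurable_const.add (measurable_fst.mul h1)).pow_const _)

theorem measurable_jumpDensity_left (φ : ℝ) (c : Fin d → ℕ) (t : Fin d → ℝ) :
    Measurable fun s => jumpDensity φ c s t :=
  (measurable_jumpDensity φ c).comp (measurable_id.prodMk measurable_const)

theorem measurable_jumpMoment (φ σ : ℝ) (c : Fin d → ℕ) : Measurable (jumpMoment φ σ c) := by
  have h : StronglyMeasurable fun t => ∫ s, jumpDensity φ c s t ∂(stableLevy φ σ) :=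
    StronglyMeasurable.integral_prod_right' (f := fun p : (Fin d → ℝ) × ℝ => jumpDensity φ c p.2 p.1)
      ((measurable_jumpDensity φ c).comp measurable_swap).stronglyMeasurable
  exact h.measurable

theorem measurable_levyExponent (φ σ : ℝ) :
    Measurable (levyExponent φ σ : (Fin d → ℝ) → ℝ) := by
  have h : StronglyMeasurable fun t : Fin d → ℝ =>
      ∫ s, (1 - jumpDensity φ 0 s t) ∂(stableLevy φ σ) :=
    StronglyMeasurable.integral_prod_right'
      (f := fun p : (Fin d → ℝ) × ℝ => 1 - jumpDensity φ 0 p.2 p.1)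
      (measurable_const.sub ((measurable_jumpDensity φ 0).comp measurable_swap)).stronglyMeasurable
  exact h.measurable

/-- A nonzero order supplies at least one factor min(s, 1). For order zero the density tends to 1 at
s = 0, where the Lévy measure has infinite mass. -/
theorem integrable_jumpDensity (hφ : 0 < φ) (hσ : σ ∈ Ioo (0 : ℝ) 1) {c : Fin d → ℕ} (hc : c ≠ 0)
    {t : Fin d → ℝ} (ht : ∀ j, 0 < t j) :
    Integrable (fun s => jumpDensity φ c s t) (stableLevy φ σ) := by
  let C := ∏ j, Real.Gamma (φ + c j) / Real.Gamma φ * (1 + (t j)⁻¹) ^ c j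
  refine ((integrable_min_stableLevy hφ hσ).const_mul C).mono'
    (measurable_jumpDensity_left φ c t).aestronglyMeasurable ?_
  filter_upwards [ae_pos_stableLevy φ σ] with s hs
  rw [Real.norm_of_nonneg (jumpDensity_pos hφ hs (fun j => (ht j).le) c).le]
  have hmin : 0 < min s 1 := lt_min hs one_pos
  have hC : 0 ≤ C := Finset.prod_nonneg fun j _ => by
    have h1 := Real.Gamma_pos_of_pos hφ
    have h2 := Real.Gamma_pos_of_pos (show 0 < φ + c j by positivity)
    have := ht j
    positivity
  have h1 : jumpDensity φ c s t ≤ C * min s 1 ^ (∑ j, c j) := by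
    rw [← Finset.prod_pow_eq_pow_sum, ← Finset.prod_mul_distrib]
    exact Finset.prod_le_prod (fun j _ => (jumpFactor_pos hφ hs (ht j).le _).le)
      fun j _ => jumpFactor_le hφ hs (ht j) (c j)
  refine h1.trans (mul_le_mul_of_nonneg_left ?_ hC)
  have h2 : ∑ j, c j ≠ 0 := by
    intro h
    exact hc (funext fun j => by simpa using (Finset.sum_eq_zero_iff.1 h) j (Finset.mem_univ j))
  exact pow_le_of_le_one hmin.le (min_le_right _ _) h2

theorem jumpFactor_zero (hφ : 0 < φ) (s t : ℝ) : jumpFactor φ s t 0 = (1 + s * t) ^ (-φ) := by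
  unfold jumpFactor
  simp [div_self (Real.Gamma_pos_of_pos hφ).ne']

theorem jumpDensity_zero_le_one (hφ : 0 < φ) {s : ℝ} (hs : 0 < s) {t : Fin d → ℝ}
    (ht : ∀ j, 0 ≤ t j) : jumpDensity φ 0 s t ≤ 1 := by
  refine Finset.prod_le_one (fun j _ => (jumpFactor_pos hφ hs (ht j) _).le) fun j _ => ?_
  rw [Pi.zero_apply, jumpFactor_zero hφ]
  exact Real.rpow_le_one_of_one_le_of_nonpos (by nlinarith [mul_nonneg hs.le (ht j)]) (by linarith)

/-- For s ≤ 1 from e^{-x} ≥ 1 - x and log(1 + x) ≤ x; for s ≥ 1 from positivity of the density. -/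
theorem one_sub_jumpDensity_le (hφ : 0 < φ) {s : ℝ} (hs : 0 < s) {t : Fin d → ℝ}
    (ht : ∀ j, 0 ≤ t j) : 1 - jumpDensity φ 0 s t ≤ (1 + φ * ∑ j, t j) * min s 1 := by
  have hT : 0 ≤ ∑ j, t j := Finset.sum_nonneg fun j _ => ht j
  have h1 : 1 - φ * (s * ∑ j, t j) ≤ jumpDensity φ 0 s t := by
    have h2 : jumpDensity φ 0 s t = Real.exp (∑ j, -(φ * Real.log (1 + s * t j))) := by
      rw [Real.exp_sum]
      refine Finset.prod_congr rfl fun j _ => ?_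
      have : 0 < 1 + s * t j := by nlinarith [mul_nonneg hs.le (ht j)]
      rw [Pi.zero_apply, jumpFactor_zero hφ, Real.rpow_def_of_pos this]
      congr 1; ring
    rw [h2]
    refine le_trans ?_ (Real.add_one_le_exp _)
    rw [Finset.sum_neg_distrib, ← Finset.mul_sum, Finset.mul_sum (a := s)]
    have : ∑ j, Real.log (1 + s * t j) ≤ ∑ j, s * t j := Finset.sum_le_sum fun j _ => by
      have h3 : 0 < 1 + s * t j := by nlinarith [mul_nonneg hs.le (ht j)]
      linarith [Real.log_le_sub_one_of_pos h3]
    nlinarith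
  have h0 := jumpDensity_pos hφ hs ht 0
  have h5 : 0 ≤ φ * ∑ j, t j := by positivity
  rcases le_total s 1 with h | h
  · rw [min_eq_left h]; nlinarith
  · rw [min_eq_right h]; linarith

theorem integrable_one_sub_jumpDensity (hφ : 0 < φ) (hσ : σ ∈ Ioo (0 : ℝ) 1)
    {t : Fin d → ℝ} (ht : ∀ j, 0 ≤ t j) :
    Integrable (fun s => 1 - jumpDensity φ 0 s t) (stableLevy φ σ) := by
  refine ((integrable_min_stableLevy hφ hσ).const_mul (1 + φ * ∑ j, t j)).mono'
    (measurable_const.sub (measurable_jumpDensity_left φ 0 t)).aestronglyMeasurable ?_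
  filter_upwards [ae_pos_stableLevy φ σ] with s hs
  rw [Real.norm_of_nonneg (sub_nonneg.2 (jumpDensity_zero_le_one hφ hs ht))]
  exact one_sub_jumpDensity_le hφ hs ht

theorem levyExponent_nonneg (hφ : 0 < φ) {t : Fin d → ℝ} (ht : ∀ j, 0 ≤ t j) :
    0 ≤ levyExponent φ σ t := by
  refine integral_nonneg_of_ae ?_
  filter_upwards [ae_pos_stableLevy φ σ] with s hs
  exact sub_nonneg.2 (jumpDensity_zero_le_one hφ hs ht)

theorem levyExponent_le (hφ : 0 < φ) (hσ : σ ∈ Ioo (0 : ℝ) 1) {t : Fin d → ℝ}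
    (ht : ∀ j, 0 ≤ t j) : levyExponent φ σ t ≤
      (1 + φ * ∑ j, t j) * ∫ s, min s 1 ∂(stableLevy φ σ) := by
  unfold levyExponent
  rw [← integral_const_mul]
  refine integral_mono_ae (integrable_one_sub_jumpDensity hφ hσ ht)
    ((integrable_min_stableLevy hφ hσ).const_mul _) ?_
  filter_upwards [ae_pos_stableLevy φ σ] with s hs
  exact one_sub_jumpDensity_le hφ hs ht

theorem jumpMoment_pos (hφ : 0 < φ) (hσ : σ ∈ Ioo (0 : ℝ) 1) {c : Fin d → ℕ} (hc : c ≠ 0)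
    {t : Fin d → ℝ} (ht : ∀ j, 0 < t j) : 0 < jumpMoment φ σ c t := by
  have hpos : ∀ᵐ s ∂(stableLevy φ σ), 0 < jumpDensity φ c s t := by
    filter_upwards [ae_pos_stableLevy φ σ] with s hs
    exact jumpDensity_pos hφ hs (fun j => (ht j).le) c
  refine lt_of_le_of_ne (integral_nonneg_of_ae (hpos.mono fun s hs => hs.le)) fun h => ?_
  have h1 := (integral_eq_zero_iff_of_nonneg_ae (hpos.mono fun s hs => hs.le)
    (integrable_jumpDensity hφ hσ hc ht)).1 h.symm
  have h2 : ∀ᵐ s ∂(stableLevy φ σ), False := by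
    filter_upwards [h1, hpos] with s hs hs'
    exact hs'.ne' hs
  rw [eventually_false_iff_eq_bot, ae_eq_bot] at h2
  have := stableLevy_univ hφ hσ
  simp [h2] at this

theorem jumpMoment_antitone (hφ : 0 < φ) (hσ : σ ∈ Ioo (0 : ℝ) 1) {c : Fin d → ℕ} (hc : c ≠ 0)
    {t t' : Fin d → ℝ} (ht : ∀ j, 0 < t j) (htt' : ∀ j, t j ≤ t' j) :
    jumpMoment φ σ c t' ≤ jumpMoment φ σ c t := by
  refine integral_mono_ae (integrable_jumpDensity hφ hσ hc fun j => (ht j).trans_le (htt' j))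
    (integrable_jumpDensity hφ hσ hc ht) ?_
  filter_upwards [ae_pos_stableLevy φ σ] with s hs
  exact jumpDensity_antitone hφ hs (fun j => (ht j).le) htt' c

/-- Differentiating E[(sM)^c e^{-stM}] in t brings down -sM, so the order rises by one; in closed
form this is Γ(φ + c + 1) = (φ + c) Γ(φ + c). -/
theorem hasDerivAt_jumpFactor (hφ : 0 < φ) {s t : ℝ} (h : 0 < 1 + s * t) (c : ℕ) :
    HasDerivAt (fun t => jumpFactor φ s t c) (-jumpFactor φ s t (c + 1)) t := by
  have h1 : HasDerivAt (fun t => 1 + s * t) s t := by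
    simpa using ((hasDerivAt_id t).const_mul s).const_add 1
  have h2 := (h1.rpow_const (p := -(φ + c)) (Or.inl h.ne')).const_mul
    (Real.Gamma (φ + c) / Real.Gamma φ * s ^ c)
  refine h2.congr_deriv ?_
  unfold jumpFactor
  have h3 : Real.Gamma (φ + (c + 1 : ℕ)) = (φ + c) * Real.Gamma (φ + c) := by
    rw [← Real.Gamma_add_one (by positivity)]
    push_cast
    ring_nf
  rw [h3]
  have h4 : -(φ + ((c + 1 : ℕ) : ℝ)) = -(φ + c) - 1 := by push_cast; ring
  rw [h4]
  ring

theorem hasDerivAt_jumpDensity (hφ : 0 < φ) (c : Fin d → ℕ) {s : ℝ} {t : Fin d → ℝ} (j : Fin d)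
    {τ : ℝ} (h : 0 < 1 + s * (t j + τ)) :
    HasDerivAt (fun τ => jumpDensity φ c s (t + Pi.single j τ))
      (-jumpDensity φ (c + Pi.single j 1) s (t + Pi.single j τ)) τ := by
  have key : ∀ (c' : Fin d → ℕ) (τ : ℝ), (∀ i, i ≠ j → c' i = c i) →
      jumpDensity φ c' s (t + Pi.single j τ) = jumpFactor φ s (t j + τ) (c' j) *
        ∏ i ∈ Finset.univ.erase j, jumpFactor φ s (t i) (c i) := by
    intro c' τ hc'
    unfold jumpDensity
    rw [← Finset.mul_prod_erase _ _ (Finset.mem_univ j)]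
    congr 1
    · simp
    · refine Finset.prod_congr rfl fun i hi => ?_
      have hij := Finset.ne_of_mem_erase hi
      rw [hc' i hij]
      simp [hij]
  simp_rw [key c _ (fun _ _ => rfl)]
  rw [key (c + Pi.single j 1) τ (fun i hi => by simp [hi]), ← neg_mul]
  refine HasDerivAt.mul_const ?_ _
  have h1 := (hasDerivAt_jumpFactor hφ h (c j)).comp τ ((hasDerivAt_id τ).const_add (t j))
  simpa [Function.comp_def] using h1

/-- The half margin keeps the perturbed argument away from 0, so that the density at the constant
argument ε/2 dominates uniformly in τ. -/
theorem add_single_pos {t : Fin d → ℝ} {ε : ℝ} (ht : ∀ i, ε ≤ t i) (j : Fin d) {τ : ℝ}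
    (hτ : τ ∈ Metric.ball (0 : ℝ) (ε / 2)) (i : Fin d) : ε / 2 ≤ (t + Pi.single j τ : Fin d → ℝ) i := by
  have h1 : |τ| < ε / 2 := by simpa using hτ
  have h2 := (abs_lt.1 h1).1
  have h3 := ht i
  have h4 : 0 < ε := by linarith [abs_nonneg τ]
  by_cases hij : i = j
  · subst hij
    simp only [Pi.add_apply, Pi.single_eq_same]
    linarith
  · simp only [Pi.add_apply, Pi.single_eq_of_ne hij]
    linarith

theorem ae_hasDerivAt_jumpDensity (hφ : 0 < φ) (c : Fin d → ℕ) {t : Fin d → ℝ} {ε : ℝ}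
    (hε : 0 < ε) (ht : ∀ i, ε ≤ t i) (j : Fin d) :
    ∀ᵐ s ∂(stableLevy φ σ), ∀ τ ∈ Metric.ball (0 : ℝ) (ε / 2),
      HasDerivAt (fun τ => jumpDensity φ c s (t + Pi.single j τ))
        (-jumpDensity φ (c + Pi.single j 1) s (t + Pi.single j τ)) τ := by
  filter_upwards [ae_pos_stableLevy φ σ] with s hs τ hτ
  refine hasDerivAt_jumpDensity hφ c j ?_
  have h := add_single_pos ht j hτ j
  simp only [Pi.add_apply, Pi.single_eq_same] at h
  have : 0 < t j + τ := by linarith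
  positivity

theorem ae_norm_jumpDensity_le (hφ : 0 < φ) (c : Fin d → ℕ) {t : Fin d → ℝ} {ε : ℝ}
    (hε : 0 < ε) (ht : ∀ i, ε ≤ t i) (j : Fin d) :
    ∀ᵐ s ∂(stableLevy φ σ), ∀ τ ∈ Metric.ball (0 : ℝ) (ε / 2),
      ‖-jumpDensity φ c s (t + Pi.single j τ)‖ ≤ jumpDensity φ c s fun _ => ε / 2 := by
  filter_upwards [ae_pos_stableLevy φ σ] with s hs τ hτ
  have h1 := add_single_pos ht j hτ
  rw [norm_neg, Real.norm_of_nonneg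
    (jumpDensity_pos hφ hs (fun i => (half_pos hε).le.trans (h1 i)) c).le]
  exact jumpDensity_antitone hφ hs (fun _ => (half_pos hε).le) h1 c

theorem add_single_ne_zero (c : Fin d → ℕ) (j : Fin d) : c + Pi.single j 1 ≠ 0 := by
  intro h
  have := congrFun h j
  simp at this

/-- Differentiation under the integral, dominated by the density of the raised order at ε/2, since
densities decrease in their argument. -/
theorem hasDerivAt_jumpMoment (hφ : 0 < φ) (hσ : σ ∈ Ioo (0 : ℝ) 1) {c : Fin d → ℕ} (hc : c ≠ 0)
    {t : Fin d → ℝ} {ε : ℝ} (hε : 0 < ε) (ht : ∀ i, ε ≤ t i) (j : Fin d) {τ : ℝ}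
    (hτ : τ ∈ Metric.ball (0 : ℝ) (ε / 2)) :
    HasDerivAt (fun τ => jumpMoment φ σ c (t + Pi.single j τ))
      (-jumpMoment φ σ (c + Pi.single j 1) (t + Pi.single j τ)) τ := by
  have hε2 : ∀ _ : Fin d, 0 < ε / 2 := fun _ => half_pos hε
  have hint : Integrable (fun s => jumpDensity φ c s (t + Pi.single j τ)) (stableLevy φ σ) :=
    integrable_jumpDensity hφ hσ hc fun i => (hε2 i).trans_le (add_single_pos ht j hτ i)
  have hbd : Integrable (fun s => jumpDensity φ (c + Pi.single j 1) s fun _ => ε / 2)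
      (stableLevy φ σ) := integrable_jumpDensity hφ hσ (add_single_ne_zero c j) hε2
  have h : HasDerivAt (fun τ => ∫ s, jumpDensity φ c s (t + Pi.single j τ) ∂(stableLevy φ σ))
      (∫ s, -jumpDensity φ (c + Pi.single j 1) s (t + Pi.single j τ) ∂(stableLevy φ σ)) τ := by
    let F : ℝ → ℝ → ℝ := fun τ s => jumpDensity φ c s (t + Pi.single j τ)
    let F' : ℝ → ℝ → ℝ := fun τ s => -jumpDensity φ (c + Pi.single j 1) s (t + Pi.single j τ)
    have hint' : Integrable (F τ) (stableLevy φ σ) := hint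
    refine hasDerivAt_integral_ball (F := F) (F' := F') (bound := fun s => jumpDensity φ (c + Pi.single j 1) s
      fun _ => ε / 2) hτ ?_ hint' ?_ ?_ hbd ?_
    · exact Eventually.of_forall fun τ => (measurable_jumpDensity_left φ c _).aestronglyMeasurable
    · exact (measurable_jumpDensity_left φ _ _).neg.aestronglyMeasurable
    · exact ae_norm_jumpDensity_le hφ _ hε ht j
    · exact ae_hasDerivAt_jumpDensity hφ c hε ht j
  rwa [integral_neg] at h

/-- The density of order zero is not integrable, so its complement to 1 is differentiated; one
derivative leads to the integrable moments of order one. -/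
theorem hasDerivAt_levyExponent (hφ : 0 < φ) (hσ : σ ∈ Ioo (0 : ℝ) 1)
    {t : Fin d → ℝ} {ε : ℝ} (hε : 0 < ε) (ht : ∀ i, ε ≤ t i) (j : Fin d) {τ : ℝ}
    (hτ : τ ∈ Metric.ball (0 : ℝ) (ε / 2)) :
    HasDerivAt (fun τ => levyExponent φ σ (t + Pi.single j τ))
      (jumpMoment φ σ (Pi.single j 1) (t + Pi.single j τ)) τ := by
  have hε2 : ∀ _ : Fin d, 0 < ε / 2 := fun _ => half_pos hε
  have hint : Integrable (fun s => 1 - jumpDensity φ 0 s (t + Pi.single j τ)) (stableLevy φ σ) :=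
    integrable_one_sub_jumpDensity hφ hσ fun i => (hε2 i).le.trans (add_single_pos ht j hτ i)
  have hbd : Integrable (fun s => jumpDensity φ (0 + Pi.single j 1) s fun _ => ε / 2)
      (stableLevy φ σ) := integrable_jumpDensity hφ hσ (add_single_ne_zero 0 j) hε2
  have hle := ae_norm_jumpDensity_le (σ := σ) hφ (0 + Pi.single j 1) hε ht j
  have h : HasDerivAt
      (fun τ => ∫ s, (1 - jumpDensity φ 0 s (t + Pi.single j τ)) ∂(stableLevy φ σ))
      (∫ s, - -jumpDensity φ (0 + Pi.single j 1) s (t + Pi.single j τ) ∂(stableLevy φ σ)) τ := by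
    let F : ℝ → ℝ → ℝ := fun τ s => 1 - jumpDensity φ 0 s (t + Pi.single j τ)
    let F' : ℝ → ℝ → ℝ := fun τ s => - -jumpDensity φ (0 + Pi.single j 1) s (t + Pi.single j τ)
    have hint' : Integrable (F τ) (stableLevy φ σ) := hint
    refine hasDerivAt_integral_ball (F := F) (F' := F') (bound := fun s => jumpDensity φ (0 + Pi.single j 1) s
      fun _ => ε / 2) hτ ?_ hint' ?_ ?_ hbd ?_
    · exact Eventually.of_forall fun τ =>
        (measurable_const.sub (measurable_jumpDensity_left φ 0 _)).aestronglyMeasurable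
    · exact (measurable_jumpDensity_left φ _ _).neg.neg.aestronglyMeasurable
    · exact hle.mono fun s hs τ hτ => (norm_neg _).trans_le (hs τ hτ)
    · exact (ae_hasDerivAt_jumpDensity hφ 0 hε ht j).mono fun s hs τ hτ => (hs τ hτ).const_sub 1
  simp only [neg_neg, zero_add] at h
  exact h

end

attribute [irreducible] jumpMoment levyExponent jumpDensity

/-- Differentiating a Laplace transform at the origin. -/
theorem integral_mul_of_hasDerivAt_laplace {Ω : Type*} [MeasurableSpace Ω] {P : Measure Ω}
    {Y b : Ω → ℝ} (hY : Measurable Y) (hb : Measurable b) (hY0 : ∀ ω, 0 ≤ Y ω)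
    (hb0 : ∀ ω, 0 ≤ b ω) {R : ℝ → ℝ} {r : ℝ} (hR : HasDerivAt R (-r) 0)
    (hint : ∀ τ, 0 ≤ τ → Integrable (fun ω => Y ω * Real.exp (-(τ * b ω))) P)
    (hRe : ∀ τ, 0 ≤ τ → ∫ ω, Y ω * Real.exp (-(τ * b ω)) ∂P = R τ) :
    Integrable (fun ω => Y ω * b ω) P ∧ ∫ ω, Y ω * b ω ∂P = r := by
  -- The transform is known for τ ≥ 0 only, so the derivative at 0 is read along a sequence from the
  -- right.
  let τ : ℕ → ℝ := fun n => 1 / ((n : ℝ) + 1)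
  have hτ0 : ∀ n, 0 < τ n := fun n => by positivity
  have hτ : Tendsto τ atTop (𝓝 0) := tendsto_one_div_add_atTop_nhds_zero_nat
  have hτ' : Tendsto τ atTop (𝓝[≠] 0) :=
    tendsto_nhdsWithin_iff.2 ⟨hτ, Eventually.of_forall fun n => (hτ0 n).ne'⟩
  -- Difference quotients of the exponential: they lie between 0 and Y b because 1 - e^{-x} ≤ x,
  -- converge to Y b, and their integrals are the difference quotients of R.
  let g : ℕ → Ω → ℝ := fun n ω => Y ω * ((1 - Real.exp (-(τ n * b ω))) / τ n)
  have hg0 : ∀ n ω, 0 ≤ g n ω := fun n ω => by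
    have : Real.exp (-(τ n * b ω)) ≤ 1 :=
      Real.exp_le_one_iff.2 (by nlinarith [mul_nonneg (hτ0 n).le (hb0 ω)])
    exact mul_nonneg (hY0 ω) (div_nonneg (by linarith) (hτ0 n).le)
  have hgle : ∀ n ω, g n ω ≤ Y ω * b ω := fun n ω => by
    refine mul_le_mul_of_nonneg_left ?_ (hY0 ω)
    rw [div_le_iff₀ (hτ0 n)]
    have := Real.add_one_le_exp (-(τ n * b ω))
    linarith
  have hgm : ∀ n, Measurable (g n) := fun n =>
    hY.mul ((measurable_const.sub (hb.const_mul _).neg.exp).div_const _)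
  have hgint : ∀ n, Integrable (g n) P := fun n => by
    have h := ((hint 0 le_rfl).sub (hint (τ n) (hτ0 n).le)).div_const (τ n)
    refine h.congr (Eventually.of_forall fun ω => ?_)
    simp only [Pi.sub_apply, g, zero_mul, neg_zero, Real.exp_zero]
    ring
  have hgI : ∀ n, ∫ ω, g n ω ∂P = (R 0 - R (τ n)) / τ n := fun n => by
    rw [← hRe 0 le_rfl, ← hRe (τ n) (hτ0 n).le, ← integral_sub (hint 0 le_rfl)
      (hint (τ n) (hτ0 n).le), ← integral_div]
    refine integral_congr_ae (Eventually.of_forall fun ω => ?_)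
    simp only [g, zero_mul, neg_zero, Real.exp_zero]
    ring
  have hlim : Tendsto (fun n => ∫ ω, g n ω ∂P) atTop (𝓝 r) := by
    have h1 := (hasDerivAt_iff_tendsto_slope.1 hR).comp hτ'
    have h2 := h1.neg
    rw [neg_neg] at h2
    refine h2.congr fun n => ?_
    rw [hgI, Function.comp_apply, slope_def_field, sub_zero, ← neg_div, neg_sub]
  have hpt : ∀ ω, Tendsto (fun n => g n ω) atTop (𝓝 (Y ω * b ω)) := fun ω => by
    refine Tendsto.const_mul _ ?_
    have h0 : HasDerivAt (fun t => Real.exp (-(t * b ω))) (-b ω) 0 := by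
      have := ((hasDerivAt_id (0 : ℝ)).mul_const (b ω)).neg.exp
      simpa using this
    have h1 := ((hasDerivAt_iff_tendsto_slope.1 h0).comp hτ').neg
    rw [neg_neg] at h1
    refine h1.congr fun n => ?_
    rw [Function.comp_apply, slope_def_field]
    simp only [sub_zero, zero_mul, neg_zero, Real.exp_zero]
    rw [← neg_div, neg_sub]
  -- Y b is not yet known to be integrable. Fatou's lemma gives this, and then Y b can serve as the
  -- dominating function.
  have hfin : ∫⁻ ω, ENNReal.ofReal (Y ω * b ω) ∂P ≤ ENNReal.ofReal r := by
    have h1 : ∀ ω, ENNReal.ofReal (Y ω * b ω) = liminf (fun n => ENNReal.ofReal (g n ω)) atTop :=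
      fun ω => ((ENNReal.continuous_ofReal.tendsto _).comp (hpt ω)).liminf_eq.symm
    simp_rw [h1]
    refine (lintegral_liminf_le fun n => (hgm n).ennreal_ofReal).trans ?_
    have h2 : ∀ n, ∫⁻ ω, ENNReal.ofReal (g n ω) ∂P = ENNReal.ofReal (∫ ω, g n ω ∂P) := fun n =>
      (ofReal_integral_eq_lintegral_ofReal (hgint n) (Eventually.of_forall (hg0 n))).symm
    simp_rw [h2]
    exact ((ENNReal.continuous_ofReal.tendsto _).comp hlim).liminf_eq.le
  have hYb : Integrable (fun ω => Y ω * b ω) P := by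
    refine ⟨(hY.mul hb).aestronglyMeasurable, ?_⟩
    rw [hasFiniteIntegral_iff_ofReal (Eventually.of_forall fun ω => mul_nonneg (hY0 ω) (hb0 ω))]
    exact hfin.trans_lt ENNReal.ofReal_lt_top
  refine ⟨hYb, tendsto_nhds_unique ?_ hlim⟩
  refine tendsto_integral_of_dominated_convergence _ (fun n => (hgm n).aestronglyMeasurable) hYb
    (fun n => Eventually.of_forall fun ω => ?_) (Eventually.of_forall hpt)
  rw [Real.norm_of_nonneg (hg0 n ω)]
  exact hgle n ω

/-! ### Blocks of equal observations -/

section Blocks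

open Classical in
/-- The number of indices `i` with `g i = j` and `z i = y`. -/
noncomputable def blockCount {X : Type*} {d N : ℕ} (g : Fin N → Fin d) (z : Fin N → X) (y : X)
    (j : Fin d) : ℕ :=
  (Finset.univ.filter fun i => z i = y ∧ g i = j).card

open Classical in
/-- The product over the distinct values `y` of `z` of the jump moments at `θ y`. -/
noncomputable def blockMoment {X : Type*} {d N : ℕ} (φ σ : ℝ) (g : Fin N → Fin d) (z : Fin N → X)
    (θ : X → Fin d → ℝ) : ℝ :=
  ∏ y ∈ Finset.univ.image z, jumpMoment φ σ (blockCount g z y) (θ y)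

variable {X : Type*} {d N : ℕ} {φ σ : ℝ}

theorem blockCount_ne_zero (g : Fin N → Fin d) (z : Fin N → X) (i : Fin N) :
    blockCount g z (z i) ≠ 0 := by
  classical
  intro h
  have h1 := congrFun h (g i)
  simp only [blockCount, Pi.zero_apply, Finset.card_eq_zero] at h1
  have : i ∈ Finset.univ.filter fun i' => z i' = z i ∧ g i' = g i := by simp
  simp [h1] at this

theorem blockCount_eq_zero (g : Fin N → Fin d) (z : Fin N → X) {y : X} (hy : ∀ i, z i ≠ y) :
    blockCount g z y = 0 := by
  ext j
  simp [blockCount, hy]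

theorem blockCount_le (g : Fin N → Fin d) (z : Fin N → X) (y : X) (j : Fin d) :
    blockCount g z y j ≤ N := by
  classical
  exact (Finset.card_filter_le _ _).trans (by simp)

theorem blockCount_cons_self (g : Fin N → Fin d) (z : Fin N → X) (y : X) (j : Fin d) :
    blockCount (Fin.cons j g : Fin (N + 1) → Fin d) (Fin.cons y z : Fin (N + 1) → X) y =
      blockCount g z y + Pi.single j 1 := by
  classical
  ext i
  simp only [blockCount, Finset.card_filter, Fin.sum_univ_succ, Fin.cons_zero, Fin.cons_succ,
    true_and, Pi.add_apply]
  rw [add_comm]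
  congr 1
  by_cases h : j = i
  · subst h; simp
  · rw [if_neg h, Pi.single_eq_of_ne (Ne.symm h)]

theorem blockCount_cons_of_ne (g : Fin N → Fin d) (z : Fin N → X) {y y' : X} (h : y ≠ y')
    (j : Fin d) :
    blockCount (Fin.cons j g : Fin (N + 1) → Fin d) (Fin.cons y z : Fin (N + 1) → X) y' =
      blockCount g z y' := by
  classical
  ext i
  simp only [blockCount, Finset.card_filter, Fin.sum_univ_succ, Fin.cons_zero, Fin.cons_succ]
  rw [if_neg fun h' => h h'.1, zero_add]

theorem image_cons [DecidableEq X] (z : Fin N → X) (y : X) :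
    Finset.univ.image (Fin.cons y z : Fin (N + 1) → X) = insert y (Finset.univ.image z) := by
  ext x
  simp [Fin.exists_fin_succ, eq_comm]

/-- The fresh point: it opens a block with count vector e_j and leaves the other factors alone. This
is the term that arises when the exponential of the Lévy exponent is differentiated. -/
theorem blockMoment_cons_of_notMem (g : Fin N → Fin d) (z : Fin N → X) {y : X}
    (hy : ∀ i, z i ≠ y) (j : Fin d) (θ : X → Fin d → ℝ) :
    blockMoment φ σ (Fin.cons j g : Fin (N + 1) → Fin d) (Fin.cons y z : Fin (N + 1) → X) θ =
      jumpMoment φ σ (Pi.single j 1) (θ y) * blockMoment φ σ g z θ := by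
  classical
  unfold blockMoment
  rw [image_cons, Finset.prod_insert (by simpa using hy), blockCount_cons_self,
    blockCount_eq_zero g z hy, zero_add]
  congr 1
  refine Finset.prod_congr rfl fun y' hy' => ?_
  rw [blockCount_cons_of_ne]
  rintro rfl
  obtain ⟨i, -, hi⟩ := Finset.mem_image.1 hy'
  exact hy i hi

/-- The repeated point: only the factor of its own block changes, as when the product of the block
moments is differentiated. -/
theorem blockMoment_cons_of_mem [DecidableEq X] (g : Fin N → Fin d) (z : Fin N → X) {y : X}
    (hy : y ∈ Finset.univ.image z) (j : Fin d) (θ : X → Fin d → ℝ) :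
    blockMoment φ σ (Fin.cons j g : Fin (N + 1) → Fin d) (Fin.cons y z : Fin (N + 1) → X) θ =
      jumpMoment φ σ (blockCount g z y + Pi.single j 1) (θ y) *
        ∏ y' ∈ (Finset.univ.image z).erase y, jumpMoment φ σ (blockCount g z y') (θ y') := by
  unfold blockMoment
  have h : ∀ (_ : DecidableEq X), Finset.univ.image (Fin.cons y z : Fin (N + 1) → X) =
      Finset.univ.image z := fun _ => by rw [image_cons, Finset.insert_eq_of_mem (by convert! hy)]
  rw [h, ← Finset.mul_prod_erase _ _ (by convert! hy), blockCount_cons_self]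
  congr 1
  refine Finset.prod_congr (by congr!) fun y' hy' => ?_
  rw [blockCount_cons_of_ne g z (Finset.ne_of_mem_erase hy').symm]

theorem blockMoment_pos (hφ : 0 < φ) (hσ : σ ∈ Ioo (0 : ℝ) 1) (g : Fin N → Fin d) (z : Fin N → X)
    {θ : X → Fin d → ℝ} (hθ : ∀ y j, 0 < θ y j) : 0 < blockMoment φ σ g z θ := by
  classical
  refine Finset.prod_pos fun y hy => ?_
  obtain ⟨i, -, rfl⟩ := Finset.mem_image.1 hy
  exact jumpMoment_pos hφ hσ (blockCount_ne_zero g z i) (hθ _)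

/-- A bound for the block moments at arguments that are at least `ε`. -/
noncomputable def blockBound (φ σ : ℝ) (d N : ℕ) (ε : ℝ) : ℝ :=
  (1 + ∑ c ∈ Fintype.piFinset fun _ : Fin d => Finset.range (N + 1),
    |jumpMoment φ σ c fun _ => ε|) ^ N

/-- Counts lie in the finite box {0, …, N}^d, so a sum over this box dominates every factor; the
summand 1 in `blockBound` allows the number of blocks to be replaced by N. -/
theorem blockMoment_le (hφ : 0 < φ) (hσ : σ ∈ Ioo (0 : ℝ) 1) (g : Fin N → Fin d) (z : Fin N → X)
    {θ : X → Fin d → ℝ} {ε : ℝ} (hε : 0 < ε) (hθ : ∀ y j, ε ≤ θ y j) :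
    blockMoment φ σ g z θ ≤ blockBound φ σ d N ε := by
  classical
  have hS : 0 ≤ ∑ c ∈ Fintype.piFinset fun _ : Fin d => Finset.range (N + 1),
    |jumpMoment φ σ c fun _ => ε| := Finset.sum_nonneg fun _ _ => abs_nonneg _
  unfold blockMoment blockBound
  calc _ ≤ ∏ y ∈ Finset.univ.image z, (1 + ∑ c ∈ Fintype.piFinset fun _ : Fin d =>
        Finset.range (N + 1), |jumpMoment φ σ c fun _ => ε|) := by
        refine Finset.prod_le_prod (fun y hy => ?_) fun y hy => ?_
        · obtain ⟨i, -, rfl⟩ := Finset.mem_image.1 hy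
          exact (jumpMoment_pos hφ hσ (blockCount_ne_zero g z i)
            fun j => hε.trans_le (hθ _ j)).le
        · obtain ⟨i, -, rfl⟩ := Finset.mem_image.1 hy
          refine (jumpMoment_antitone hφ hσ (blockCount_ne_zero g z i) (t := fun _ => ε)
            (fun _ => hε) (hθ _)).trans ?_
          have h1 : blockCount g z (z i) ∈ Fintype.piFinset fun _ : Fin d =>
              Finset.range (N + 1) := by
            simp [blockCount_le]
          have h2 := Finset.single_le_sum (f := fun c => |jumpMoment φ σ c fun _ => ε|)
            (fun _ _ => abs_nonneg _) h1
          linarith [le_abs_self (jumpMoment φ σ (blockCount g z (z i)) fun _ => ε)]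
    _ = (1 + ∑ c ∈ Fintype.piFinset fun _ : Fin d =>
        Finset.range (N + 1), |jumpMoment φ σ c fun _ => ε|) ^ (Finset.univ.image z).card := by
        rw [Finset.prod_const]
    _ ≤ _ := pow_le_pow_right₀ (by linarith) (Finset.card_image_le.trans (by simp))

/-- `θ` shifted by `τ` in direction `j` on the set `B`. -/
noncomputable def shiftOn (θ : X → Fin d → ℝ) (B : Set X) (j : Fin d) (τ : ℝ) (y : X) :
    Fin d → ℝ :=
  θ y + Pi.single j (τ * B.indicator 1 y)

theorem shiftOn_of_mem (θ : X → Fin d → ℝ) {B : Set X} (j : Fin d) (τ : ℝ) {y : X} (hy : y ∈ B) :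
    shiftOn θ B j τ y = θ y + Pi.single j τ := by
  simp [shiftOn, hy]

theorem shiftOn_of_notMem (θ : X → Fin d → ℝ) {B : Set X} (j : Fin d) (τ : ℝ) {y : X}
    (hy : y ∉ B) : shiftOn θ B j τ y = θ y := by
  simp [shiftOn, hy]

theorem shiftOn_zero (θ : X → Fin d → ℝ) (B : Set X) (j : Fin d) : shiftOn θ B j 0 = θ := by
  ext y i
  simp [shiftOn]

theorem le_shiftOn {θ : X → Fin d → ℝ} {ε : ℝ} (hθ : ∀ y j, ε ≤ θ y j) (B : Set X)
    (j : Fin d) {τ : ℝ} (hτ : τ ∈ Metric.ball (0 : ℝ) (ε / 2)) (y : X) (i : Fin d) :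
    ε / 2 ≤ shiftOn θ B j τ y i := by
  by_cases hy : y ∈ B
  · rw [shiftOn_of_mem θ j τ hy]
    exact add_single_pos (hθ y) j hτ i
  · rw [shiftOn_of_notMem θ j τ hy]
    have h1 : |τ| < ε / 2 := by simpa using hτ
    linarith [hθ y i, abs_nonneg τ]

theorem hasDerivAt_jumpMoment_shiftOn (hφ : 0 < φ) (hσ : σ ∈ Ioo (0 : ℝ) 1) {c : Fin d → ℕ}
    (hc : c ≠ 0) {θ : X → Fin d → ℝ} {ε : ℝ} (hε : 0 < ε) (hθ : ∀ y j, ε ≤ θ y j) (B : Set X)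
    (j : Fin d) {τ : ℝ} (hτ : τ ∈ Metric.ball (0 : ℝ) (ε / 2)) (y : X) :
    HasDerivAt (fun τ => jumpMoment φ σ c (shiftOn θ B j τ y))
      (-(B.indicator 1 y * jumpMoment φ σ (c + Pi.single j 1) (shiftOn θ B j τ y))) τ := by
  by_cases hy : y ∈ B
  · simp_rw [shiftOn_of_mem θ j _ hy, indicator_of_mem hy, Pi.one_apply, one_mul]
    exact hasDerivAt_jumpMoment hφ hσ hc hε (hθ y) j hτ
  · simp_rw [shiftOn_of_notMem θ j _ hy, indicator_of_notMem hy, zero_mul, neg_zero]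
    exact hasDerivAt_const _ _

theorem hasDerivAt_levyExponent_shiftOn (hφ : 0 < φ) (hσ : σ ∈ Ioo (0 : ℝ) 1)
    {θ : X → Fin d → ℝ} {ε : ℝ} (hε : 0 < ε) (hθ : ∀ y j, ε ≤ θ y j) (B : Set X)
    (j : Fin d) {τ : ℝ} (hτ : τ ∈ Metric.ball (0 : ℝ) (ε / 2)) (y : X) :
    HasDerivAt (fun τ => levyExponent φ σ (shiftOn θ B j τ y))
      (B.indicator 1 y * jumpMoment φ σ (Pi.single j 1) (shiftOn θ B j τ y)) τ := by
  by_cases hy : y ∈ B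
  · simp_rw [shiftOn_of_mem θ j _ hy, indicator_of_mem hy, Pi.one_apply, one_mul]
    exact hasDerivAt_levyExponent hφ hσ hε (hθ y) j hτ
  · simp_rw [shiftOn_of_notMem θ j _ hy, indicator_of_notMem hy, zero_mul]
    exact hasDerivAt_const _ _

/-- Product rule. The factor of y moves only if y lies in B, and its derivative raises the count of
y in group j, which amounts to observing y once more. -/
theorem hasDerivAt_blockMoment_shiftOn [DecidableEq X] (hφ : 0 < φ) (hσ : σ ∈ Ioo (0 : ℝ) 1)
    (g : Fin N → Fin d) (z : Fin N → X)
    {θ : X → Fin d → ℝ} {ε : ℝ} (hε : 0 < ε) (hθ : ∀ y j, ε ≤ θ y j) (B : Set X)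
    (j : Fin d) {τ : ℝ} (hτ : τ ∈ Metric.ball (0 : ℝ) (ε / 2)) :
    HasDerivAt (fun τ => blockMoment φ σ g z (shiftOn θ B j τ))
      (-∑ y ∈ Finset.univ.image z, B.indicator 1 y * blockMoment φ σ
        (Fin.cons j g : Fin (N + 1) → Fin d) (Fin.cons y z : Fin (N + 1) → X)
        (shiftOn θ B j τ)) τ := by
  have h0 : (fun τ => blockMoment φ σ g z (shiftOn θ B j τ)) = fun τ =>
      ∏ y ∈ Finset.univ.image z, jumpMoment φ σ (blockCount g z y) (shiftOn θ B j τ y) := by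
    ext τ
    unfold blockMoment
    congr!
  rw [h0]
  have h := HasDerivAt.fun_finsetProd (u := Finset.univ.image z)
    (f := fun y τ => jumpMoment φ σ (blockCount g z y) (shiftOn θ B j τ y))
    (f' := fun y => -(B.indicator 1 y * jumpMoment φ σ (blockCount g z y + Pi.single j 1)
      (shiftOn θ B j τ y))) (x := τ) fun y hy => by
        obtain ⟨i, -, rfl⟩ := Finset.mem_image.1 hy
        exact hasDerivAt_jumpMoment_shiftOn hφ hσ (blockCount_ne_zero g z i) hε hθ B j hτ (z i)
  refine h.congr_deriv ?_
  rw [← Finset.sum_neg_distrib]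
  refine Finset.sum_congr rfl fun y hy => ?_
  rw [blockMoment_cons_of_mem g z hy, smul_eq_mul]
  ring

/-- The index `i` is the first one at which `z` takes the value `z i`. -/
def IsFirst (z : Fin N → X) (i : Fin N) : Prop := ∀ i' < i, z i' ≠ z i

theorem exists_isFirst (z : Fin N → X) (i : Fin N) : ∃ i', IsFirst z i' ∧ z i' = z i := by
  classical
  have hne : (Finset.univ.filter fun i' => z i' = z i).Nonempty := ⟨i, by simp⟩
  refine ⟨(Finset.univ.filter fun i' => z i' = z i).min' hne, fun i' hi' h => ?_, ?_⟩
  · have h1 : z ((Finset.univ.filter fun i' => z i' = z i).min' hne) = z i := by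
      simpa using Finset.min'_mem _ hne
    exact (Finset.min'_le _ i' (by simp [h, h1])).not_gt hi'
  · simpa using Finset.min'_mem _ hne

-- The set of distinct values varies with z. Selecting first occurrences gives a product over fixed
-- indices, from which measurability in z can be read off.
open Classical in
theorem prod_image_eq_prod_isFirst {M : Type*} [CommMonoid M] (z : Fin N → X) (F : X → M) :
    ∏ y ∈ Finset.univ.image z, F y = ∏ i, if IsFirst z i then F (z i) else 1 := by
  rw [← Finset.prod_filter]
  have h : Finset.univ.image z = (Finset.univ.filter (IsFirst z)).image z := by
    ext y
    simp only [Finset.mem_image, Finset.mem_univ, true_and, Finset.mem_filter]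
    constructor
    · rintro ⟨i, rfl⟩
      exact exists_isFirst z i
    · rintro ⟨i, -, rfl⟩
      exact ⟨i, rfl⟩
  rw [h, Finset.prod_image]
  intro i hi i' hi' hii'
  have h1 : IsFirst z i := by simpa using hi
  have h2 : IsFirst z i' := by simpa using hi'
  rcases lt_trichotomy i i' with h | h | h
  · exact (h2 i h hii').elim
  · exact h
  · exact (h1 i' h hii'.symm).elim

open Classical in
theorem sum_image_eq_sum_isFirst {M : Type*} [AddCommMonoid M] (z : Fin N → X) (F : X → M) :
    ∑ y ∈ Finset.univ.image z, F y = ∑ i, if IsFirst z i then F (z i) else 0 :=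
  prod_image_eq_prod_isFirst (M := Multiplicative M) z F

variable [MeasurableSpace X] [TopologicalSpace X] [PolishSpace X] [BorelSpace X]

theorem measurableSet_isFirst (i : Fin N) : MeasurableSet {z : Fin N → X | IsFirst z i} := by
  have : {z : Fin N → X | IsFirst z i} = ⋂ i', ⋂ _ : i' < i, {z | z i' = z i}ᶜ := by
    ext z
    simp [IsFirst]
  rw [this]
  exact MeasurableSet.iInter fun i' => MeasurableSet.iInter fun _ =>
    (measurableSet_eq_fun (measurable_pi_apply i') (measurable_pi_apply i)).compl

theorem measurable_blockCount (g : Fin N → Fin d) (i : Fin N) :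
    Measurable fun z : Fin N → X => blockCount g z (z i) := by
  classical
  refine measurable_pi_lambda _ fun j => ?_
  simp only [blockCount, Finset.card_filter]
  refine Finset.measurable_sum _ fun i' _ => ?_
  refine Measurable.ite ?_ measurable_const measurable_const
  have hE : MeasurableSet {z : Fin N → X | z i' = z i} :=
    measurableSet_eq_fun (measurable_pi_apply i') (measurable_pi_apply i)
  by_cases h : g i' = j
  · simpa only [h, and_true] using hE
  · simp [h]

theorem Measurable.binary {A B C D : Type*} [MeasurableSpace A] [MeasurableSpace B]
    [MeasurableSpace C] [MeasurableSpace D] (F : B → C → D)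
    (hF : Measurable fun q : B × C => F q.1 q.2) {f : A → B} {g : A → C} (hf : Measurable f)
    (hg : Measurable g) : Measurable fun a => F (f a) (g a) :=
  hF.comp (hf.prodMk hg)

theorem measurable_blockMoment {W : Type*} [MeasurableSpace W] (φ σ : ℝ) (g : Fin N → Fin d)
    {θ : W → X → Fin d → ℝ} (hθ : Measurable (Function.uncurry θ)) :
    Measurable fun p : (Fin N → X) × W => blockMoment φ σ g p.1 (θ p.2) := by
  classical
  have h1 : Measurable fun q : (Fin d → ℕ) × (Fin d → ℝ) => jumpMoment φ σ q.1 q.2 :=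
    measurable_from_prod_countable_right fun c => measurable_jumpMoment φ σ c
  unfold blockMoment
  simp_rw [prod_image_eq_prod_isFirst]
  generalize jumpMoment (d := d) φ σ = K at h1 ⊢
  have hev : ∀ i, Measurable fun p : (Fin N → X) × W => p.1 i := fun i =>
    (measurable_pi_apply i).comp measurable_fst
  have h2 : ∀ i, Measurable fun p : (Fin N → X) × W => blockCount g p.1 (p.1 i) := fun i =>
    (measurable_blockCount g i).comp measurable_fst
  have h3 : ∀ i, Measurable fun p : (Fin N → X) × W => θ p.2 (p.1 i) := fun i =>
    hθ.comp (measurable_snd.prodMk (hev i))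
  have h4 : ∀ i, Measurable fun p : (Fin N → X) × W =>
      K (blockCount g p.1 (p.1 i)) (θ p.2 (p.1 i)) := fun i =>
    Measurable.binary K h1 (h2 i) (h3 i)
  have h5 : ∀ i, MeasurableSet {p : (Fin N → X) × W | IsFirst p.1 i} := fun i =>
    measurable_fst (measurableSet_isFirst i)
  have h6 : ∀ i, Measurable fun p : (Fin N → X) × W =>
      if IsFirst p.1 i then K (blockCount g p.1 (p.1 i)) (θ p.2 (p.1 i)) else 1 :=
    fun i => Measurable.ite (h5 i) (h4 i) measurable_const
  exact Finset.measurable_prod _ fun i _ => h6 i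

theorem measurable_blockMoment_left (φ σ : ℝ) (g : Fin N → Fin d)
    {θ : X → Fin d → ℝ} (hθ : Measurable θ) :
    Measurable fun z : Fin N → X => blockMoment φ σ g z θ := by
  have h1 : Measurable (Function.uncurry fun (_ : Unit) => θ) := hθ.comp measurable_snd
  have h2 := measurable_blockMoment φ σ g h1
  generalize blockMoment φ σ g = K at h2 ⊢
  exact Measurable.binary (fun z (_ : Unit) => K z θ) h2
    (f := id) (g := fun _ => ()) measurable_id measurable_const

end Blocks

attribute [irreducible] blockMoment

/-! ### Mixed moments of the masses -/

section Moments

variable {X : Type*} [MeasurableSpace X] {d N : ℕ} {φ σ : ℝ}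

theorem measurable_cons : Measurable fun p : X × (Fin N → X) =>
    (Fin.cons p.1 p.2 : Fin (N + 1) → X) := by
  refine measurable_pi_lambda _ fun i => ?_
  refine Fin.cases ?_ (fun i => ?_) i
  · exact measurable_fst
  · simp only [Fin.cons_succ]
    exact (measurable_pi_apply i).comp measurable_snd

theorem measurable_cons_self (i : Fin N) : Measurable fun z : Fin N → X =>
    (Fin.cons (z i) z : Fin (N + 1) → X) :=
  measurable_cons.comp ((measurable_pi_apply i).prodMk measurable_id)

theorem measurable_shiftOn {θ : X → Fin d → ℝ} (hθ : Measurable θ) {B : Set X}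
    (hB : MeasurableSet B) (j : Fin d) (τ : ℝ) : Measurable (shiftOn θ B j τ) := by
  refine measurable_pi_lambda _ fun i => ?_
  have h1 : Measurable fun y => θ y i := (measurable_pi_apply i).comp hθ
  have h2 : Measurable fun y => τ * B.indicator (1 : X → ℝ) y :=
    (measurable_one.indicator hB).const_mul τ
  have h3 : (fun y => shiftOn θ B j τ y i) =
      fun y => θ y i + if i = j then τ * B.indicator (1 : X → ℝ) y else 0 := by
    ext y
    simp [shiftOn, Pi.single_apply]
  rw [h3]
  split_ifs with h
  · exact h1.add h2
  · exact h1.add measurable_const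

theorem hasDerivAt_integral_levyExponent_shiftOn (hφ : 0 < φ) (hσ : σ ∈ Ioo (0 : ℝ) 1)
    (α : Measure X) [IsFiniteMeasure α] {θ : X → Fin d → ℝ} (hm : Measurable θ) {ε M : ℝ}
    (hε : 0 < ε) (hθ : ∀ y j, ε ≤ θ y j) (hM : ∀ y j, θ y j ≤ M) {B : Set X}
    (hB : MeasurableSet B) (j : Fin d) :
    HasDerivAt (fun τ => ∫ y, levyExponent φ σ (shiftOn θ B j τ y) ∂α)
      (∫ y, B.indicator 1 y * jumpMoment φ σ (Pi.single j 1) (θ y) ∂α) 0 := by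
  have h0 : (0 : ℝ) ∈ Metric.ball (0 : ℝ) (ε / 2) := Metric.mem_ball_self (half_pos hε)
  let F : ℝ → X → ℝ := fun τ y => levyExponent φ σ (shiftOn θ B j τ y)
  let F' : ℝ → X → ℝ := fun τ y =>
    B.indicator 1 y * jumpMoment φ σ (Pi.single j 1) (shiftOn θ B j τ y)
  have hj : (Pi.single j 1 : Fin d → ℕ) ≠ 0 := by simp
  have hFm : ∀ τ, Measurable (F τ) := fun τ =>
    (measurable_levyExponent φ σ).comp (measurable_shiftOn hm hB j τ)
  have hFm' : ∀ τ, Measurable (F' τ) := fun τ => (measurable_one.indicator hB).mul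
    ((measurable_jumpMoment φ σ _).comp (measurable_shiftOn hm hB j τ))
  have hint : Integrable (F 0) α := by
    refine Integrable.of_bound (hFm 0).aestronglyMeasurable
      ((1 + φ * (d * M)) * ∫ s, min s 1 ∂(stableLevy φ σ)) (Eventually.of_forall fun y => ?_)
    simp only [F, shiftOn_zero]
    have hy : ∀ j, 0 ≤ θ y j := fun j => hε.le.trans (hθ y j)
    rw [Real.norm_of_nonneg (levyExponent_nonneg hφ hy)]
    refine (levyExponent_le hφ hσ hy).trans ?_
    refine mul_le_mul_of_nonneg_right ?_ (integral_nonneg_of_ae ?_)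
    · have : ∑ j, θ y j ≤ d * M := by
        simpa using Finset.sum_le_card_nsmul Finset.univ (θ y) M fun j _ => hM y j
      nlinarith
    · filter_upwards [ae_pos_stableLevy φ σ] with s hs
      exact le_min hs.le zero_le_one
  have h := hasDerivAt_integral_ball (μ := α) (F := F) (F' := F')
    (bound := fun _ => jumpMoment φ σ (Pi.single j 1) fun _ => ε / 2) h0
    (Eventually.of_forall fun τ => (hFm τ).aestronglyMeasurable) hint
    (hFm' 0).aestronglyMeasurable
    (Eventually.of_forall fun y τ hτ => by
      have h1 : ∀ i, 0 < shiftOn θ B j τ y i := fun i =>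
        (half_pos hε).trans_le (le_shiftOn hθ B j hτ y i)
      have h2 := (jumpMoment_pos hφ hσ hj h1).le
      have h3 : 0 ≤ B.indicator (1 : X → ℝ) y := indicator_nonneg (fun _ _ => zero_le_one) y
      have h4 : B.indicator (1 : X → ℝ) y ≤ 1 := indicator_le_self' (fun _ _ => zero_le_one) y
      rw [Real.norm_of_nonneg (mul_nonneg h3 h2)]
      exact (mul_le_of_le_one_left h2 h4).trans (jumpMoment_antitone hφ hσ hj
        (t := fun _ => ε / 2) (fun _ => half_pos hε) (le_shiftOn hθ B j hτ y)))
    (integrable_const _)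
    (Eventually.of_forall fun y τ hτ => hasDerivAt_levyExponent_shiftOn hφ hσ hε hθ B j hτ y)
  simpa only [F, F', shiftOn_zero] using h

variable [TopologicalSpace X] [PolishSpace X] [BorelSpace X]

-- Summing over first occurrences repeats each existing value exactly once, whatever its
-- multiplicity, as in the second part of `seatingMeasure`; multiplicities are recorded by the block
-- moments alone.
open Classical in
theorem hasDerivAt_integral_blockMoment_shiftOn (hφ : 0 < φ) (hσ : σ ∈ Ioo (0 : ℝ) 1)
    (Γ : Measure (Fin N → X)) [IsFiniteMeasure Γ] (g : Fin N → Fin d) {θ : X → Fin d → ℝ}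
    (hm : Measurable θ) {ε : ℝ}
    (hε : 0 < ε) (hθ : ∀ y j, ε ≤ θ y j) {B : Set X} (hB : MeasurableSet B) (j : Fin d) :
    HasDerivAt (fun τ => ∫ z, blockMoment φ σ g z (shiftOn θ B j τ) ∂Γ)
      (-∫ z, ∑ i, (if IsFirst z i then B.indicator 1 (z i) * blockMoment φ σ
        (Fin.cons j g : Fin (N + 1) → Fin d) (Fin.cons (z i) z : Fin (N + 1) → X) θ else 0)
        ∂Γ) 0 := by
  have h0 : (0 : ℝ) ∈ Metric.ball (0 : ℝ) (ε / 2) := Metric.mem_ball_self (half_pos hε)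
  let F : ℝ → (Fin N → X) → ℝ := fun τ z => blockMoment φ σ g z (shiftOn θ B j τ)
  let F' : ℝ → (Fin N → X) → ℝ := fun τ z =>
    -∑ y ∈ Finset.univ.image z, B.indicator 1 y * blockMoment φ σ
        (Fin.cons j g : Fin (N + 1) → Fin d) (Fin.cons y z : Fin (N + 1) → X) (shiftOn θ B j τ)
  have hF'eq : F' 0 = fun z => -∑ i, (if IsFirst z i then B.indicator 1 (z i) * blockMoment φ σ
        (Fin.cons j g : Fin (N + 1) → Fin d) (Fin.cons (z i) z : Fin (N + 1) → X) θ else 0) := by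
    ext z
    simp only [F', shiftOn_zero]
    congr 1
    rw [sum_image_eq_sum_isFirst z (fun y => B.indicator 1 y * blockMoment φ σ
        (Fin.cons j g : Fin (N + 1) → Fin d) (Fin.cons y z : Fin (N + 1) → X) θ)]
  have hFm : ∀ τ, Measurable (F τ) := fun τ =>
    measurable_blockMoment_left φ σ g (measurable_shiftOn hm hB j τ)
  have hK := measurable_blockMoment_left φ σ (Fin.cons j g : Fin (N + 1) → Fin d) hm
  have hFm' : Measurable (F' 0) := by
    rw [hF'eq]
    refine (Finset.measurable_sum _ fun i _ => Measurable.ite (measurableSet_isFirst i)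
      (Measurable.mul ?_ ?_) measurable_const).neg
    · exact (measurable_one.indicator hB).comp (measurable_pi_apply i)
    · exact hK.comp (measurable_cons_self i)
  have hint : Integrable (F 0) Γ := by
    refine Integrable.of_bound (hFm 0).aestronglyMeasurable (blockBound φ σ d N ε)
      (Eventually.of_forall fun z => ?_)
    simp only [F, shiftOn_zero]
    rw [Real.norm_of_nonneg (blockMoment_pos hφ hσ g z fun y j => hε.trans_le (hθ y j)).le]
    exact blockMoment_le hφ hσ g z hε hθ
  have h := hasDerivAt_integral_ball (μ := Γ) (F := F) (F' := F')
    (bound := fun _ => N * blockBound φ σ d (N + 1) (ε / 2)) h0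
    (Eventually.of_forall fun τ => (hFm τ).aestronglyMeasurable) hint
    hFm'.aestronglyMeasurable
    (Eventually.of_forall fun z τ hτ => by
      have h1 : ∀ y i, 0 < shiftOn θ B j τ y i := fun y i =>
        (half_pos hε).trans_le (le_shiftOn hθ B j hτ y i)
      have h5 : ∀ y ∈ Finset.univ.image z, ‖B.indicator 1 y * blockMoment φ σ
        (Fin.cons j g : Fin (N + 1) → Fin d) (Fin.cons y z : Fin (N + 1) → X)
          (shiftOn θ B j τ)‖ ≤ blockBound φ σ d (N + 1) (ε / 2) := fun y _ => by
        have h2 := (blockMoment_pos hφ hσ (Fin.cons j g : Fin (N + 1) → Fin d)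
          (Fin.cons y z : Fin (N + 1) → X) h1).le
        have h3 : 0 ≤ B.indicator (1 : X → ℝ) y := indicator_nonneg (fun _ _ => zero_le_one) y
        have h4 : B.indicator (1 : X → ℝ) y ≤ 1 := indicator_le_self' (fun _ _ => zero_le_one) y
        rw [Real.norm_of_nonneg (mul_nonneg h3 h2)]
        exact (mul_le_of_le_one_left h2 h4).trans
          (blockMoment_le hφ hσ _ _ (half_pos hε) (le_shiftOn hθ B j hτ))
      have h6 : 0 ≤ blockBound φ σ d (N + 1) (ε / 2) :=
        pow_nonneg (add_nonneg zero_le_one (Finset.sum_nonneg fun _ _ => abs_nonneg _)) _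
      simp only [F', norm_neg]
      refine (norm_sum_le_of_le _ h5).trans ?_
      rw [Finset.sum_const, nsmul_eq_mul]
      refine mul_le_mul_of_nonneg_right ?_ h6
      exact_mod_cast Finset.card_image_le.trans (by simp))
    (integrable_const _)
    (Eventually.of_forall fun z τ hτ => hasDerivAt_blockMoment_shiftOn hφ hσ g z hε hθ B j hτ)
  rw [hF'eq, integral_neg] at h
  exact h

/-- The measure that places `N` points successively: each one either has law `α`, or repeats one
of the values that are already there. -/
noncomputable def seatingMeasure (α : Measure X) : (N : ℕ) → Measure (Fin N → X)
  | 0 => Measure.dirac Fin.elim0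
  | N + 1 => (α.prod (seatingMeasure α N)).map
      (fun p => (Fin.cons p.1 p.2 : Fin (N + 1) → X)) +
    ∑ i, ((seatingMeasure α N).restrict {z | IsFirst z i}).map
      fun z => (Fin.cons (z i) z : Fin (N + 1) → X)

instance (α : Measure X) [IsFiniteMeasure α] (N : ℕ) : IsFiniteMeasure (seatingMeasure α N) := by
  induction N with
  | zero => unfold seatingMeasure; infer_instance
  | succ N ih =>
    unfold seatingMeasure
    infer_instance

end Moments

section Moments

variable {X : Type*} [MeasurableSpace X] {d N : ℕ} {φ σ : ℝ}

theorem IsTest.shiftOn {θ : X → Fin d → ℝ} (hθ : IsTest fun j y => θ y j) {B : Set X}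
    (hB : MeasurableSet B) (j : Fin d) {τ : ℝ} (hτ : 0 ≤ τ) :
    IsTest fun i y => shiftOn θ B j τ y i := by
  obtain ⟨M, hM⟩ := hθ.bounded
  have hB0 : ∀ y, 0 ≤ B.indicator (1 : X → ℝ) y := indicator_nonneg fun _ _ => zero_le_one
  have hB1 : ∀ y, B.indicator (1 : X → ℝ) y ≤ 1 := indicator_le_self' fun _ _ => zero_le_one
  refine ⟨fun i => (measurable_pi_apply i).comp
    (measurable_shiftOn (measurable_pi_iff.2 hθ.measurable) hB j τ), fun i y => ?_,
    M + τ, fun i y => ?_⟩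
  · simp only [_root_.shiftOn, Pi.add_apply, Pi.single_apply]
    refine add_nonneg (hθ.nonneg i y) ?_
    split_ifs
    exacts [mul_nonneg hτ (hB0 y), le_rfl]
  · simp only [_root_.shiftOn, Pi.add_apply, Pi.single_apply]
    refine add_le_add (hM i y) ?_
    split_ifs
    exacts [mul_le_of_le_one_right hτ (hB1 y), hτ]

/-- This is why shifts are used: a derivative in τ at 0 inserts the factor μ_j(B) under the
expectation, up to sign. -/
theorem laplaceTest_shiftOn {θ : X → Fin d → ℝ} (hθ : IsTest fun j y => θ y j) {B : Set X}
    (hB : MeasurableSet B) (j : Fin d) {τ : ℝ} (hτ : 0 ≤ τ) {μ : Fin d → Measure X}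
    (hμ : μ j B ≠ ∞) :
    (laplaceTest (fun i y => shiftOn θ B j τ y i) μ).toReal =
      (laplaceTest (fun i y => θ y i) μ).toReal * Real.exp (-(τ * (μ j B).toReal)) := by
  have h1 : ∀ i, ∫⁻ y, ENNReal.ofReal (shiftOn θ B j τ y i) ∂μ i =
      (∫⁻ y, ENNReal.ofReal (θ y i) ∂μ i) +
        if i = j then ENNReal.ofReal τ * μ j B else 0 := fun i => by
    have hm : Measurable fun y => ENNReal.ofReal (θ y i) := (hθ.measurable i).ennreal_ofReal
    split_ifs with h
    · subst h
      have h2 : ∀ y, ENNReal.ofReal (shiftOn θ B i τ y i) =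
          ENNReal.ofReal (θ y i) + B.indicator (fun _ => ENNReal.ofReal τ) y := fun y => by
        by_cases hy : y ∈ B
        · rw [shiftOn_of_mem _ _ _ hy, indicator_of_mem hy, ← ENNReal.ofReal_add (hθ.nonneg i y) hτ]
          simp
        · rw [shiftOn_of_notMem _ _ _ hy, indicator_of_notMem hy, add_zero]
      simp_rw [h2]
      rw [lintegral_add_left hm, lintegral_indicator hB, setLIntegral_const]
    · simp [shiftOn, Pi.single_eq_of_ne h]
  unfold laplaceTest
  simp_rw [h1]
  rw [Finset.sum_add_distrib, expNeg_add, ENNReal.toReal_mul]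
  congr 1
  rw [Finset.sum_ite_eq' Finset.univ j, if_pos (Finset.mem_univ j), ← ENNReal.ofReal_toReal hμ,
    ← ENNReal.ofReal_mul hτ, expNeg_ofReal (mul_nonneg hτ ENNReal.toReal_nonneg),
    ENNReal.toReal_ofReal (Real.exp_pos _).le, ENNReal.toReal_ofReal ENNReal.toReal_nonneg]

variable [TopologicalSpace X] [PolishSpace X] [BorelSpace X]

-- The added point is either fresh or a repetition. Diffuseness of α enters here: almost surely a
-- fresh point differs from all points already present, so it opens its own block and the integral
-- factorizes.
open Classical in
theorem setIntegral_cons_seatingMeasure (hφ : 0 < φ) (hσ : σ ∈ Ioo (0 : ℝ) 1)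
    (α : Measure X) [IsFiniteMeasure α] (hα : ∀ a, α {a} = 0)
    (g : Fin N → Fin d) {θ : X → Fin d → ℝ}
    (hm : Measurable θ) {ε : ℝ} (hε : 0 < ε) (hθ : ∀ y j, ε ≤ θ y j) {B : Set X}
    (hB : MeasurableSet B) {C : Fin N → Set X} (hC : ∀ i, MeasurableSet (C i)) (j : Fin d) :
    ∫ z in univ.pi (Fin.cons B C : Fin (N + 1) → Set X), blockMoment φ σ
        (Fin.cons j g : Fin (N + 1) → Fin d) z θ ∂seatingMeasure α (N + 1) =
      (∫ y, B.indicator 1 y * jumpMoment φ σ (Pi.single j 1) (θ y) ∂α) *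
        (∫ z in univ.pi C, blockMoment φ σ g z θ ∂seatingMeasure α N) +
      ∫ z in univ.pi C, ∑ i, (if IsFirst z i then B.indicator 1 (z i) * blockMoment φ σ
        (Fin.cons j g : Fin (N + 1) → Fin d) (Fin.cons (z i) z : Fin (N + 1) → X) θ else 0)
        ∂seatingMeasure α N := by
  let K : (Fin (N + 1) → X) → ℝ := fun z => blockMoment φ σ (Fin.cons j g : Fin (N + 1) → Fin d) z θ
  have hK : Measurable K := measurable_blockMoment_left φ σ _ hm
  have hKn : ∀ z, 0 ≤ K z := fun z =>
    (blockMoment_pos hφ hσ _ z fun y j => hε.trans_le (hθ y j)).le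
  have hKb : ∀ z, ‖K z‖ ≤ blockBound φ σ d (N + 1) ε := fun z => by
    rw [Real.norm_of_nonneg (hKn z)]
    exact blockMoment_le hφ hσ _ z hε hθ
  have hKi : ∀ ρ : Measure (Fin (N + 1) → X), IsFiniteMeasure ρ → Integrable K ρ := fun ρ _ =>
    Integrable.of_bound hK.aestronglyMeasurable _ (Eventually.of_forall hKb)
  have hS : MeasurableSet (univ.pi C) := MeasurableSet.univ_pi hC
  have hS' : MeasurableSet (univ.pi (Fin.cons B C : Fin (N + 1) → Set X)) :=
    MeasurableSet.univ_pi fun i => Fin.cases hB hC i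
  have hmem : ∀ y (z : Fin N → X), (Fin.cons y z : Fin (N + 1) → X) ∈
      univ.pi (Fin.cons B C : Fin (N + 1) → Set X) ↔ y ∈ B ∧ z ∈ univ.pi C := fun y z => by
    simp [Set.mem_pi, Fin.forall_fin_succ]
  change ∫ z in univ.pi (Fin.cons B C : Fin (N + 1) → Set X), K z ∂seatingMeasure α (N + 1) = _
  rw [seatingMeasure, Measure.restrict_add, integral_add_measure (hKi _ inferInstance)
    (hKi _ inferInstance)]
  congr 1
  · rw [setIntegral_map hS' hK.aestronglyMeasurable measurable_cons.aemeasurable,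
      ← integral_indicator (measurable_cons hS'), ← integral_indicator hS, ← integral_prod_mul]
    have hne : ∀ i, ∀ᵐ p ∂(α.prod (seatingMeasure α N)), p.2 i ≠ p.1 := fun i => by
      have hE : MeasurableSet {p : X × (Fin N → X) | p.2 i = p.1} :=
        measurableSet_eq_fun ((measurable_pi_apply i).comp measurable_snd) measurable_fst
      rw [ae_iff]
      simp only [ne_eq, not_not]
      rw [Measure.prod_apply_symm hE]
      refine lintegral_eq_zero_of_ae_eq_zero (Eventually.of_forall fun z => ?_)
      have : (fun y => (y, z)) ⁻¹' {p : X × (Fin N → X) | p.2 i = p.1} = {z i} := by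
        ext y
        simp [eq_comm]
      exact (congrArg α this).trans (hα _)
    refine integral_congr_ae ?_
    filter_upwards [ae_all_iff.2 hne] with p hp
    have h1 : K (Fin.cons p.1 p.2 : Fin (N + 1) → X) = _ :=
      blockMoment_cons_of_notMem g p.2 hp j θ
    simp only [indicator_apply, mem_preimage, hmem, h1]
    by_cases hpB : p.1 ∈ B <;> by_cases hpC : p.2 ∈ univ.pi C <;> simp [hpB, hpC]
  · have hsum : (∑ i, ((seatingMeasure α N).restrict {z | IsFirst z i}).map
      fun z => (Fin.cons (z i) z : Fin (N + 1) → X)).restrict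
        (univ.pi (Fin.cons B C : Fin (N + 1) → Set X)) =
      ∑ i, (((seatingMeasure α N).restrict {z | IsFirst z i}).map
      fun z => (Fin.cons (z i) z : Fin (N + 1) → X)).restrict
        (univ.pi (Fin.cons B C : Fin (N + 1) → Set X)) := by
      rw [← Measure.sum_fintype, Measure.restrict_sum _ hS', Measure.sum_fintype]
    rw [hsum, integral_finsetSum_measure fun i _ => hKi _ inferInstance,
      integral_finsetSum]
    · refine Finset.sum_congr rfl fun i _ => ?_
      have hms := measurable_cons_self (X := X) i
      rw [setIntegral_map hS' hK.aestronglyMeasurable hms.aemeasurable,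
        Measure.restrict_restrict (hms hS'),
        ← integral_indicator ((hms hS').inter (measurableSet_isFirst i)), ← integral_indicator hS]
      refine integral_congr_ae (Eventually.of_forall fun z => ?_)
      simp only [indicator_apply, mem_inter_iff, mem_preimage, hmem, Set.mem_ofPred_eq, K]
      by_cases h1 : z i ∈ B <;> by_cases h2 : z ∈ univ.pi C <;> by_cases h3 : IsFirst z i <;>
        simp [h1, h2, h3]
    · intro i _
      refine Integrable.of_bound (C := blockBound φ σ d (N + 1) ε) (Measurable.aestronglyMeasurable
        (Measurable.ite (measurableSet_isFirst i) (Measurable.mul ?_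
        (hK.comp (measurable_cons_self i))) measurable_const)) (Eventually.of_forall fun z => ?_)
      · exact (measurable_one.indicator hB).comp (measurable_pi_apply i)
      · have h2 := hKb (Fin.cons (z i) z)
        split_ifs
        · rw [norm_mul]
          refine le_trans (mul_le_of_le_one_left (norm_nonneg _) ?_) h2
          simp only [indicator_apply, Pi.one_apply]
          split_ifs <;> simp
        · rw [norm_zero]
          exact (norm_nonneg _).trans h2

/-- The mixed moments of the masses of measurable sets, tilted by a Laplace functional. -/
theorem integral_laplaceTest_mul_prod {Ω : Type*} [MeasurableSpace Ω] {P : Measure Ω}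
    (hφ : 0 < φ) (hσ : σ ∈ Ioo (0 : ℝ) 1)
    (α : Measure X) [IsProbabilityMeasure α] (hα : ∀ a, α {a} = 0)
    {μ : Ω → Fin d → Measure X} (hμ : Measurable μ) (hfin : ∀ᵐ ω ∂P, ∀ j, μ ω j univ ≠ ∞)
    (hL : ∀ θ : X → Fin d → ℝ, IsTest (fun j y => θ y j) →
      ∫⁻ ω, laplaceTest (fun j y => θ y j) (μ ω) ∂P =
        ENNReal.ofReal (Real.exp (-∫ y, levyExponent φ σ (θ y) ∂α)))
    (g : Fin N → Fin d) {C : Fin N → Set X} (hC : ∀ i, MeasurableSet (C i))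
    {θ : X → Fin d → ℝ} (hθ : IsTest fun j y => θ y j) {ε : ℝ} (hε : 0 < ε)
    (hθε : ∀ y j, ε ≤ θ y j) :
    Integrable (fun ω => (laplaceTest (fun j y => θ y j) (μ ω)).toReal *
      ∏ i, (μ ω (g i) (C i)).toReal) P ∧
    ∫ ω, (laplaceTest (fun j y => θ y j) (μ ω)).toReal * ∏ i, (μ ω (g i) (C i)).toReal ∂P =
      Real.exp (-∫ y, levyExponent φ σ (θ y) ∂α) *
        ∫ z in univ.pi C, blockMoment φ σ g z θ ∂seatingMeasure α N := by
  classical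
  have hLm : ∀ θ : X → Fin d → ℝ, IsTest (fun j y => θ y j) →
      Measurable fun ω => (laplaceTest (fun j y => θ y j) (μ ω)).toReal := fun θ hθ =>
    ((measurable_laplaceTest hθ).comp hμ).ennreal_toReal
  have hmass : ∀ j {B : Set X}, MeasurableSet B → Measurable fun ω => (μ ω j B).toReal :=
    fun j B hB => ((Measure.measurable_coe hB).comp
      ((measurable_pi_apply j).comp hμ)).ennreal_toReal
  -- The inductive step differentiates in a shift of θ, so the identity for N factors is needed at
  -- all shifted θ.
  induction N generalizing θ ε with
  | zero =>
    have h1 : ∀ z : Fin 0 → X, blockMoment φ σ g z θ = 1 := fun z => by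
      simp [blockMoment, Finset.univ_eq_empty]
    have h2 : (univ.pi C : Set (Fin 0 → X)) = univ := by ext; simp [Set.mem_pi]
    have hlt : ∀ᵐ ω ∂P, laplaceTest (fun j y => θ y j) (μ ω) < ∞ := Eventually.of_forall
      fun ω => (laplaceTest_le_one _ _).trans_lt ENNReal.one_lt_top
    simp only [Finset.univ_eq_empty, Finset.prod_empty, mul_one, h1, h2, seatingMeasure,
      Measure.restrict_univ]
    have hme : AEMeasurable (fun ω => laplaceTest (fun j y => θ y j) (μ ω)) P :=
      ((measurable_laplaceTest hθ).comp hμ).aemeasurable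
    refine ⟨integrable_toReal_of_lintegral_ne_top hme ?_, ?_⟩
    · rw [hL θ hθ]
      exact ENNReal.ofReal_ne_top
    · rw [integral_toReal hme hlt, hL θ hθ, ENNReal.toReal_ofReal (Real.exp_pos _).le]
      simp
  | succ N ih =>
    obtain ⟨M, hM⟩ := hθ.bounded
    have hm : Measurable θ := measurable_pi_iff.2 hθ.measurable
    obtain ⟨j, g, rfl⟩ : ∃ j g', g = Fin.cons j g' := ⟨g 0, Fin.tail g, (Fin.cons_self_tail g).symm⟩
    obtain ⟨B, C, rfl⟩ : ∃ B C', C = Fin.cons B C' := ⟨C 0, Fin.tail C, (Fin.cons_self_tail C).symm⟩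
    have hB : MeasurableSet B := hC 0
    replace hC : ∀ i, MeasurableSet (C i) := fun i => by simpa using hC i.succ
    have hS : MeasurableSet (univ.pi C) := MeasurableSet.univ_pi hC
    have hstep : ∀ τ, 0 ≤ τ → (fun ω => ((laplaceTest (fun j y => θ y j) (μ ω)).toReal *
        ∏ i, (μ ω (g i) (C i)).toReal) * Real.exp (-(τ * (μ ω j B).toReal))) =ᵐ[P]
        fun ω => (laplaceTest (fun i y => shiftOn θ B j τ y i) (μ ω)).toReal *
          ∏ i, (μ ω (g i) (C i)).toReal := fun τ hτ => by
      filter_upwards [hfin] with ω hω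
      rw [laplaceTest_shiftOn hθ hB j hτ
        (ne_top_of_le_ne_top (hω j) (measure_mono (subset_univ _)))]
      ring
    have hge : ∀ τ, 0 ≤ τ → ∀ y i, ε ≤ shiftOn θ B j τ y i := fun τ hτ y i => by
      refine (hθε y i).trans ?_
      simp only [shiftOn, Pi.add_apply, Pi.single_apply, le_add_iff_nonneg_right]
      split_ifs
      exacts [mul_nonneg hτ (indicator_nonneg (fun _ _ => zero_le_one) _), le_rfl]
    -- Product rule: the derivative of the exponential accounts for a fresh point, that of the block
    -- integral for a repeated one. Together they are the two summands of
    -- `setIntegral_cons_seatingMeasure`.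
    have hR := (hasDerivAt_integral_levyExponent_shiftOn hφ hσ α hm hε hθε (fun y j => hM j y) hB j).neg.exp.mul
      (hasDerivAt_integral_blockMoment_shiftOn hφ hσ
        ((seatingMeasure α N).restrict (univ.pi C)) g hm hε hθε hB j)
    simp only [shiftOn_zero, Pi.neg_apply] at hR
    have key := integral_mul_of_hasDerivAt_laplace (P := P)
      (Y := fun ω => (laplaceTest (fun j y => θ y j) (μ ω)).toReal *
        ∏ i, (μ ω (g i) (C i)).toReal) (b := fun ω => (μ ω j B).toReal)
      (R := fun τ => Real.exp (-∫ y, levyExponent φ σ (shiftOn θ B j τ y) ∂α) *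
        ∫ z in univ.pi C, blockMoment φ σ g z (shiftOn θ B j τ) ∂seatingMeasure α N)
      (r := Real.exp (-∫ y, levyExponent φ σ (θ y) ∂α) *
        ∫ z in univ.pi (Fin.cons B C : Fin (N + 1) → Set X), blockMoment φ σ
        (Fin.cons j g : Fin (N + 1) → Fin d) z θ ∂seatingMeasure α (N + 1))
      ((hLm θ hθ).mul (Finset.measurable_prod _ fun i _ => hmass _ (hC i))) (hmass j hB)
      (fun ω => mul_nonneg ENNReal.toReal_nonneg
        (Finset.prod_nonneg fun i _ => ENNReal.toReal_nonneg))
      (fun ω => ENNReal.toReal_nonneg)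
      (by
        refine hR.congr_deriv ?_
        rw [setIntegral_cons_seatingMeasure hφ hσ α hα g hm hε hθε hB hC j]
        ring)
      (fun τ hτ => (ih g hC (hθ.shiftOn hB j hτ) hε (hge τ hτ)).1.congr (hstep τ hτ).symm)
      (fun τ hτ => (integral_congr_ae (hstep τ hτ)).trans
        (ih g hC (hθ.shiftOn hB j hτ) hε (hge τ hτ)).2)
    have hprod : ∀ ω, ((laplaceTest (fun j y => θ y j) (μ ω)).toReal *
        ∏ i, (μ ω (g i) (C i)).toReal) * (μ ω j B).toReal =
        (laplaceTest (fun j y => θ y j) (μ ω)).toReal *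
        ∏ i, (μ ω ((Fin.cons j g : Fin (N + 1) → Fin d) i)
          ((Fin.cons B C : Fin (N + 1) → Set X) i)).toReal := fun ω => by
      rw [Fin.prod_univ_succ]
      simp only [Fin.cons_zero, Fin.cons_succ]
      ring
    simp only [hprod] at key
    exact key

end Moments

/-! ### Lévy exponent; finiteness and positivity of the total masses -/

section Masses

variable {X : Type*} [MeasurableSpace X] {d : ℕ} {φ σ : ℝ}

theorem expNeg_levelCost_eq_jumpDensity {X : Type*} (hφ : 0 < φ) {f : Fin d → X → ℝ}
    (hf : ∀ j x, 0 ≤ f j x) {s : ℝ} (hs : 0 < s) (x : X) :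
    expNeg (levelCost φ f (s, x)) = ENNReal.ofReal (jumpDensity φ 0 s fun j => f j x) := by
  rw [expNeg_levelCost hφ hf hs.le, jumpDensity, ENNReal.ofReal_prod_of_nonneg]
  · refine Finset.prod_congr rfl fun j _ => ?_
    have : 0 < 1 + s * f j x := by nlinarith [mul_nonneg hs.le (hf j x)]
    rw [Pi.zero_apply, jumpFactor_zero hφ, one_div, Real.inv_rpow this.le, Real.rpow_neg this.le]
  · exact fun j _ => (jumpFactor_pos hφ hs (hf j x) 0).le

theorem integrable_levyExponent (hφ : 0 < φ) (hσ : σ ∈ Ioo (0 : ℝ) 1) (α : Measure X)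
    [IsFiniteMeasure α] {f : Fin d → X → ℝ} (hf : IsTest f) :
    Integrable (fun y => levyExponent φ σ fun j => f j y) α := by
  obtain ⟨M, hM⟩ := hf.bounded
  refine Integrable.of_bound ((measurable_levyExponent φ σ).comp
    (measurable_pi_iff.2 hf.measurable)).aestronglyMeasurable
    ((1 + φ * (d * M)) * ∫ s, min s 1 ∂(stableLevy φ σ)) (Eventually.of_forall fun y => ?_)
  rw [Real.norm_of_nonneg (levyExponent_nonneg hφ fun j => hf.nonneg j y)]
  refine (levyExponent_le hφ hσ fun j => hf.nonneg j y).trans ?_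
  refine mul_le_mul_of_nonneg_right ?_ (integral_nonneg_of_ae ?_)
  · have : ∑ j, f j y ≤ d * M := by
      simpa using Finset.sum_le_card_nsmul Finset.univ (fun j => f j y) M fun j _ => hM j y
    nlinarith
  · filter_upwards [ae_pos_stableLevy φ σ] with s hs
    exact le_min hs.le zero_le_one

theorem lintegral_one_sub_jumpDensity (hφ : 0 < φ) (hσ : σ ∈ Ioo (0 : ℝ) 1) {t : Fin d → ℝ}
    (ht : ∀ j, 0 ≤ t j) :
    ∫⁻ s, ENNReal.ofReal (1 - jumpDensity φ 0 s t) ∂(stableLevy φ σ) =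
      ENNReal.ofReal (levyExponent φ σ t) := by
  rw [levyExponent, ofReal_integral_eq_lintegral_ofReal (integrable_one_sub_jumpDensity hφ hσ ht)]
  filter_upwards [ae_pos_stableLevy φ σ] with s hs
  exact sub_nonneg.2 (jumpDensity_zero_le_one hφ hs ht)

theorem lintegral_one_sub_expNeg_levelCost (hφ : 0 < φ) (hσ : σ ∈ Ioo (0 : ℝ) 1) (α : Measure X)
    [IsFiniteMeasure α] {f : Fin d → X → ℝ} (hf : IsTest f) :
    ∫⁻ p, (1 - expNeg (levelCost φ f p)) ∂((stableLevy φ σ).prod α) =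
      ENNReal.ofReal (∫ y, levyExponent φ σ (fun j => f j y) ∂α) := by
  have hm : Measurable fun p => 1 - expNeg (levelCost φ f p) :=
    measurable_const.sub (measurable_expNeg.comp (measurable_levelCost φ hf))
  rw [lintegral_prod_symm _ hm.aemeasurable,
    ofReal_integral_eq_lintegral_ofReal (integrable_levyExponent hφ hσ α hf)
      (Eventually.of_forall fun y => levyExponent_nonneg hφ fun j => hf.nonneg j y)]
  refine lintegral_congr fun y => ?_
  rw [← lintegral_one_sub_jumpDensity hφ hσ fun j => hf.nonneg j y]
  refine lintegral_congr_ae ?_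
  filter_upwards [ae_pos_stableLevy φ σ] with s hs
  rw [expNeg_levelCost_eq_jumpDensity hφ hf.nonneg hs, ENNReal.ofReal_sub _
    (jumpDensity_pos hφ hs (fun j => hf.nonneg j y) 0).le, ENNReal.ofReal_one]

theorem IsTest.const {c : Fin d → ℝ} (hc : ∀ j, 0 ≤ c j) : IsTest fun j (_ : X) => c j :=
  ⟨fun _ => measurable_const, fun j _ => hc j, ∑ j, c j, fun j _ =>
    Finset.single_le_sum (fun j _ => hc j) (Finset.mem_univ j)⟩

theorem tendsto_levyExponent_zero (hφ : 0 < φ) (hσ : σ ∈ Ioo (0 : ℝ) 1) :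
    Tendsto (fun n : ℕ => levyExponent φ σ fun _ : Fin d => (1 : ℝ) / (n + 1)) atTop (𝓝 0) := by
  have h0 : ∀ n : ℕ, (0 : ℝ) < 1 / (n + 1) := fun n => by positivity
  have h1 : ∀ n : ℕ, (1 : ℝ) / (n + 1) ≤ 1 := fun n => by
    rw [div_le_one (by positivity)]
    linarith [Nat.cast_nonneg (α := ℝ) n]
  have h2 : Tendsto (fun n : ℕ => (1 : ℝ) / (n + 1)) atTop (𝓝 0) :=
    tendsto_one_div_add_atTop_nhds_zero_nat
  unfold levyExponent
  have h : Tendsto (fun n : ℕ => ∫ s, (1 - jumpDensity φ 0 s fun _ : Fin d => (1 : ℝ) / (n + 1))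
      ∂(stableLevy φ σ)) atTop (𝓝 (∫ s, (0 : ℝ) ∂(stableLevy φ σ))) := by
    refine tendsto_integral_of_dominated_convergence (fun s => (1 + φ * d) * min s 1)
      (fun n => (measurable_const.sub (measurable_jumpDensity_left φ 0 _)).aestronglyMeasurable)
      ((integrable_min_stableLevy hφ hσ).const_mul _) (fun n => ?_) ?_
    · filter_upwards [ae_pos_stableLevy φ σ] with s hs
      rw [Real.norm_of_nonneg (sub_nonneg.2 (jumpDensity_zero_le_one hφ hs fun _ => (h0 n).le))]
      refine (one_sub_jumpDensity_le hφ hs fun _ => (h0 n).le).trans ?_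
      refine mul_le_mul_of_nonneg_right ?_ (le_min hs.le zero_le_one)
      rw [Finset.sum_const, Finset.card_univ, Fintype.card_fin, nsmul_eq_mul]
      have : (d : ℝ) * (1 / (n + 1)) ≤ d := mul_le_of_le_one_right (Nat.cast_nonneg d) (h1 n)
      nlinarith
    · filter_upwards [ae_pos_stableLevy φ σ] with s hs
      simp only [jumpDensity, Pi.zero_apply, jumpFactor_zero hφ]
      have h3 : Tendsto (fun n : ℕ => 1 + s * ((1 : ℝ) / (n + 1))) atTop (𝓝 (1 + s * 0)) :=
        (h2.const_mul s).const_add 1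
      have h4 := h3.rpow_const (p := -φ) (Or.inl (by norm_num))
      have h5 : Tendsto (fun n : ℕ => ∏ _j : Fin d, (1 + s * ((1 : ℝ) / (n + 1))) ^ (-φ)) atTop
          (𝓝 (∏ _j : Fin d, (1 + s * 0) ^ (-φ))) := tendsto_finsetProd _ fun _ _ => h4
      simpa using h5.const_sub 1
  simpa using h

/-- The integrand tends to 1 at every s > 0 and the Lévy measure is infinite, so Fatou's lemma
applies. -/
theorem tendsto_levyExponent_atTop (hφ : 0 < φ) (hσ : σ ∈ Ioo (0 : ℝ) 1) (j : Fin d) :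
    Tendsto (fun n : ℕ => ENNReal.ofReal (levyExponent φ σ (Pi.single j (n : ℝ)))) atTop (𝓝 ∞) := by
  have h0 : ∀ (n : ℕ) i, 0 ≤ (Pi.single j (n : ℝ) : Fin d → ℝ) i := fun n i => by
    rw [Pi.single_apply]
    split_ifs
    exacts [Nat.cast_nonneg n, le_rfl]
  simp_rw [← lintegral_one_sub_jumpDensity hφ hσ (h0 _)]
  have hlim : ∀ᵐ s ∂(stableLevy φ σ), liminf (fun n : ℕ => ENNReal.ofReal
      (1 - jumpDensity φ 0 s (Pi.single j (n : ℝ) : Fin d → ℝ))) atTop = 1 := by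
    filter_upwards [ae_pos_stableLevy φ σ] with s hs
    refine Tendsto.liminf_eq ?_
    have h1 : ∀ n : ℕ, jumpDensity φ 0 s (Pi.single j (n : ℝ) : Fin d → ℝ) =
        (1 + s * n) ^ (-φ) := fun n => by
      rw [jumpDensity, Finset.prod_eq_single j]
      · simp [jumpFactor_zero hφ]
      · intro i _ hi
        simp [jumpFactor_zero hφ, Pi.single_eq_of_ne hi]
      · simp
    simp_rw [h1]
    have h2 : Tendsto (fun n : ℕ => 1 + s * (n : ℝ)) atTop atTop :=
      tendsto_atTop_add_const_left _ _ (tendsto_natCast_atTop_atTop.const_mul_atTop hs)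
    have h3 := ((tendsto_rpow_neg_atTop hφ).comp h2).const_sub 1
    have h4 := (ENNReal.continuous_ofReal.tendsto _).comp h3
    simpa [Function.comp_def] using h4
  have hle : ∞ ≤ liminf (fun n : ℕ => ∫⁻ s, ENNReal.ofReal
      (1 - jumpDensity φ 0 s (Pi.single j (n : ℝ) : Fin d → ℝ)) ∂(stableLevy φ σ)) atTop := by
    refine le_trans ?_ (lintegral_liminf_le fun n =>
      (measurable_const.sub (measurable_jumpDensity_left φ 0 _)).ennreal_ofReal)
    rw [lintegral_congr_ae hlim, lintegral_one, stableLevy_univ hφ hσ]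
  exact tendsto_of_le_liminf_of_limsup_le hle le_top

variable {Ω : Type*} [MeasurableSpace Ω] {P : Measure Ω} [IsProbabilityMeasure P]
  {α : Measure X} [IsProbabilityMeasure α] {μ : Ω → Fin d → Measure X}

/-- The functional at the constant 1/(n+1) vanishes as soon as some mass is infinite, so the
probability of finite masses is at least exp(-ψ(1/(n+1), …)), which tends to 1. -/
theorem ae_mass_ne_top (hφ : 0 < φ) (hσ : σ ∈ Ioo (0 : ℝ) 1) (hμ : Measurable μ)
    (hL : ∀ θ : X → Fin d → ℝ, IsTest (fun j y => θ y j) →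
      ∫⁻ ω, laplaceTest (fun j y => θ y j) (μ ω) ∂P =
        ENNReal.ofReal (Real.exp (-∫ y, levyExponent φ σ (θ y) ∂α))) :
    ∀ᵐ ω ∂P, ∀ j, μ ω j univ ≠ ∞ := by
  have hE : MeasurableSet {ω | ∃ j, μ ω j univ = ∞} := by
    simp only [Set.ofPred_exists]
    exact MeasurableSet.iUnion fun j => ((Measure.measurable_coe MeasurableSet.univ).comp
      ((measurable_pi_apply j).comp hμ)) (measurableSet_singleton ∞)
  have h1 : ∀ n : ℕ, ENNReal.ofReal (Real.exp (-levyExponent φ σ fun _ : Fin d => (1 : ℝ) / (n + 1)))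
      ≤ P {ω | ∃ j, μ ω j univ = ∞}ᶜ := fun n => by
    have hc : (0 : ℝ) < 1 / (n + 1) := by positivity
    have h2 := hL (fun _ _ => (1 : ℝ) / (n + 1)) (IsTest.const fun _ => hc.le)
    simp only [integral_const, probReal_univ, one_smul] at h2
    rw [← h2, ← lintegral_indicator_one hE.compl]
    refine lintegral_mono fun ω => ?_
    by_cases hω : ω ∈ {ω | ∃ j, μ ω j univ = ∞}
    · obtain ⟨j, hj⟩ := hω
      have : laplaceTest (fun _ _ => (1 : ℝ) / (n + 1)) (μ ω) = 0 := by
        unfold laplaceTest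
        rw [← expNeg_top]
        congr 1
        refine (ENNReal.sum_eq_top).2 ⟨j, Finset.mem_univ j, ?_⟩
        rw [lintegral_const, hj, ENNReal.mul_top (by simpa using by positivity)]
      rw [this]
      exact zero_le
    · rw [indicator_of_mem (by exact hω)]
      exact laplaceTest_le_one _ _
  have h2 : Tendsto (fun n : ℕ => ENNReal.ofReal (Real.exp (-levyExponent φ σ fun _ : Fin d =>
      (1 : ℝ) / (n + 1)))) atTop (𝓝 1) := by
    have := (ENNReal.continuous_ofReal.tendsto _).comp ((Real.continuous_exp.tendsto _).comp
      (tendsto_levyExponent_zero (d := d) hφ hσ).neg)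
    simpa [Function.comp_def] using this
  have h3 : P {ω | ∃ j, μ ω j univ = ∞}ᶜ = 1 :=
    le_antisymm prob_le_one (le_of_tendsto h2 (Eventually.of_forall h1))
  rw [prob_compl_eq_one_iff hE] at h3
  rw [ae_iff]
  convert! h3 using 2
  ext ω
  simp

/-- On the event that the j-th mass is 0 the functional at n e_j equals 1, so the probability of
this event is at most exp(-ψ(n e_j)), which tends to 0. -/
theorem ae_mass_ne_zero (hφ : 0 < φ) (hσ : σ ∈ Ioo (0 : ℝ) 1) (hμ : Measurable μ)
    (hL : ∀ θ : X → Fin d → ℝ, IsTest (fun j y => θ y j) →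
      ∫⁻ ω, laplaceTest (fun j y => θ y j) (μ ω) ∂P =
        ENNReal.ofReal (Real.exp (-∫ y, levyExponent φ σ (θ y) ∂α))) :
    ∀ᵐ ω ∂P, ∀ j, μ ω j univ ≠ 0 := by
  rw [ae_all_iff]
  intro j
  have hE : MeasurableSet {ω | μ ω j univ = 0} := ((Measure.measurable_coe MeasurableSet.univ).comp
      ((measurable_pi_apply j).comp hμ)) (measurableSet_singleton 0)
  have h0 : ∀ (n : ℕ) i, 0 ≤ (Pi.single j (n : ℝ) : Fin d → ℝ) i := fun n i => by
    rw [Pi.single_apply]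
    split_ifs
    exacts [Nat.cast_nonneg n, le_rfl]
  have h1 : ∀ n : ℕ, P {ω | μ ω j univ = 0} ≤
      expNeg (ENNReal.ofReal (levyExponent φ σ (Pi.single j (n : ℝ)))) := fun n => by
    have h2 := hL (fun _ => Pi.single j (n : ℝ)) (IsTest.const (h0 n))
    simp only [integral_const, probReal_univ, one_smul] at h2
    rw [expNeg_ofReal (levyExponent_nonneg hφ (h0 n)), ← h2, ← lintegral_indicator_one hE]
    refine lintegral_mono fun ω => ?_
    by_cases hω : ω ∈ {ω | μ ω j univ = 0}
    swap
    · rw [indicator_of_notMem hω]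
      exact zero_le
    rw [indicator_of_mem hω]
    replace hω : μ ω j univ = 0 := hω
    have : laplaceTest (fun i (_ : X) => (Pi.single j (n : ℝ) : Fin d → ℝ) i) (μ ω) = 1 := by
      unfold laplaceTest
      rw [← expNeg_zero]
      congr 1
      refine Finset.sum_eq_zero fun i _ => ?_
      rw [lintegral_const]
      by_cases hi : i = j
      · rw [hi, hω, mul_zero]
      · rw [Pi.single_eq_of_ne hi, ENNReal.ofReal_zero, zero_mul]
    rw [this, Pi.one_apply]
  have h2 := (continuous_expNeg.tendsto _).comp (tendsto_levyExponent_atTop hφ hσ j)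
  rw [expNeg_top] at h2
  have h3 : P {ω | μ ω j univ = 0} = 0 :=
    nonpos_iff_eq_zero.1 (ge_of_tendsto h2 (Eventually.of_forall h1))
  rw [ae_iff]
  simpa using h3

end Masses

/-! ### The grouped sample as a single list -/

section Sample

variable {X : Type*} {d : ℕ} {n : Fin d → ℕ} {φ σ : ℝ}

/-- The sample as a single list. -/
def flatten (z : (j : Fin d) → Fin (n j) → X) (i : Fin (∑ j, n j)) : X :=
  z (finSigmaFinEquiv.symm i).1 (finSigmaFinEquiv.symm i).2

/-- The group of each member of the list. -/
def groupOf (n : Fin d → ℕ) (i : Fin (∑ j, n j)) : Fin d :=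
  (finSigmaFinEquiv.symm i).1

/-- The inverse of `flatten`. -/
def unflatten (z : Fin (∑ j, n j) → X) (j : Fin d) (i : Fin (n j)) : X :=
  z (finSigmaFinEquiv ⟨j, i⟩)

theorem flatten_unflatten (z : Fin (∑ j, n j) → X) : flatten (unflatten z) = z := by
  ext i
  simp only [flatten, unflatten]
  exact congrArg z (Equiv.apply_symm_apply finSigmaFinEquiv i)

theorem unflatten_flatten (z : (j : Fin d) → Fin (n j) → X) : unflatten (flatten z) = z := by
  funext j i
  exact congrArg (fun p : (j : Fin d) × Fin (n j) => z p.1 p.2)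
    (Equiv.symm_apply_apply finSigmaFinEquiv ⟨j, i⟩)

theorem flatten_apply (z : (j : Fin d) → Fin (n j) → X) (j : Fin d) (i : Fin (n j)) :
    flatten z (finSigmaFinEquiv ⟨j, i⟩) = z j i :=
  congrFun (congrFun (unflatten_flatten z) j) i

theorem groupOf_apply (j : Fin d) (i : Fin (n j)) : groupOf n (finSigmaFinEquiv ⟨j, i⟩) = j :=
  congrArg Sigma.fst (Equiv.symm_apply_apply finSigmaFinEquiv ⟨j, i⟩)

theorem blockCount_flatten (z : (j : Fin d) → Fin (n j) → X) (y : X) :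
    blockCount (groupOf n) (flatten z) y = freq z y := by
  classical
  ext j
  rw [blockCount, freq, ← Set.ncard_coe_finset]
  refine (Set.ncard_congr (fun i _ => finSigmaFinEquiv ⟨j, i⟩) ?_ ?_ ?_).symm
  · intro i hi
    have : z j i = y := hi
    rw [Finset.coe_filter]
    simp only [Finset.mem_univ, true_and, Set.mem_ofPred_eq, flatten_apply, groupOf_apply]
    exact ⟨this, trivial⟩
  · intro i i' _ _ h
    simpa using h
  · intro i hi
    obtain ⟨⟨j', i'⟩, rfl⟩ := finSigmaFinEquiv.surjective i
    rw [Finset.coe_filter] at hi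
    simp only [Finset.mem_univ, true_and, Set.mem_ofPred_eq, flatten_apply, groupOf_apply] at hi
    obtain ⟨h1, rfl⟩ := hi
    exact ⟨i', h1, rfl⟩

/-- An injective listing only enumerates the set of distinct values, so the right side does not
depend on the listing. -/
theorem blockMoment_flatten (z : (j : Fin d) → Fin (n j) → X) (θ : X → Fin d → ℝ) {k : ℕ}
    {y : Fin k → X} (hy : Function.Injective y) (hr : range y = {a | ∃ j i, z j i = a}) :
    blockMoment φ σ (groupOf n) (flatten z) θ =
      ∏ ℓ, jumpMoment φ σ (freq z (y ℓ)) (θ (y ℓ)) := by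
  classical
  unfold blockMoment
  simp_rw [blockCount_flatten]
  have : Finset.univ.image (flatten z) = Finset.univ.image y := by
    apply Finset.coe_injective
    rw [Finset.coe_image, Finset.coe_image, Finset.coe_univ, Finset.coe_univ, image_univ,
      image_univ, hr]
    ext a
    constructor
    · rintro ⟨i, rfl⟩
      exact ⟨_, _, rfl⟩
    · rintro ⟨j, i, rfl⟩
      exact ⟨finSigmaFinEquiv ⟨j, i⟩, congrFun (congrFun (unflatten_flatten z) j) i⟩
  rw [← Finset.prod_image (s := Finset.univ) (g := y)
    (f := fun y => jumpMoment φ σ (freq z y) (θ y)) fun a _ b _ h => hy h]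
  exact Finset.prod_congr (by convert! this) fun _ _ => rfl

variable [MeasurableSpace X]

theorem measurable_flatten : Measurable (flatten : ((j : Fin d) → Fin (n j) → X) → _) :=
  measurable_pi_lambda _ fun i => (measurable_pi_apply _).comp (measurable_pi_apply _)

theorem measurable_unflatten : Measurable (unflatten : _ → (j : Fin d) → Fin (n j) → X) :=
  measurable_pi_lambda _ fun j => measurable_pi_lambda _ fun i => measurable_pi_apply _

variable [TopologicalSpace X] [PolishSpace X] [BorelSpace X]

/-- The dominating measure for the law of the observations. -/
noncomputable def sampleMeasure (α : Measure X) (n : Fin d → ℕ) :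
    Measure ((j : Fin d) → Fin (n j) → X) :=
  (seatingMeasure α (∑ j, n j)).map unflatten

instance (α : Measure X) [IsFiniteMeasure α] (n : Fin d → ℕ) :
    IsFiniteMeasure (sampleMeasure α n) := by
  unfold sampleMeasure
  infer_instance

/-- The moment formula for a sample arranged in groups, with values in [0, ∞]; the masses are almost
surely finite, so passing through real numbers loses nothing. -/
theorem lintegral_laplaceTest_mul_prod {Ω : Type*} [MeasurableSpace Ω] {P : Measure Ω}
    (hφ : 0 < φ) (hσ : σ ∈ Ioo (0 : ℝ) 1)
    (α : Measure X) [IsProbabilityMeasure α] (hα : ∀ a, α {a} = 0)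
    {μ : Ω → Fin d → Measure X} (hμ : Measurable μ) (hfin : ∀ᵐ ω ∂P, ∀ j, μ ω j univ ≠ ∞)
    (hL : ∀ θ : X → Fin d → ℝ, IsTest (fun j y => θ y j) →
      ∫⁻ ω, laplaceTest (fun j y => θ y j) (μ ω) ∂P =
        ENNReal.ofReal (Real.exp (-∫ y, levyExponent φ σ (θ y) ∂α)))
    {B : (j : Fin d) → Fin (n j) → Set X} (hB : ∀ j i, MeasurableSet (B j i))
    {θ : X → Fin d → ℝ} (hθ : IsTest fun j y => θ y j) {ε : ℝ} (hε : 0 < ε)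
    (hθε : ∀ y j, ε ≤ θ y j) :
    ∫⁻ ω, laplaceTest (fun j y => θ y j) (μ ω) * ∏ j, ∏ i, μ ω j (B j i) ∂P =
      ENNReal.ofReal (Real.exp (-∫ y, levyExponent φ σ (θ y) ∂α)) *
        ∫⁻ z in {z | ∀ j i, z j i ∈ B j i},
          ENNReal.ofReal (blockMoment φ σ (groupOf n) (flatten z) θ) ∂sampleMeasure α n := by
  let C : Fin (∑ j, n j) → Set X := fun i =>
    B (finSigmaFinEquiv.symm i).1 (finSigmaFinEquiv.symm i).2
  have hC : ∀ i, MeasurableSet (C i) := fun i => hB _ _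
  have hm : Measurable θ := measurable_pi_iff.2 hθ.measurable
  have hK := measurable_blockMoment_left φ σ (groupOf n) hm
  have hKn : ∀ z, 0 ≤ blockMoment φ σ (groupOf n) z θ := fun z =>
    (blockMoment_pos hφ hσ _ z fun y j => hε.trans_le (hθε y j)).le
  have hS : MeasurableSet {z : (j : Fin d) → Fin (n j) → X | ∀ j i, z j i ∈ B j i} := by
    simp only [Set.ofPred_forall]
    exact MeasurableSet.iInter fun j => MeasurableSet.iInter fun i =>
      ((measurable_pi_apply i).comp (measurable_pi_apply j)) (hB j i)
  obtain ⟨h1, h2⟩ := integral_laplaceTest_mul_prod hφ hσ α hα hμ hfin hL (groupOf n) hC hθ hε hθε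
  have h3 : ∫⁻ ω, laplaceTest (fun j y => θ y j) (μ ω) * ∏ j, ∏ i, μ ω j (B j i) ∂P =
      ∫⁻ ω, ENNReal.ofReal ((laplaceTest (fun j y => θ y j) (μ ω)).toReal *
        ∏ i, (μ ω (groupOf n i) (C i)).toReal) ∂P := by
    refine lintegral_congr_ae ?_
    filter_upwards [hfin] with ω hω
    rw [ENNReal.ofReal_mul ENNReal.toReal_nonneg, ENNReal.ofReal_toReal
      ((laplaceTest_le_one _ _).trans_lt ENNReal.one_lt_top).ne,
      ENNReal.ofReal_prod_of_nonneg fun _ _ => ENNReal.toReal_nonneg]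
    congr 1
    rw [← Finset.prod_sigma Finset.univ (fun _ => Finset.univ)
      (fun p : (j : Fin d) × Fin (n j) => μ ω p.1 (B p.1 p.2)), Finset.univ_sigma_univ,
      ← finSigmaFinEquiv.symm.prod_comp]
    refine Finset.prod_congr rfl fun i _ => ?_
    rw [ENNReal.ofReal_toReal (ne_top_of_le_ne_top (hω _) (measure_mono (subset_univ _)))]
    rfl
  rw [h3, ← ofReal_integral_eq_lintegral_ofReal h1 (Eventually.of_forall fun ω =>
    mul_nonneg ENNReal.toReal_nonneg (Finset.prod_nonneg fun _ _ => ENNReal.toReal_nonneg)), h2,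
    ENNReal.ofReal_mul (Real.exp_pos _).le]
  congr 1
  have hK' : Measurable fun z : (j : Fin d) → Fin (n j) → X =>
      ENNReal.ofReal (blockMoment φ σ (groupOf n) (flatten z) θ) :=
    (hK.comp measurable_flatten).ennreal_ofReal
  rw [sampleMeasure, setLIntegral_map hS hK' measurable_unflatten, ofReal_integral_eq_lintegral_ofReal
    (Integrable.of_bound (C := blockBound φ σ d (∑ j, n j) ε) hK.aestronglyMeasurable
      (Eventually.of_forall fun z => by
        rw [Real.norm_of_nonneg (hKn z)]
        exact blockMoment_le hφ hσ _ z hε hθε))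
    (Eventually.of_forall hKn)]
  have h4 : unflatten ⁻¹' {z : (j : Fin d) → Fin (n j) → X | ∀ j i, z j i ∈ B j i} =
      univ.pi C := by
    ext z
    simp only [mem_preimage, Set.mem_ofPred_eq, Set.mem_pi, mem_univ, true_imp_iff, C, unflatten]
    constructor
    · intro h i
      have := h (finSigmaFinEquiv.symm i).1 (finSigmaFinEquiv.symm i).2
      rwa [show finSigmaFinEquiv (⟨(finSigmaFinEquiv.symm i).1, (finSigmaFinEquiv.symm i).2⟩ :
        (j : Fin d) × Fin (n j)) = i from Equiv.apply_symm_apply finSigmaFinEquiv i] at this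
    · intro h j i
      have := h (finSigmaFinEquiv ⟨j, i⟩)
      rwa [Equiv.symm_apply_apply] at this
  rw [h4]
  simp only [flatten_unflatten]

end Sample

/-! ### Joint law of the observations and the latent variables -/

section Joint

variable {X : Type*} [MeasurableSpace X] {d : ℕ} {n : Fin d → ℕ} {φ σ : ℝ}
  {Ω : Type*} [MeasurableSpace Ω] {P : Measure Ω} {μ : Ω → Fin d → Measure X}
  {obs : Ω → (j : Fin d) → Fin (n j) → X} {G : Ω → Fin d → ℝ}

theorem measurableSet_sampleBox {B : (j : Fin d) → Fin (n j) → Set X}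
    (hB : ∀ j i, MeasurableSet (B j i)) :
    MeasurableSet {z : (j : Fin d) → Fin (n j) → X | ∀ j i, z j i ∈ B j i} := by
  simp only [Set.ofPred_forall]
  exact MeasurableSet.iInter fun j => MeasurableSet.iInter fun i =>
    ((measurable_pi_apply i).comp (measurable_pi_apply j)) (hB j i)

theorem measurable_apply_mass (j : Fin d) {B : Set X} (hB : MeasurableSet B) :
    Measurable fun ν : Fin d → Measure X => ν j B :=
  (Measure.measurable_coe hB).comp (measurable_pi_apply j)

theorem measurable_sampleWeight {B : (j : Fin d) → Fin (n j) → Set X}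
    (hB : ∀ j i, MeasurableSet (B j i)) :
    Measurable fun ν : Fin d → Measure X => ∏ j, ∏ i, ((ν j univ)⁻¹ • ν j) (B j i) := by
  refine Finset.measurable_prod _ fun j _ => Finset.measurable_prod _ fun i _ => ?_
  simp only [Measure.smul_apply, smul_eq_mul]
  exact (measurable_apply_mass j MeasurableSet.univ).inv.mul (measurable_apply_mass j (hB j i))

/-- By definition of the sample, restricting P to the sample event and weighting P by the product of
normalized masses give the same law of μ. Hence any function of μ may be integrated. -/
theorem IsNormalizedSample.setLIntegral (h : IsNormalizedSample P μ n obs) (hμ : Measurable μ)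
    {F : (Fin d → Measure X) → ℝ≥0∞} (hF : Measurable F) {B : (j : Fin d) → Fin (n j) → Set X}
    (hB : ∀ j i, MeasurableSet (B j i)) :
    ∫⁻ ω in {ω | ∀ j i, obs ω j i ∈ B j i}, F (μ ω) ∂P =
      ∫⁻ ω, (∏ j, ∏ i, ((μ ω j univ)⁻¹ • μ ω j) (B j i)) * F (μ ω) ∂P := by
  have hD : MeasurableSet {ω | ∀ j i, obs ω j i ∈ B j i} :=
    h.measurable (measurableSet_sampleBox hB)
  have hw : Measurable fun ω => ∏ j, ∏ i, ((μ ω j univ)⁻¹ • μ ω j) (B j i) :=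
    (measurable_sampleWeight hB).comp hμ
  have key : (P.restrict {ω | ∀ j i, obs ω j i ∈ B j i}).map μ =
      (P.withDensity fun ω => ∏ j, ∏ i, ((μ ω j univ)⁻¹ • μ ω j) (B j i)).map μ := by
    ext A hA
    rw [Measure.map_apply hμ hA, Measure.map_apply hμ hA, Measure.restrict_apply (hμ hA),
      withDensity_apply _ (hμ hA)]
    exact h.cond A hA B hB
  have hFμ : Measurable fun ω => F (μ ω) := hF.comp hμ
  rw [← lintegral_map hF hμ, key, lintegral_map hF hμ,
    lintegral_withDensity_eq_lintegral_mul _ hw hFμ]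
  rfl

theorem IsGammaAuxiliary.map_eq [IsProbabilityMeasure P]
    (h : IsGammaAuxiliary P μ n obs G) (hμ : Measurable μ) (hobs : Measurable obs) :
    P.map (fun ω => (G ω, (μ ω, obs ω))) =
      (Measure.pi fun j => gammaMeasure (n j) 1).prod (P.map fun ω => (μ ω, obs ω)) := by
  have hGj : ∀ j, Measurable fun ω => G ω j := fun j => (measurable_pi_apply j).comp h.measurable
  rw [(indepFun_iff_map_prod_eq_prod_map_map h.measurable.aemeasurable
    (hμ.prodMk hobs).aemeasurable).1 h.indep_model]
  congr 1
  have h1 := (iIndepFun_iff_map_fun_eq_pi_map fun j => (hGj j).aemeasurable).1 h.indep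
  rw [h1]
  congr 1
  ext1 j
  exact (h.law j).map_eq

theorem measurableSet_latentBox {C : Fin d → Set ℝ} (hC : ∀ j, MeasurableSet (C j)) :
    MeasurableSet {p : (Fin d → ℝ) × (Fin d → Measure X) |
      ∀ j, p.1 j / (p.2 j univ).toReal ∈ C j} := by
  simp only [Set.ofPred_forall]
  exact MeasurableSet.iInter fun j => (((measurable_pi_apply j).comp measurable_fst).div
    ((measurable_apply_mass j MeasurableSet.univ).comp measurable_snd).ennreal_toReal) (hC j)

theorem measurable_latent (hμ : Measurable μ) (hG : Measurable G) : Measurable (latent μ G) :=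
  measurable_pi_lambda _ fun j => ((measurable_pi_apply j).comp hG).div
    ((measurable_apply_mass j MeasurableSet.univ).comp hμ).ennreal_toReal

/-- G is independent of the measures and the observations jointly, so it is integrated out first,
with these frozen. -/
theorem IsGammaAuxiliary.setLIntegral [IsProbabilityMeasure P] (hn : ∀ j, 1 ≤ n j)
    (h : IsGammaAuxiliary P μ n obs G) (hμ : Measurable μ) (hobs : Measurable obs)
    {F : (Fin d → Measure X) → ℝ≥0∞} (hF : Measurable F) {B : (j : Fin d) → Fin (n j) → Set X}
    (hB : ∀ j i, MeasurableSet (B j i)) {C : Fin d → Set ℝ} (hC : ∀ j, MeasurableSet (C j)) :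
    ∫⁻ ω in {ω | (∀ j i, obs ω j i ∈ B j i) ∧ ∀ j, latent μ G ω j ∈ C j}, F (μ ω) ∂P =
      ∫⁻ ω in {ω | ∀ j i, obs ω j i ∈ B j i}, F (μ ω) *
        (Measure.pi fun j => gammaMeasure (n j) 1) {g | ∀ j, g j / (μ ω j univ).toReal ∈ C j}
          ∂P := by
  have hγ : ∀ j, IsProbabilityMeasure (gammaMeasure (n j) 1) := fun j =>
    isProbabilityMeasure_gammaMeasure (by exact_mod_cast hn j) one_pos
  have hBm := measurableSet_sampleBox hB
  have hE := measurableSet_latentBox (X := X) hC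
  let Φ : (Fin d → ℝ) × ((Fin d → Measure X) × ((j : Fin d) → Fin (n j) → X)) → ℝ≥0∞ := fun q =>
    {z : (j : Fin d) → Fin (n j) → X | ∀ j i, z j i ∈ B j i}.indicator 1 q.2.2 * F q.2.1 *
      {p : (Fin d → ℝ) × (Fin d → Measure X) |
        ∀ j, p.1 j / (p.2 j univ).toReal ∈ C j}.indicator 1 (q.1, q.2.1)
  have hΦ : Measurable Φ := by
    refine Measurable.mul (Measurable.mul ?_ ?_) ?_
    · exact (measurable_one.indicator hBm).comp (measurable_snd.comp measurable_snd)
    · exact hF.comp (measurable_fst.comp measurable_snd)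
    · exact (measurable_one.indicator hE).comp
        (measurable_fst.prodMk (measurable_fst.comp measurable_snd))
  have hD : MeasurableSet {ω | (∀ j i, obs ω j i ∈ B j i) ∧ ∀ j, latent μ G ω j ∈ C j} := by
    refine (hobs hBm).inter ?_
    exact (h.measurable.prodMk hμ) hE
  have hDB : MeasurableSet {ω | ∀ j i, obs ω j i ∈ B j i} := hobs hBm
  have h1 : ∫⁻ ω in {ω | (∀ j i, obs ω j i ∈ B j i) ∧ ∀ j, latent μ G ω j ∈ C j}, F (μ ω) ∂P =
      ∫⁻ ω, Φ (G ω, (μ ω, obs ω)) ∂P := by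
    rw [← lintegral_indicator hD]
    refine lintegral_congr fun ω => ?_
    simp only [Φ, latent]
    by_cases h1 : ∀ j i, obs ω j i ∈ B j i <;>
      by_cases h2 : ∀ j, G ω j / (μ ω j univ).toReal ∈ C j <;> simp [h1, h2]
  have hm := h.measurable.prodMk (hμ.prodMk hobs)
  have h2 := lintegral_map (μ := P) hΦ hm
  rw [h1, ← h2, h.map_eq hμ hobs, lintegral_prod_symm _ hΦ.aemeasurable,
    lintegral_map hΦ.lintegral_prod_left' (hμ.prodMk hobs), ← lintegral_indicator hDB]
  refine lintegral_congr fun ω => ?_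
  have h3 : Measurable fun g : Fin d → ℝ => {p : (Fin d → ℝ) × (Fin d → Measure X) |
        ∀ j, p.1 j / (p.2 j univ).toReal ∈ C j}.indicator
          (1 : (Fin d → ℝ) × (Fin d → Measure X) → ℝ≥0∞) (g, μ ω) :=
    (measurable_one.indicator hE).comp (measurable_id.prodMk measurable_const)
  simp only [Φ]
  rw [lintegral_const_mul _ h3]
  have h4 : ∫⁻ g, {p : (Fin d → ℝ) × (Fin d → Measure X) |
        ∀ j, p.1 j / (p.2 j univ).toReal ∈ C j}.indicator
          (1 : (Fin d → ℝ) × (Fin d → Measure X) → ℝ≥0∞) (g, μ ω)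
        ∂(Measure.pi fun j => gammaMeasure (n j) 1) =
      (Measure.pi fun j => gammaMeasure (n j) 1) {g | ∀ j, g j / (μ ω j univ).toReal ∈ C j} := by
    rw [← lintegral_indicator_one]
    · rfl
    · exact (measurable_id.prodMk (measurable_const (a := μ ω))) hE
  rw [h4]
  by_cases h5 : ∀ j i, obs ω j i ∈ B j i
  · rw [indicator_of_mem (by exact h5), indicator_of_mem (by exact h5), Pi.one_apply, one_mul]
  · rw [indicator_of_notMem (by exact h5), indicator_of_notMem (by exact h5), zero_mul, zero_mul]

/-- The reason for the latent variables: the quotient by T has law Gamma(k, T), whose factor T^k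
cancels T^{-k} and leaves e^{-uT}. The factor e^u removes the exponential of the reference law
Gamma(k, 1), which is chosen because it does not depend on T. -/
theorem inv_pow_mul_gammaMeasure_preimage {k : ℕ} (hk : 1 ≤ k) {T : ℝ} (hT : 0 < T) {C : Set ℝ}
    (hC : MeasurableSet C) :
    (ENNReal.ofReal T)⁻¹ ^ k * gammaMeasure k 1 {g | g / T ∈ C} =
      ∫⁻ u, C.indicator 1 u * (ENNReal.ofReal (Real.exp u) * expNeg (ENNReal.ofReal (u * T)))
        ∂(gammaMeasure k 1) := by
  have hp : ∀ r, Measurable (gammaPDF k r) := fun r => (measurable_gammaPDFReal k r).ennreal_ofReal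
  have hm : Measurable fun u : ℝ => C.indicator (1 : ℝ → ℝ≥0∞) u *
      (ENNReal.ofReal (Real.exp u) * expNeg (ENNReal.ofReal (u * T))) :=
    (measurable_one.indicator hC).mul (Real.measurable_exp.ennreal_ofReal.mul
      (measurable_expNeg.comp (by fun_prop)))
  have h1 : gammaMeasure k 1 {g | g / T ∈ C} = gammaMeasure k T C := by
    rw [← gammaMeasure_map_div hT, Measure.map_apply (by fun_prop) hC]
    rfl
  have h2 : ∀ u, (ENNReal.ofReal T)⁻¹ ^ k * gammaPDF k T u = gammaPDF k 1 u *
      (ENNReal.ofReal (Real.exp u) * expNeg (ENNReal.ofReal (u * T))) := fun u => by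
    rcases lt_or_ge u 0 with hu | hu
    · simp [gammaPDF_of_neg hu]
    · have hΓ : 0 < Real.Gamma k := Real.Gamma_pos_of_pos (by exact_mod_cast hk)
      have hu' : 0 ≤ u ^ ((k : ℝ) - 1) := Real.rpow_nonneg hu _
      rw [gammaPDF_of_nonneg hu, gammaPDF_of_nonneg hu, expNeg_ofReal (mul_nonneg hu hT.le),
        ← ENNReal.ofReal_mul (Real.exp_pos _).le, ← ENNReal.ofReal_mul (by positivity),
        ← ENNReal.ofReal_inv_of_pos hT, ← ENNReal.ofReal_pow (by positivity),
        ← ENNReal.ofReal_mul (by positivity)]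
      congr 1
      have h3 : Real.exp (-(1 * u)) * Real.exp u = 1 := by rw [← Real.exp_add]; simp
      rw [Real.one_rpow, Real.rpow_natCast, show -(T * u) = -(u * T) by ring]
      calc T⁻¹ ^ k * (T ^ k / Real.Gamma k * u ^ ((k : ℝ) - 1) * Real.exp (-(u * T)))
          = (T⁻¹ * T) ^ k * (1 / Real.Gamma k * u ^ ((k : ℝ) - 1)) * Real.exp (-(u * T)) := by
            rw [mul_pow]; ring
        _ = 1 / Real.Gamma k * u ^ ((k : ℝ) - 1) * (Real.exp (-(1 * u)) * Real.exp u) *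
              Real.exp (-(u * T)) := by
            rw [inv_mul_cancel₀ hT.ne', one_pow, h3]; ring
        _ = _ := by ring
  rw [h1]
  conv_rhs => rw [gammaMeasure]
  rw [lintegral_withDensity_eq_lintegral_mul _ (hp 1) hm, gammaMeasure, withDensity_apply _ hC,
    ← lintegral_const_mul _ (hp T), ← lintegral_indicator hC]
  refine lintegral_congr fun u => ?_
  rw [Pi.mul_apply]
  by_cases hu : u ∈ C
  · rw [indicator_of_mem hu, indicator_of_mem hu, Pi.one_apply, one_mul, h2]
  · rw [indicator_of_notMem hu, indicator_of_notMem hu, zero_mul, mul_zero]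

theorem ae_pos_pi_gammaMeasure (hn : ∀ j, 1 ≤ n j) :
    ∀ᵐ u ∂(Measure.pi fun j => gammaMeasure (n j) 1), ∀ j, 0 < u j := by
  have hγ : ∀ j, IsProbabilityMeasure (gammaMeasure (n j) 1) := fun j =>
    isProbabilityMeasure_gammaMeasure (by exact_mod_cast hn j) one_pos
  rw [ae_all_iff]
  intro j
  exact (measurePreserving_eval (fun j => gammaMeasure (n j) 1) j).quasiMeasurePreserving.ae
    (ae_pos_gammaMeasure _ _)

/-- Lets the factors e^{-u_j μ_j(X)} produced by the latent variables be absorbed into the test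
function. -/
theorem laplaceTest_add_const {f : Fin d → X → ℝ} (hf : IsTest f) {u : Fin d → ℝ}
    (hu : ∀ j, 0 ≤ u j) (ν : Fin d → Measure X) :
    laplaceTest (fun j y => f j y + u j) ν =
      laplaceTest f ν * ∏ j, expNeg (ENNReal.ofReal (u j) * ν j univ) := by
  unfold laplaceTest
  rw [← expNeg_sum, ← expNeg_add, ← Finset.sum_add_distrib]
  congr 1
  refine Finset.sum_congr rfl fun j _ => ?_
  simp_rw [ENNReal.ofReal_add (hf.nonneg j _) (hu j)]
  rw [lintegral_add_left (hf.measurable j).ennreal_ofReal, lintegral_const]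

theorem IsTest.add_const {f : Fin d → X → ℝ} (hf : IsTest f) {u : Fin d → ℝ}
    (hu : ∀ j, 0 ≤ u j) : IsTest fun j y => f j y + u j := by
  obtain ⟨M, hM⟩ := hf.bounded
  exact ⟨fun j => (hf.measurable j).add_const _, fun j y => add_nonneg (hf.nonneg j y) (hu j),
    M + ∑ j, u j, fun j y => add_le_add (hM j y)
      (Finset.single_le_sum (fun j _ => hu j) (Finset.mem_univ j))⟩

variable [TopologicalSpace X] [PolishSpace X] [BorelSpace X]

/-- The density of the joint law of the observations and the latent variables, weighted by a
Laplace functional of the random measures. -/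
noncomputable def jointDensity (φ σ : ℝ) (α : Measure X) (n : Fin d → ℕ) (f : Fin d → X → ℝ)
    (q : ((j : Fin d) → Fin (n j) → X) × (Fin d → ℝ)) : ℝ≥0∞ :=
  (∏ j, ENNReal.ofReal (Real.exp (q.2 j))) *
    (ENNReal.ofReal (Real.exp (-∫ y, levyExponent φ σ (fun j => f j y + q.2 j) ∂α)) *
      ENNReal.ofReal (blockMoment φ σ (groupOf n) (flatten q.1) fun y j => f j y + q.2 j))

theorem measurable_jointDensity (φ σ : ℝ) (α : Measure X) [IsFiniteMeasure α] (n : Fin d → ℕ)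
    {f : Fin d → X → ℝ} (hf : ∀ j, Measurable (f j)) :
    Measurable (jointDensity φ σ α n f) := by
  have hθ : Measurable fun p : (Fin d → ℝ) × X => fun j => f j p.2 + p.1 j :=
    measurable_pi_lambda _ fun j => ((hf j).comp measurable_snd).add
      ((measurable_pi_apply j).comp measurable_fst)
  have h1 : Measurable fun q : ((j : Fin d) → Fin (n j) → X) × (Fin d → ℝ) =>
      ∏ j, ENNReal.ofReal (Real.exp (q.2 j)) := Finset.measurable_prod _ fun j _ =>
    (Real.measurable_exp.comp ((measurable_pi_apply j).comp measurable_snd)).ennreal_ofReal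
  have h2 : Measurable fun u : Fin d → ℝ => ∫ y, levyExponent φ σ (fun j => f j y + u j) ∂α :=
    (StronglyMeasurable.integral_prod_right'
      (f := fun p : (Fin d → ℝ) × X => levyExponent φ σ fun j => f j p.2 + p.1 j)
      ((measurable_levyExponent φ σ).comp hθ).stronglyMeasurable).measurable
  have h3 := measurable_blockMoment φ σ (groupOf n)
    (θ := fun (u : Fin d → ℝ) y j => f j y + u j) hθ
  have h4 : Measurable fun q : ((j : Fin d) → Fin (n j) → X) × (Fin d → ℝ) =>
      blockMoment φ σ (groupOf n) (flatten q.1) fun y j => f j y + q.2 j :=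
    h3.comp ((measurable_flatten.comp measurable_fst).prodMk measurable_snd)
  have h5 : Measurable fun q : ((j : Fin d) → Fin (n j) → X) × (Fin d → ℝ) =>
      ∫ y, levyExponent φ σ (fun j => f j y + q.2 j) ∂α := h2.comp measurable_snd
  exact h1.mul (h5.neg.exp.ennreal_ofReal.mul h4.ennreal_ofReal)

/-- Once the normalizing masses have cancelled, Tonelli brings the integral over u outside. For each
fixed u the expectation is then a mixed moment with test function f + u. -/
theorem setLIntegral_laplaceTest_joint [IsProbabilityMeasure P]
    (hφ : 0 < φ) (hσ : σ ∈ Ioo (0 : ℝ) 1)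
    (α : Measure X) [IsProbabilityMeasure α] (hα : ∀ a, α {a} = 0) (hn : ∀ j, 1 ≤ n j)
    (hμ : Measurable μ)
    (hL : ∀ θ : X → Fin d → ℝ, IsTest (fun j y => θ y j) →
      ∫⁻ ω, laplaceTest (fun j y => θ y j) (μ ω) ∂P =
        ENNReal.ofReal (Real.exp (-∫ y, levyExponent φ σ (θ y) ∂α)))
    (hobs : IsNormalizedSample P μ n obs) (hG : IsGammaAuxiliary P μ n obs G)
    {B : (j : Fin d) → Fin (n j) → Set X} (hB : ∀ j i, MeasurableSet (B j i))
    {C : Fin d → Set ℝ} (hC : ∀ j, MeasurableSet (C j)) {f : Fin d → X → ℝ} (hf : IsTest f) :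
    ∫⁻ ω in {ω | (∀ j i, obs ω j i ∈ B j i) ∧ ∀ j, latent μ G ω j ∈ C j},
        laplaceTest f (μ ω) ∂P =
      ∫⁻ q in {z | ∀ j i, z j i ∈ B j i} ×ˢ univ.pi C, jointDensity φ σ α n f q
        ∂((sampleMeasure α n).prod (Measure.pi fun j => gammaMeasure (n j) 1)) := by
  have hγ : ∀ j, IsProbabilityMeasure (gammaMeasure (n j) 1) := fun j =>
    isProbabilityMeasure_gammaMeasure (by exact_mod_cast hn j) one_pos
  have hfin := ae_mass_ne_top hφ hσ hμ hL
  have hne := ae_mass_ne_zero hφ hσ hμ hL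
  have hFm := measurable_laplaceTest hf
  have hE := measurableSet_latentBox (X := X) hC
  have hgm : Measurable fun ν : Fin d → Measure X => (Measure.pi fun j => gammaMeasure (n j) 1)
      {g | ∀ j, g j / (ν j univ).toReal ∈ C j} := measurable_measure_prodMk_right hE
  rw [hG.setLIntegral hn hμ hobs.measurable hFm hB hC,
    hobs.setLIntegral hμ (F := fun ν => laplaceTest f ν * (Measure.pi fun j =>
      gammaMeasure (n j) 1) {g | ∀ j, g j / (ν j univ).toReal ∈ C j}) (hFm.mul hgm) hB]
  -- The integrand of `inv_pow_mul_gammaMeasure_preimage`, multiplied over the groups.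
  let k : (Fin d → ℝ) → (Fin d → Measure X) → ℝ≥0∞ := fun u ν =>
    ∏ j, ((C j).indicator 1 (u j) * (ENNReal.ofReal (Real.exp (u j)) *
      expNeg (ENNReal.ofReal (u j * (ν j univ).toReal))))
  have hk : Measurable fun p : (Fin d → ℝ) × (Fin d → Measure X) => k p.1 p.2 := by
    refine Finset.measurable_prod _ fun j _ => ?_
    have hu : Measurable fun p : (Fin d → ℝ) × (Fin d → Measure X) => p.1 j :=
      (measurable_pi_apply j).comp measurable_fst
    have hT : Measurable fun p : (Fin d → ℝ) × (Fin d → Measure X) => (p.2 j univ).toReal :=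
      ((measurable_apply_mass j MeasurableSet.univ).comp measurable_snd).ennreal_toReal
    exact ((measurable_one.indicator (hC j)).comp hu).mul
      ((Real.measurable_exp.comp hu).ennreal_ofReal.mul
        (measurable_expNeg.comp (hu.mul hT).ennreal_ofReal))
  have hw : Measurable fun ν : Fin d → Measure X => ∏ j, ∏ i, ν j (B j i) :=
    Finset.measurable_prod _ fun j _ => Finset.measurable_prod _ fun i _ =>
      measurable_apply_mass j (hB j i)
  have h1 : ∀ᵐ ω ∂P, (∏ j, ∏ i, ((μ ω j univ)⁻¹ • μ ω j) (B j i)) * (laplaceTest f (μ ω) *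
      (Measure.pi fun j => gammaMeasure (n j) 1) {g | ∀ j, g j / (μ ω j univ).toReal ∈ C j}) =
      ∫⁻ u, laplaceTest f (μ ω) * (∏ j, ∏ i, μ ω j (B j i)) * k u (μ ω)
        ∂(Measure.pi fun j => gammaMeasure (n j) 1) := by
    filter_upwards [hfin, hne] with ω hω1 hω2
    have hT : ∀ j, 0 < (μ ω j univ).toReal := fun j => ENNReal.toReal_pos (hω2 j) (hω1 j)
    have hku : Measurable fun u => k u (μ ω) := hk.comp (measurable_id.prodMk measurable_const)
    rw [lintegral_const_mul _ hku]
    have h2 : ∫⁻ u, k u (μ ω) ∂(Measure.pi fun j => gammaMeasure (n j) 1) =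
        ∏ j, ((ENNReal.ofReal (μ ω j univ).toReal)⁻¹ ^ n j * gammaMeasure (n j) 1
          {g | g / (μ ω j univ).toReal ∈ C j}) := by
      simp only [k]
      rw [lintegral_pi_prod (fun j => gammaMeasure (n j) 1) (fun j u => (C j).indicator 1 u *
        (ENNReal.ofReal (Real.exp u) * expNeg (ENNReal.ofReal (u * (μ ω j univ).toReal))))]
      · exact Finset.prod_congr rfl fun j _ =>
          (inv_pow_mul_gammaMeasure_preimage (hn j) (hT j) (hC j)).symm
      · intro j
        exact (measurable_one.indicator (hC j)).mul (Real.measurable_exp.ennreal_ofReal.mul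
          (measurable_expNeg.comp (by fun_prop)))
    have h3 : {g : Fin d → ℝ | ∀ j, g j / (μ ω j univ).toReal ∈ C j} =
        univ.pi fun j => {g | g / (μ ω j univ).toReal ∈ C j} := by
      ext g; simp [Set.mem_pi]
    rw [h2, h3, Measure.pi_pi, Finset.prod_mul_distrib]
    have h4 : ∏ j, ∏ i, ((μ ω j univ)⁻¹ • μ ω j) (B j i) =
        (∏ j, (ENNReal.ofReal (μ ω j univ).toReal)⁻¹ ^ n j) * ∏ j, ∏ i, μ ω j (B j i) := by
      rw [← Finset.prod_mul_distrib]
      refine Finset.prod_congr rfl fun j _ => ?_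
      simp only [Measure.smul_apply, smul_eq_mul]
      rw [Finset.prod_mul_distrib, Finset.prod_const, Finset.card_univ, Fintype.card_fin,
        ENNReal.ofReal_toReal (hω1 j)]
    rw [h4]
    ring
  rw [lintegral_congr_ae h1, lintegral_lintegral_swap]
  swap
  · refine Measurable.aemeasurable ?_
    have e1 : Measurable fun p : Ω × (Fin d → ℝ) => laplaceTest f (μ p.1) :=
      hFm.comp (hμ.comp measurable_fst)
    have e2 : Measurable fun p : Ω × (Fin d → ℝ) => ∏ j, ∏ i, μ p.1 j (B j i) :=
      hw.comp (hμ.comp measurable_fst)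
    have e3 : Measurable fun p : Ω × (Fin d → ℝ) => k p.2 (μ p.1) :=
      hk.comp (measurable_snd.prodMk (hμ.comp measurable_fst))
    exact (e1.mul e2).mul e3
  have hJ := measurable_jointDensity φ σ α n hf.measurable
  have hS := measurableSet_sampleBox hB
  have hCp : MeasurableSet (univ.pi C) := MeasurableSet.univ_pi hC
  rw [← Measure.prod_restrict, lintegral_prod_symm _ hJ.aemeasurable, ← lintegral_indicator hCp]
  refine lintegral_congr_ae ?_
  filter_upwards [ae_pos_pi_gammaMeasure hn] with u hu
  have hu0 : ∀ j, 0 ≤ u j := fun j => (hu j).le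
  by_cases huC : u ∈ univ.pi C
  swap
  · rw [indicator_of_notMem huC]
    have : ∀ ν, k u ν = 0 := fun ν => by
      simp only [Set.mem_pi, mem_univ, true_imp_iff, not_forall] at huC
      obtain ⟨j, hj⟩ := huC
      exact Finset.prod_eq_zero (Finset.mem_univ j) (by rw [indicator_of_notMem hj, zero_mul])
    simp [this]
  rw [indicator_of_mem huC]
  -- The moment formula needs a test function bounded away from 0. The smallest coordinate of u is
  -- such a bound; for no groups any positive number works.
  have hε : ∃ ε > 0, ∀ j, ε ≤ u j := by
    rcases isEmpty_or_nonempty (Fin d) with h | h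
    · exact ⟨1, one_pos, fun j => h.elim j⟩
    · obtain ⟨j, hj⟩ := Finite.exists_min u
      exact ⟨u j, hu j, hj⟩
  obtain ⟨ε, hε, hεu⟩ := hε
  have hθ : IsTest fun j y => f j y + u j := hf.add_const hu0
  have h5 := lintegral_laplaceTest_mul_prod (n := n) hφ hσ α hα hμ hfin hL hB
    (θ := fun y j => f j y + u j) hθ hε fun y j => by linarith [hf.nonneg j y, hεu j]
  have h6 : ∀ᵐ ω ∂P, laplaceTest f (μ ω) * (∏ j, ∏ i, μ ω j (B j i)) * k u (μ ω) =
      (∏ j, ENNReal.ofReal (Real.exp (u j))) *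
        (laplaceTest (fun j y => f j y + u j) (μ ω) * ∏ j, ∏ i, μ ω j (B j i)) := by
    filter_upwards [hfin] with ω hω
    have h7 : k u (μ ω) = (∏ j, ENNReal.ofReal (Real.exp (u j))) *
        ∏ j, expNeg (ENNReal.ofReal (u j) * μ ω j univ) := by
      rw [← Finset.prod_mul_distrib]
      refine Finset.prod_congr rfl fun j _ => ?_
      rw [indicator_of_mem (huC j (mem_univ j)), Pi.one_apply, one_mul,
        ENNReal.ofReal_mul (hu0 j), ENNReal.ofReal_toReal (hω j)]
    rw [laplaceTest_add_const hf hu0, h7]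
    ring
  have hW : ∏ j, ENNReal.ofReal (Real.exp (u j)) ≠ ∞ :=
    ENNReal.prod_ne_top fun j _ => ENNReal.ofReal_ne_top
  rw [lintegral_congr_ae h6, lintegral_const_mul' _ _ hW, h5]
  have hmz : Measurable fun z : (j : Fin d) → Fin (n j) → X => ENNReal.ofReal
      (blockMoment φ σ (groupOf n) (flatten z) fun y j => f j y + u j) :=
    ((measurable_blockMoment_left φ σ (groupOf n) (measurable_pi_iff.2 hθ.measurable)).comp
      measurable_flatten).ennreal_ofReal
  simp only [jointDensity]
  rw [lintegral_const_mul' _ _ hW, lintegral_const_mul _ hmz]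

end Joint

/-! ### Identifying the conditional law -/

theorem measure_pi_ext {ι : Type*} [Finite ι] {Y : ι → Type*} [∀ i, MeasurableSpace (Y i)]
    {ν ν' : Measure (∀ i, Y i)} [IsFiniteMeasure ν]
    (h : ∀ C : ∀ i, Set (Y i), (∀ i, MeasurableSet (C i)) → ν (univ.pi C) = ν' (univ.pi C)) :
    ν = ν' := by
  refine ext_of_generate_finite _ generateFrom_pi.symm isPiSystem_pi ?_ ?_
  · rintro _ ⟨C, hC, rfl⟩
    exact h C fun i => by simpa using hC i (mem_univ i)
  · simpa using h (fun _ => univ) fun _ => MeasurableSet.univ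

section Joint

variable {X : Type*} [MeasurableSpace X] {d : ℕ} {n : Fin d → ℕ} {φ σ : ℝ}

theorem measure_sample_ext {ν ν' : Measure ((j : Fin d) → Fin (n j) → X)} [IsFiniteMeasure ν]
    (h : ∀ B : (j : Fin d) → Fin (n j) → Set X, (∀ j i, MeasurableSet (B j i)) →
      ν {z | ∀ j i, z j i ∈ B j i} = ν' {z | ∀ j i, z j i ∈ B j i}) : ν = ν' := by
  have h1 : ν.map flatten = ν'.map flatten := by
    refine measure_pi_ext fun C hC => ?_
    rw [Measure.map_apply measurable_flatten (MeasurableSet.univ_pi hC),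
      Measure.map_apply measurable_flatten (MeasurableSet.univ_pi hC)]
    have h2 : flatten ⁻¹' (univ.pi C) = {z : (j : Fin d) → Fin (n j) → X |
        ∀ j i, z j i ∈ C (finSigmaFinEquiv ⟨j, i⟩)} := by
      ext z
      simp only [mem_preimage, Set.mem_pi, mem_univ, true_imp_iff, Set.mem_ofPred_eq]
      constructor
      · intro h j i
        rw [← flatten_apply z]
        exact h _
      · intro h i
        obtain ⟨⟨j, i⟩, rfl⟩ := finSigmaFinEquiv.surjective i
        rw [flatten_apply]
        exact h j i
    rw [h2]
    exact h _ fun j i => hC _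
  have h3 : ∀ ρ : Measure ((j : Fin d) → Fin (n j) → X), (ρ.map flatten).map unflatten = ρ :=
    fun ρ => by
      rw [Measure.map_map measurable_unflatten measurable_flatten]
      have : (unflatten ∘ flatten : ((j : Fin d) → Fin (n j) → X) → _) = id :=
        funext unflatten_flatten
      rw [this, Measure.map_id]
  rw [← h3 ν, ← h3 ν', h1]

/-- From boxes to all measurable rectangles, one factor at a time with the other one fixed. -/
theorem measure_joint_ext {ν ν' : Measure (((j : Fin d) → Fin (n j) → X) × (Fin d → ℝ))}
    [IsFiniteMeasure ν]
    (h : ∀ B : (j : Fin d) → Fin (n j) → Set X, (∀ j i, MeasurableSet (B j i)) →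
      ∀ C : Fin d → Set ℝ, (∀ j, MeasurableSet (C j)) →
      ν ({z | ∀ j i, z j i ∈ B j i} ×ˢ univ.pi C) = ν' ({z | ∀ j i, z j i ∈ B j i} ×ˢ univ.pi C)) :
    ν = ν' := by
  have h1 : ∀ B : (j : Fin d) → Fin (n j) → Set X, (∀ j i, MeasurableSet (B j i)) →
      ∀ T : Set (Fin d → ℝ), MeasurableSet T →
      ν ({z | ∀ j i, z j i ∈ B j i} ×ˢ T) = ν' ({z | ∀ j i, z j i ∈ B j i} ×ˢ T) := by
    intro B hB T hT
    have hS := measurableSet_sampleBox hB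
    have key : ∀ (ρ : Measure (((j : Fin d) → Fin (n j) → X) × (Fin d → ℝ)))
        (T : Set (Fin d → ℝ)), MeasurableSet T →
        ((ρ.restrict ({z | ∀ j i, z j i ∈ B j i} ×ˢ univ)).map Prod.snd) T =
          ρ ({z | ∀ j i, z j i ∈ B j i} ×ˢ T) := fun ρ T hT => by
      rw [Measure.map_apply measurable_snd hT, Measure.restrict_apply (measurable_snd hT)]
      congr 1
      ext q
      simp [and_comm]
    have h2 : (ν.restrict ({z | ∀ j i, z j i ∈ B j i} ×ˢ univ)).map Prod.snd =
        (ν'.restrict ({z | ∀ j i, z j i ∈ B j i} ×ˢ univ)).map Prod.snd :=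
      measure_pi_ext fun C hC => by
        rw [key _ _ (MeasurableSet.univ_pi hC), key _ _ (MeasurableSet.univ_pi hC)]
        exact h B hB C hC
    rw [← key ν T hT, h2, key ν' T hT]
  refine Measure.ext_prod fun {S T} hS hT => ?_
  have key : ∀ (ρ : Measure (((j : Fin d) → Fin (n j) → X) × (Fin d → ℝ)))
      (S : Set ((j : Fin d) → Fin (n j) → X)), MeasurableSet S →
      ((ρ.restrict (univ ×ˢ T)).map Prod.fst) S = ρ (S ×ˢ T) := fun ρ S hS => by
    rw [Measure.map_apply measurable_fst hS, Measure.restrict_apply (measurable_fst hS)]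
    congr 1
    ext q
    simp
  have h2 : (ν.restrict (univ ×ˢ T)).map Prod.fst = (ν'.restrict (univ ×ˢ T)).map Prod.fst :=
    measure_sample_ext fun B hB => by
      rw [key _ _ (measurableSet_sampleBox hB), key _ _ (measurableSet_sampleBox hB)]
      exact h1 B hB T hT
  rw [← key ν S hS, h2, key ν' S hS]

theorem laplaceTest_zero (ν : Fin d → Measure X) : laplaceTest (fun _ _ => 0) ν = 1 := by
  simp [laplaceTest, expNeg_zero]

variable [TopologicalSpace X] [PolishSpace X] [BorelSpace X]
  {Ω : Type*} [MeasurableSpace Ω] {P : Measure Ω} {μ : Ω → Fin d → Measure X}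
  {obs : Ω → (j : Fin d) → Fin (n j) → X} {G : Ω → Fin d → ℝ}

/-- Bayes' formula for Laplace functionals. Weighting P by the functional in f gives (obs, U) the
density `jointDensity` in f over a base measure free of f, and f = 0 gives the law of (obs, U). `hQ`
says that the functional of Q is the quotient of the two, in a form without division; positive u
suffice because the base measure charges no others. -/
theorem hasCondDistrib_of_laplaceTest [IsProbabilityMeasure P]
    (hφ : 0 < φ) (hσ : σ ∈ Ioo (0 : ℝ) 1)
    (α : Measure X) [IsProbabilityMeasure α] (hα : ∀ a, α {a} = 0) (hn : ∀ j, 1 ≤ n j)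
    (hμ : Measurable μ)
    (hL : ∀ θ : X → Fin d → ℝ, IsTest (fun j y => θ y j) →
      ∫⁻ ω, laplaceTest (fun j y => θ y j) (μ ω) ∂P =
        ENNReal.ofReal (Real.exp (-∫ y, levyExponent φ σ (θ y) ∂α)))
    (hobs : IsNormalizedSample P μ n obs) (hG : IsGammaAuxiliary P μ n obs G)
    (Q : Kernel (((j : Fin d) → Fin (n j) → X) × (Fin d → ℝ)) (Fin d → Measure X))
    [IsMarkovKernel Q]
    (hQ : ∀ f : Fin d → X → ℝ, IsTest f → ∀ z u, (∀ j, 0 < u j) →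
      jointDensity φ σ α n (fun _ _ => 0) (z, u) * ∫⁻ ν, laplaceTest f ν ∂(Q (z, u)) =
        jointDensity φ σ α n f (z, u)) :
    HasCondDistrib μ (fun ω => (obs ω, latent μ G ω)) Q P := by
  have hγ : ∀ j, IsProbabilityMeasure (gammaMeasure (n j) 1) := fun j =>
    isProbabilityMeasure_gammaMeasure (by exact_mod_cast hn j) one_pos
  have hY : Measurable fun ω => (obs ω, latent μ G ω) :=
    hobs.measurable.prodMk (measurable_latent hμ hG.measurable)
  have h0 : IsTest fun (_ : Fin d) (_ : X) => (0 : ℝ) := IsTest.const fun _ => le_rfl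
  let base := (sampleMeasure α n).prod (Measure.pi fun j => gammaMeasure (n j) 1)
  have h1 : ∀ f : Fin d → X → ℝ, IsTest f →
      (P.withDensity fun ω => laplaceTest f (μ ω)).map (fun ω => (obs ω, latent μ G ω)) =
        base.withDensity (jointDensity φ σ α n f) := fun f hf => by
    have : IsFiniteMeasure (P.withDensity fun ω => laplaceTest f (μ ω)) :=
      isFiniteMeasure_withDensity (ne_top_of_le_ne_top (measure_ne_top P univ)
        ((lintegral_mono fun ω => laplaceTest_le_one f (μ ω)).trans (by simp)))
    refine measure_joint_ext fun B hB C hC => ?_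
    have hD := (measurableSet_sampleBox hB).prod (MeasurableSet.univ_pi hC)
    rw [Measure.map_apply hY hD, withDensity_apply _ (hY hD), withDensity_apply _ hD,
      ← setLIntegral_laplaceTest_joint hφ hσ α hα hn hμ hL hobs hG hB hC hf]
    congr 2
    ext ω
    simp [Set.mem_pi]
  have h2 : P.map (fun ω => (obs ω, latent μ G ω)) =
      base.withDensity (jointDensity φ σ α n fun _ _ => 0) := by
    rw [← h1 _ h0]
    simp_rw [laplaceTest_zero]
    rw [withDensity_const, one_smul]
  have hpos : ∀ᵐ q ∂base, ∀ j, 0 < q.2 j := by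
    have := ae_pos_pi_gammaMeasure hn
    exact Measure.quasiMeasurePreserving_snd.ae this
  have hQm : ∀ f : Fin d → X → ℝ, IsTest f →
      Measurable fun q => ∫⁻ ν, laplaceTest f ν ∂(Q q) := fun f hf =>
    (measurable_laplaceTest hf).lintegral_kernel
  have hJ0 := measurable_jointDensity φ σ α n h0.measurable
  -- On each event {(obs, U) ∈ D}, the law of μ and the mixture of Q are finite measures, so their
  -- Laplace functionals decide equality.
  have h3 : ∀ D, MeasurableSet D →
      (P.restrict ((fun ω => (obs ω, latent μ G ω)) ⁻¹' D)).map μ =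
        ((P.map fun ω => (obs ω, latent μ G ω)).restrict D).bind Q := fun D hD => by
    have : IsProbabilityMeasure (P.map fun ω => (obs ω, latent μ G ω)) :=
      Measure.isProbabilityMeasure_map hY.aemeasurable
    refine measure_ext_of_laplaceTest _ _ fun f hf => ?_
    have hf' := measurable_laplaceTest hf
    rw [lintegral_map hf' hμ, Measure.lintegral_bind Q.aemeasurable hf'.aemeasurable, h2,
      restrict_withDensity hD, lintegral_withDensity_eq_lintegral_mul _ hJ0 (hQm f hf)]
    have h4 := congrArg (fun ρ => ρ D) (h1 f hf)
    rw [Measure.map_apply hY hD, withDensity_apply _ (hY hD), withDensity_apply _ hD] at h4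
    rw [h4]
    refine lintegral_congr_ae (ae_restrict_of_ae ?_)
    filter_upwards [hpos] with q hq
    exact (hQ f hf q.1 q.2 hq).symm
  refine ⟨(hY.prodMk hμ).aemeasurable, ?_⟩
  have : IsProbabilityMeasure (P.map fun ω => ((obs ω, latent μ G ω), μ ω)) :=
    Measure.isProbabilityMeasure_map (hY.prodMk hμ).aemeasurable
  have : IsProbabilityMeasure (P.map fun ω => (obs ω, latent μ G ω)) :=
    Measure.isProbabilityMeasure_map hY.aemeasurable
  refine Measure.ext_prod fun {D A} hD hA => ?_
  have h4 := congrArg (fun ρ => ρ A) (h3 D hD)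
  rw [Measure.map_apply hμ hA, Measure.restrict_apply (hμ hA),
    Measure.bind_apply hA Q.aemeasurable] at h4
  rw [Measure.map_apply (hY.prodMk hμ) (hD.prod hA), Measure.compProd_apply_prod hD hA, ← h4]
  congr 1
  ext ω
  simp [and_comm]

end Joint

/-! ### The exponentially tilted prior -/

theorem measurable_gammaMeasure_apply (a : ℝ) {B : Set ℝ} (hB : MeasurableSet B) :
    Measurable fun r => gammaMeasure a r B := by
  have h1 : Measurable fun p : ℝ × ℝ => gammaPDF a p.1 p.2 := by
    unfold gammaPDF gammaPDFReal
    refine Measurable.ennreal_ofReal (Measurable.ite (measurable_snd measurableSet_Ici) ?_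
      measurable_const)
    fun_prop
  simp_rw [gammaMeasure, withDensity_apply _ hB]
  exact h1.lintegral_prod_right'

/-- The factor ∏_j (1 + s w_j)^{-φ} is the Laplace transform of the scores of an atom of height s.
For constant test functions the cost does not depend on the location, hence the one-point space. -/
theorem updatedLevy_eq_withDensity {d : ℕ} {φ σ : ℝ} (hφ : 0 < φ) {w : Fin d → ℝ}
    (hw : ∀ j, 0 ≤ w j) :
    updatedLevy φ σ w = (stableLevy φ σ).withDensity
      fun s => expNeg (levelCost φ (fun j (_ : Unit) => w j) (s, ())) := by
  have h1 : Measurable fun s : ℝ => expNeg (levelCost φ (fun j (_ : Unit) => w j) (s, ())) := by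
    have := measurable_levelCost (X := Unit) φ (IsTest.const hw)
    exact (measurable_expNeg.comp this).comp (measurable_id.prodMk measurable_const)
  rw [stableLevy, updatedLevy, ← withDensity_mul _ (measurable_stableDensity φ σ).ennreal_ofReal h1]
  refine withDensity_congr_ae ((ae_restrict_iff' measurableSet_Ioi).2 (Eventually.of_forall ?_))
  intro s (hs : 0 < s)
  have h2 : ∀ j, 0 < 1 + s * w j := fun j => by nlinarith [mul_nonneg hs.le (hw j)]
  have h3 : ∀ j, 0 ≤ (1 / (1 + s * w j)) ^ φ := fun j =>
    Real.rpow_nonneg (one_div_nonneg.2 (h2 j).le) _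
  rw [Pi.mul_apply, expNeg_levelCost hφ (fun j _ => hw j) hs.le,
    ← ENNReal.ofReal_prod_of_nonneg fun j _ => h3 j,
    ← ENNReal.ofReal_mul' (Finset.prod_nonneg fun j _ => h3 j)]
  beta_reduce
  congr 1
  have h4 : ∀ j, 1 / (s * w j + 1) ^ φ = (1 / (1 + s * w j)) ^ φ := fun j => by
    rw [Real.div_rpow zero_le_one (h2 j).le, Real.one_rpow, add_comm]
  simp_rw [h4]
  rw [add_comm φ σ]
  ring

section Tilt

variable {X : Type*} [MeasurableSpace X] {d : ℕ} {φ σ : ℝ}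
  {Ω Ω' : Type*} [MeasurableSpace Ω] [MeasurableSpace Ω'] {P : Measure Ω} {P' : Measure Ω'}
  {J : ℕ → Ω → ℝ} {x : ℕ → Ω → X} {m : Fin d → ℕ → Ω → ℝ}
  {J' : ℕ → Ω' → ℝ} {x' : ℕ → Ω' → X} {m' : Fin d → ℕ → Ω' → ℝ} {w : Fin d → ℝ}

/-- The law of heights, locations and scores under `P'` is the one under `P`, tilted by the
exponential of the total masses weighted by `w`. -/
def IsTilted (P : Measure Ω) (P' : Measure Ω') (J : ℕ → Ω → ℝ) (x : ℕ → Ω → X)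
    (m : Fin d → ℕ → Ω → ℝ) (J' : ℕ → Ω' → ℝ) (x' : ℕ → Ω' → X) (m' : Fin d → ℕ → Ω' → ℝ)
    (w : Fin d → ℝ) : Prop :=
  ∀ F : (ℕ → ℝ) × (ℕ → X) × (Fin d → ℕ → ℝ) → ℝ≥0∞, Measurable F →
    ∫⁻ ω, F ((fun i => J' i ω), (fun i => x' i ω), fun j i => m' j i ω) ∂P' =
      (∫⁻ ω, laplaceTest (fun j _ => w j) (compound J x m ω) ∂P)⁻¹ *
        ∫⁻ ω, F ((fun i => J i ω), (fun i => x i ω), fun j i => m j i ω) *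
          laplaceTest (fun j _ => w j) (compound J x m ω) ∂P

theorem IsTilted.ae_nonneg (hV : IsTilted P P' J x m J' x' m' w)
    (hJ' : ∀ i, Measurable (J' i)) (hJ0 : ∀ i, ∀ᵐ ω ∂P, 0 ≤ J i ω) (i : ℕ) :
    ∀ᵐ ω ∂P', 0 ≤ J' i ω := by
  have hA : MeasurableSet {p : (ℕ → ℝ) × (ℕ → X) × (Fin d → ℕ → ℝ) | p.1 i < 0} :=
    measurableSet_lt ((measurable_pi_apply i).comp measurable_fst) measurable_const
  have h := hV _ (measurable_one.indicator hA)
  have h1 : ∫⁻ ω, {p : (ℕ → ℝ) × (ℕ → X) × (Fin d → ℕ → ℝ) | p.1 i < 0}.indicator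
      (1 : (ℕ → ℝ) × (ℕ → X) × (Fin d → ℕ → ℝ) → ℝ≥0∞) ((fun i => J i ω), (fun i => x i ω), fun j i => m j i ω) *
        laplaceTest (fun j _ => w j) (compound J x m ω) ∂P = 0 := by
    refine lintegral_eq_zero_of_ae_eq_zero ?_
    filter_upwards [hJ0 i] with ω hω
    rw [indicator_of_notMem (by simpa using hω), zero_mul, Pi.zero_apply]
  rw [h1, mul_zero] at h
  have h2 : ∫⁻ ω, {ω | J' i ω < 0}.indicator 1 ω ∂P' = 0 := h
  rw [lintegral_indicator_one (measurableSet_lt (hJ' i) measurable_const)] at h2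
  rw [ae_iff]
  simpa using h2

variable [IsProbabilityMeasure P]

/-- Once the scores are integrated out, tilting by the total masses tilts the Poisson process of
heights and locations by the additive functional `levelCost`, which changes the intensity as in
`IsPoissonProcess.tilt`. -/
theorem IsTilted.isCRM [IsProbabilityMeasure P'] (hφ : 0 < φ) (hσ : σ ∈ Ioo (0 : ℝ) 1) {α : Measure X}
    [IsProbabilityMeasure α] (hc : IsCRM P ((stableLevy φ σ).prod α) J x)
    (hs : HasScores P (fun (_ : ℝ) (_ : Fin d) => gammaMeasure φ 1) J x m)
    (hw : ∀ j, 0 ≤ w j) (hJ' : ∀ i, Measurable (J' i)) (hx' : ∀ i, Measurable (x' i))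
    (hV : IsTilted P P' J x m J' x' m' w) :
    IsCRM P' ((updatedLevy φ σ w).prod α) J' x' := by
  have hwt : IsTest fun j (_ : X) => w j := IsTest.const hw
  refine ⟨hJ', hx', hV.ae_nonneg hJ' hc.nonneg, ?_⟩
  have hg := measurable_levelCost φ hwt
  have hfin := lintegral_one_sub_expNeg_levelCost hφ hσ α hwt
  have hΛ : (updatedLevy φ σ w).prod α = ((stableLevy φ σ).prod α).withDensity
      fun p => expNeg (levelCost φ (fun j (_ : X) => w j) p) := by
    have h1 : Measurable fun s : ℝ => expNeg (levelCost φ (fun j (_ : Unit) => w j) (s, ())) := by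
      have := measurable_levelCost (X := Unit) φ (IsTest.const hw)
      exact (measurable_expNeg.comp this).comp (measurable_id.prodMk measurable_const)
    rw [updatedLevy_eq_withDensity hφ hw, prod_withDensity_left h1]
    rfl
  rw [hΛ]
  refine hc.poisson.tilt (measurable_pointProcess hJ' hx') hg (by rw [hfin]; exact
    ENNReal.ofReal_ne_top) fun k hk => ?_
  let F : (ℕ → ℝ) × (ℕ → X) → ℝ≥0∞ := fun y => expNeg (∫⁻ p, k p ∂(pointProcess y.1 y.2))
  have hF : Measurable F := by
    refine measurable_expNeg.comp ((Measure.measurable_lintegral hk).comp ?_)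
    exact measurable_pointProcess (Ω := (ℕ → ℝ) × (ℕ → X)) (J := fun i y => y.1 i)
      (x := fun i y => y.2 i) (fun i => (measurable_pi_apply i).comp measurable_fst)
      (fun i => (measurable_pi_apply i).comp measurable_snd)
  have h1 := hV (fun q => F (q.1, q.2.1))
    (hF.comp (measurable_fst.prodMk (measurable_fst.comp measurable_snd)))
  have h2 := hs.lintegral_tilt hφ hc.measurable_height hc.measurable_location hc.nonneg hwt hF
    (fun _ => expNeg_le_one _) 0 (fun _ _ => univ) (fun _ _ => MeasurableSet.univ)
  simp only [Finset.range_zero, Finset.prod_empty, Finset.prod_const_one, mul_one] at h2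
  simp only [F] at h1 h2
  rw [h1, h2, lintegral_laplaceTest_compound hφ hc hs hwt]
  congr 1
  refine lintegral_congr fun ω => ?_
  rw [← expNeg_add, lintegral_add_right _ hg]

/-- Both sides of the defining identity are carried back to P and evaluated by `lintegral_tilt`:
once with the constraints on the scores, once with the gamma probabilities as part of the weight. -/
theorem IsTilted.hasScores (hφ : 0 < φ)
    (hJ : ∀ i, Measurable (J i)) (hx : ∀ i, Measurable (x i)) (hJ0 : ∀ i, ∀ᵐ ω ∂P, 0 ≤ J i ω)
    (hs : HasScores P (fun (_ : ℝ) (_ : Fin d) => gammaMeasure φ 1) J x m)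
    (hw : ∀ j, 0 ≤ w j) (hJ' : ∀ i, Measurable (J' i)) (hx' : ∀ i, Measurable (x' i))
    (hm' : ∀ j i, Measurable (m' j i))
    (hV : IsTilted P P' J x m J' x' m' w) :
    HasScores P' (fun t j => gammaMeasure φ (w j * t + 1)) J' x' m' := by
  have hwt : IsTest fun j (_ : X) => w j := IsTest.const hw
  refine ⟨hm', fun A hA N B hB => ?_⟩
  -- Heights are nonnegative only almost surely. Restricting to nonnegative heights makes all rates
  -- positive and the weight bounded by 1 everywhere.
  let A₀ : Set ((ℕ → ℝ) × (ℕ → X)) := A ∩ {y | ∀ i, 0 ≤ y.1 i}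
  have hA₀ : MeasurableSet A₀ := by
    refine hA.inter ?_
    simp only [Set.ofPred_forall]
    exact MeasurableSet.iInter fun i =>
      measurableSet_le measurable_const ((measurable_pi_apply i).comp measurable_fst)
  let K : (ℕ → ℝ) × (ℕ → X) → ℝ≥0∞ := fun y =>
    ∏ j, ∏ i ∈ Finset.range N, gammaMeasure φ (w j * y.1 i + 1) (B j i)
  have hK : Measurable K := by
    refine Finset.measurable_prod _ fun j _ => Finset.measurable_prod _ fun i _ => ?_
    have h1 : Measurable fun y : (ℕ → ℝ) × (ℕ → X) => w j * y.1 i + 1 :=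
      (((measurable_pi_apply i).comp measurable_fst).const_mul _).add_const _
    exact (measurable_gammaMeasure_apply φ (hB j i)).comp h1
  have hae : ∀ᵐ ω ∂P, ∀ i, 0 ≤ J i ω := ae_all_iff.2 hJ0
  have hae' : ∀ᵐ ω ∂P', ∀ i, 0 ≤ J' i ω := ae_all_iff.2 (hV.ae_nonneg hJ' hJ0)
  have hYm : Measurable fun ω => ((fun i => J' i ω), (fun i => x' i ω)) :=
    (measurable_pi_lambda _ hJ').prodMk (measurable_pi_lambda _ hx')
  have hpr : Measurable fun q : (ℕ → ℝ) × (ℕ → X) × (Fin d → ℕ → ℝ) => (q.1, q.2.1) :=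
    measurable_fst.prodMk (measurable_fst.comp measurable_snd)
  let D : (Fin d → ℕ → ℝ) → ℝ≥0∞ := fun t =>
    ∏ j, ∏ i ∈ Finset.range N, (B j i).indicator 1 (t j i)
  have hD : Measurable D := Finset.measurable_prod _ fun j _ => Finset.measurable_prod _ fun i _ =>
    (measurable_one.indicator (hB j i)).comp ((measurable_pi_apply i).comp (measurable_pi_apply j))
  have hAi : Measurable (A₀.indicator (1 : (ℕ → ℝ) × (ℕ → X) → ℝ≥0∞)) :=
    measurable_one.indicator hA₀
  have hleft : P' ({ω | ((fun i => J' i ω), (fun i => x' i ω)) ∈ A} ∩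
          {ω | ∀ j, ∀ i < N, m' j i ω ∈ B j i}) =
      ∫⁻ ω, A₀.indicator 1 ((fun i => J' i ω), (fun i => x' i ω)) *
        D (fun j i => m' j i ω) ∂P' := by
    have hS : MeasurableSet ({ω | ((fun i => J' i ω), (fun i => x' i ω)) ∈ A} ∩
          {ω | ∀ j, ∀ i < N, m' j i ω ∈ B j i}) := by
      refine (hYm hA).inter ?_
      simp only [Set.ofPred_forall]
      exact MeasurableSet.iInter fun j => MeasurableSet.iInter fun i =>
        MeasurableSet.iInter fun _ => hm' j i (hB j i)
    rw [← lintegral_indicator_one hS]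
    refine lintegral_congr_ae ?_
    filter_upwards [hae'] with ω hω
    have hmem : (((fun i => J' i ω), (fun i => x' i ω)) ∈ A₀) ↔
        ((fun i => J' i ω), (fun i => x' i ω)) ∈ A := ⟨fun h => h.1, fun h => ⟨h, hω⟩⟩
    by_cases h2 : ∀ j, ∀ i < N, m' j i ω ∈ B j i
    · have h3 : D (fun j i => m' j i ω) = 1 := Finset.prod_eq_one fun j _ =>
        Finset.prod_eq_one fun i hi => by
          rw [indicator_of_mem (h2 j i (Finset.mem_range.1 hi)), Pi.one_apply]
      rw [h3, mul_one]
      by_cases h1 : ((fun i => J' i ω), (fun i => x' i ω)) ∈ A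
      · have h4 : ω ∈ {ω | ((fun i => J' i ω), (fun i => x' i ω)) ∈ A} ∩
            {ω | ∀ j, ∀ i < N, m' j i ω ∈ B j i} := ⟨h1, h2⟩
        rw [indicator_of_mem (hmem.2 h1), indicator_of_mem h4]; rfl
      · rw [indicator_of_notMem fun h => h1 (hmem.1 h), indicator_of_notMem fun h => h1 h.1]
    · have h3 : D (fun j i => m' j i ω) = 0 := by
        push Not at h2
        obtain ⟨j, i, hi, hj⟩ := h2
        exact Finset.prod_eq_zero (Finset.mem_univ j) (Finset.prod_eq_zero
          (Finset.mem_range.2 hi) (indicator_of_notMem hj _))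
      rw [h3, mul_zero, indicator_of_notMem fun h => h2 h.2]
  have hright : ∫⁻ ω in {ω | ((fun i => J' i ω), (fun i => x' i ω)) ∈ A},
          ∏ j, ∏ i ∈ Finset.range N, gammaMeasure φ (w j * J' i ω + 1) (B j i) ∂P' =
      ∫⁻ ω, A₀.indicator 1 ((fun i => J' i ω), (fun i => x' i ω)) *
        K ((fun i => J' i ω), (fun i => x' i ω)) ∂P' := by
    have hS : MeasurableSet {ω | ((fun i => J' i ω), (fun i => x' i ω)) ∈ A} := hYm hA
    rw [← lintegral_indicator hS]
    refine lintegral_congr_ae ?_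
    filter_upwards [hae'] with ω hω
    have hmem : (((fun i => J' i ω), (fun i => x' i ω)) ∈ A₀) ↔
        ((fun i => J' i ω), (fun i => x' i ω)) ∈ A := ⟨fun h => h.1, fun h => ⟨h, hω⟩⟩
    by_cases h1 : ((fun i => J' i ω), (fun i => x' i ω)) ∈ A
    · rw [indicator_of_mem (hmem.2 h1), indicator_of_mem (by exact h1), Pi.one_apply, one_mul]
    · rw [indicator_of_notMem fun h => h1 (hmem.1 h), indicator_of_notMem (by exact h1), zero_mul]
  have e1 := hV (fun q => A₀.indicator 1 (q.1, q.2.1) * D q.2.2)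
    ((hAi.comp hpr).mul (hD.comp (measurable_snd.comp measurable_snd)))
  have e2 := hV (fun q => A₀.indicator 1 (q.1, q.2.1) * K (q.1, q.2.1))
    ((hAi.comp hpr).mul (hK.comp hpr))
  have hAle : ∀ y, A₀.indicator (1 : (ℕ → ℝ) × (ℕ → X) → ℝ≥0∞) y ≤ 1 := fun y =>
    indicator_le_self' (fun _ _ => zero_le) y
  have hAK : ∀ y, A₀.indicator (1 : (ℕ → ℝ) × (ℕ → X) → ℝ≥0∞) y * K y ≤ 1 := fun y => by
    by_cases hy : y ∈ A₀
    · rw [indicator_of_mem hy, Pi.one_apply, one_mul]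
      refine Finset.prod_le_one' fun j _ => Finset.prod_le_one' fun i _ => ?_
      have := isProbabilityMeasure_gammaMeasure hφ
        (show 0 < w j * y.1 i + 1 by nlinarith [mul_nonneg (hw j) (hy.2 i)])
      exact prob_le_one
    · rw [indicator_of_notMem hy, zero_mul]
      exact zero_le
  have t1 := hs.lintegral_tilt hφ hJ hx hJ0 hwt hAi hAle N B hB
  have t2 := hs.lintegral_tilt hφ hJ hx hJ0 hwt (hAi.mul hK) hAK 0 (fun _ _ => univ)
    (fun _ _ => MeasurableSet.univ)
  simp only [Finset.range_zero, Finset.prod_empty, Finset.prod_const_one, mul_one,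
    Pi.mul_apply] at t2
  have hcomm : ∀ i j (ω : Ω), 1 + J i ω * w j = w j * J i ω + 1 := fun i j ω => by ring
  simp only [hcomm] at t1
  rw [hleft, hright, e1, e2]
  congr 1
  exact t1.trans t2.symm

end Tilt

/-! ### Laws of the jumps at the observed values -/

section FixedJumps

variable {d : ℕ} {φ σ : ℝ} {w : Fin d → ℝ} {c : Fin d → ℕ}

theorem withDensity_jumpDensity (hφ : 0 < φ) (hσ : σ ∈ Ioo (0 : ℝ) 1) (hw : ∀ j, 0 ≤ w j) :
    (stableLevy φ σ).withDensity (fun s => ENNReal.ofReal (jumpDensity φ c s w)) =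
      ENNReal.ofReal (σ * Real.Gamma φ / (Real.Gamma (σ + φ) * Real.Gamma (1 - σ)) *
        ∏ j, (Real.Gamma (φ + c j) / Real.Gamma φ)) • fixedJumpWeight φ σ w c := by
  have hm := (measurable_jumpDensity_left φ c w).ennreal_ofReal
  have hm' : Measurable fun s : ℝ => ENNReal.ofReal (s ^ (((∑ j, c j : ℕ) : ℝ) - 1 - σ) *
      ∏ j, 1 / (s * w j + 1) ^ ((c j : ℝ) + φ)) := by
    refine Measurable.ennreal_ofReal (Measurable.mul (by fun_prop)
      (Finset.measurable_prod _ fun j _ => ?_))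
    fun_prop
  have hK : 0 ≤ σ * Real.Gamma φ / (Real.Gamma (σ + φ) * Real.Gamma (1 - σ)) *
        ∏ j, (Real.Gamma (φ + c j) / Real.Gamma φ) := by
    refine mul_nonneg (stableConst_pos hφ hσ).le (Finset.prod_nonneg fun j _ => ?_)
    exact div_nonneg (Real.Gamma_nonneg_of_nonneg (by positivity))
      (Real.Gamma_nonneg_of_nonneg hφ.le)
  rw [stableLevy, fixedJumpWeight,
    ← withDensity_mul _ (measurable_stableDensity φ σ).ennreal_ofReal hm, ← withDensity_smul _ hm']
  refine withDensity_congr_ae ((ae_restrict_iff' measurableSet_Ioi).2 (Eventually.of_forall ?_))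
  intro s (hs : 0 < s)
  have h2 : ∀ j, 0 < 1 + s * w j := fun j => by nlinarith [mul_nonneg hs.le (hw j)]
  simp only [Pi.mul_apply, Pi.smul_apply, smul_eq_mul]
  rw [← ENNReal.ofReal_mul' (jumpDensity_pos hφ hs hw c).le, ← ENNReal.ofReal_mul hK]
  congr 1
  have h3 : jumpDensity φ c s w = (∏ j, (Real.Gamma (φ + c j) / Real.Gamma φ)) *
      s ^ (∑ j, c j) * ∏ j, 1 / (s * w j + 1) ^ ((c j : ℝ) + φ) := by
    rw [jumpDensity, ← Finset.prod_pow_eq_pow_sum, ← Finset.prod_mul_distrib,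
      ← Finset.prod_mul_distrib]
    refine Finset.prod_congr rfl fun j _ => ?_
    rw [jumpFactor, Real.rpow_neg (h2 j).le, one_div, add_comm (c j : ℝ) φ, add_comm (s * w j) 1]
  have h4 : s ^ (((∑ j, c j : ℕ) : ℝ) - 1 - σ) = s ^ (-1 - σ) * s ^ (∑ j, c j) := by
    rw [← Real.rpow_natCast s (∑ j, c j), ← Real.rpow_add hs]
    congr 1
    ring
  rw [h3, h4]
  ring

/-- The jump density against ν* is a constant multiple of the weight that defines the law, and the
constant disappears on normalization. The total mass then becomes the jump moment. -/
theorem fixedJumpLaw_eq (hφ : 0 < φ) (hσ : σ ∈ Ioo (0 : ℝ) 1) (hw : ∀ j, 0 < w j) (hc : c ≠ 0) :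
    fixedJumpLaw φ σ w c = (ENNReal.ofReal (jumpMoment φ σ c w))⁻¹ •
      (stableLevy φ σ).withDensity fun s => ENNReal.ofReal (jumpDensity φ c s w) := by
  have hK : 0 < σ * Real.Gamma φ / (Real.Gamma (σ + φ) * Real.Gamma (1 - σ)) *
        ∏ j, (Real.Gamma (φ + c j) / Real.Gamma φ) := by
    refine mul_pos (stableConst_pos hφ hσ) (Finset.prod_pos fun j _ => ?_)
    exact div_pos (Real.Gamma_pos_of_pos (by positivity)) (Real.Gamma_pos_of_pos hφ)
  have h1 := withDensity_jumpDensity (c := c) hφ hσ fun j => (hw j).le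
  have h2 : (stableLevy φ σ).withDensity (fun s => ENNReal.ofReal (jumpDensity φ c s w)) univ =
      ENNReal.ofReal (jumpMoment φ σ c w) := by
    rw [withDensity_apply _ MeasurableSet.univ, Measure.restrict_univ, jumpMoment,
      ofReal_integral_eq_lintegral_ofReal (integrable_jumpDensity hφ hσ hc hw)]
    filter_upwards [ae_pos_stableLevy φ σ] with s hs
    exact (jumpDensity_pos hφ hs (fun j => (hw j).le) c).le
  have hK0 := (ENNReal.ofReal_pos.2 hK).ne'
  have h3 := congrArg (fun ρ => ρ univ) h1
  rw [h2, Measure.smul_apply, smul_eq_mul] at h3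
  rw [h1, h3, fixedJumpLaw, smul_smul, ENNReal.mul_inv (Or.inl hK0) (Or.inl ENNReal.ofReal_ne_top),
    mul_right_comm, ENNReal.inv_mul_cancel hK0 ENNReal.ofReal_ne_top, one_mul]

theorem isProbabilityMeasure_fixedJumpLaw (hφ : 0 < φ) (hσ : σ ∈ Ioo (0 : ℝ) 1)
    (hw : ∀ j, 0 < w j) (hc : c ≠ 0) : IsProbabilityMeasure (fixedJumpLaw φ σ w c) := by
  constructor
  have h2 : (stableLevy φ σ).withDensity (fun s => ENNReal.ofReal (jumpDensity φ c s w)) univ =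
      ENNReal.ofReal (jumpMoment φ σ c w) := by
    rw [withDensity_apply _ MeasurableSet.univ, Measure.restrict_univ, jumpMoment,
      ofReal_integral_eq_lintegral_ofReal (integrable_jumpDensity hφ hσ hc hw)]
    filter_upwards [ae_pos_stableLevy φ σ] with s hs
    exact (jumpDensity_pos hφ hs (fun j => (hw j).le) c).le
  rw [fixedJumpLaw_eq hφ hσ hw hc, Measure.smul_apply, h2, smul_eq_mul]
  exact ENNReal.inv_mul_cancel (ENNReal.ofReal_pos.2 (jumpMoment_pos hφ hσ hc hw)).ne'
    ENNReal.ofReal_ne_top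

theorem ae_pos_fixedJumpLaw : ∀ᵐ s ∂(fixedJumpLaw φ σ w c), 0 < s := by
  refine Measure.ae_smul_measure ?_ _
  exact (withDensity_absolutelyContinuous _ _).ae_le (ae_restrict_mem measurableSet_Ioi)

/-- Since 1 + s t / (s w + 1) = (1 + s (w + t)) / (1 + s w), multiplying by the transform of the
gamma jumps turns the density at w into the density at w + t. -/
theorem lintegral_fixedJumpLaw (hφ : 0 < φ) (hσ : σ ∈ Ioo (0 : ℝ) 1) (hw : ∀ j, 0 < w j)
    (hc : c ≠ 0) {t : Fin d → ℝ} (ht : ∀ j, 0 ≤ t j) :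
    ∫⁻ s, ∏ j, ENNReal.ofReal ((1 / (1 + s / (s * w j + 1) * t j)) ^ (φ + c j))
        ∂(fixedJumpLaw φ σ w c) =
      (ENNReal.ofReal (jumpMoment φ σ c w))⁻¹ * ENNReal.ofReal (jumpMoment φ σ c (w + t)) := by
  have hm := (measurable_jumpDensity_left φ c w).ennreal_ofReal
  have hm' : Measurable fun s : ℝ =>
      ∏ j, ENNReal.ofReal ((1 / (1 + s / (s * w j + 1) * t j)) ^ (φ + c j)) := by
    refine Finset.measurable_prod _ fun j _ => Measurable.ennreal_ofReal ?_
    fun_prop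
  have hwt : ∀ j, 0 < (w + t) j := fun j => add_pos_of_pos_of_nonneg (hw j) (ht j)
  rw [fixedJumpLaw_eq hφ hσ hw hc, lintegral_smul_measure, smul_eq_mul,
    lintegral_withDensity_eq_lintegral_mul _ hm hm']
  congr 1
  rw [jumpMoment, ofReal_integral_eq_lintegral_ofReal (integrable_jumpDensity hφ hσ hc hwt)]
  · refine lintegral_congr_ae ?_
    filter_upwards [ae_pos_stableLevy φ σ] with s hs
    have h1 : ∀ j, 0 < 1 + s * w j := fun j => by nlinarith [mul_pos hs (hw j)]
    have h2 : ∀ j, 0 < 1 + s * (w + t) j := fun j => by nlinarith [mul_pos hs (hwt j)]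
    have h3 : ∀ j, 1 / (1 + s / (s * w j + 1) * t j) = (1 + s * w j) / (1 + s * (w + t) j) :=
      fun j => by
        have e1 := (h1 j).ne'
        have e2 := (h2 j).ne'
        have e3 : s * w j + 1 ≠ 0 := by rw [add_comm]; exact e1
        have : 1 + s / (s * w j + 1) * t j = (1 + s * (w + t) j) / (1 + s * w j) := by
          rw [Pi.add_apply, add_comm (s * w j) 1]
          field_simp
          ring
        rw [this, one_div_div]
    have h4 : ∀ j, 0 ≤ ((1 + s * w j) / (1 + s * (w + t) j)) ^ (φ + c j) := fun j =>
      Real.rpow_nonneg (div_nonneg (h1 j).le (h2 j).le) _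
    simp_rw [Pi.mul_apply, h3]
    rw [← ENNReal.ofReal_prod_of_nonneg fun j _ => h4 j,
      ← ENNReal.ofReal_mul' (Finset.prod_nonneg fun j _ => h4 j)]
    congr 1
    rw [jumpDensity, jumpDensity, ← Finset.prod_mul_distrib]
    refine Finset.prod_congr rfl fun j _ => ?_
    rw [jumpFactor, jumpFactor, Real.div_rpow (h1 j).le (h2 j).le, Real.rpow_neg (h1 j).le,
      Real.rpow_neg (h2 j).le]
    have e1 := (Real.rpow_pos_of_pos (h1 j) (φ + c j)).ne'
    have e2 := (Real.rpow_pos_of_pos (h2 j) (φ + c j)).ne'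
    field_simp
  · filter_upwards [ae_pos_stableLevy φ σ] with s hs
    exact (jumpDensity_pos hφ hs (fun j => (hwt j).le) c).le

variable {k : ℕ}

/-- The joint law of the common jump variables and of standardized gamma variables. -/
noncomputable def jumpModel (φ σ : ℝ) (w : Fin d → ℝ) (c : Fin k → Fin d → ℕ) :
    Measure ((Fin k → ℝ) × (Fin k → Fin d → ℝ)) :=
  (Measure.pi fun ℓ => fixedJumpLaw φ σ w (c ℓ)).prod
    (Measure.pi fun ℓ => Measure.pi fun j => gammaMeasure (φ + c ℓ j) 1)

/-- A gamma variable with rate s w + 1 is a standard one divided by s w + 1. So the conditional law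
given the common variables is realized on a product space, with no kernel needed. -/
theorem jumpModel_apply {c : Fin k → Fin d → ℕ} (hφ : 0 < φ) (hσ : σ ∈ Ioo (0 : ℝ) 1)
    (hw : ∀ j, 0 < w j)
    (hc : ∀ ℓ, c ℓ ≠ 0) {A : Set (Fin k → ℝ)} (hA : MeasurableSet A)
    {B : Fin k → Fin d → Set ℝ} (hB : ∀ ℓ j, MeasurableSet (B ℓ j)) :
    jumpModel φ σ w c ({ω | ω.1 ∈ A} ∩ {ω | ∀ ℓ j, ω.2 ℓ j / (ω.1 ℓ * w j + 1) ∈ B ℓ j}) =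
      ∫⁻ ω in {ω | ω.1 ∈ A}, ∏ ℓ, ∏ j,
        gammaMeasure (φ + c ℓ j) (ω.1 ℓ * w j + 1) (B ℓ j) ∂(jumpModel φ σ w c) := by
  have hF : ∀ ℓ, IsProbabilityMeasure (fixedJumpLaw φ σ w (c ℓ)) := fun ℓ =>
    isProbabilityMeasure_fixedJumpLaw hφ hσ hw (hc ℓ)
  have hγ : ∀ ℓ j, IsProbabilityMeasure (gammaMeasure (φ + c ℓ j) 1) := fun ℓ j =>
    isProbabilityMeasure_gammaMeasure (by positivity) one_pos
  have hS : MeasurableSet ({ω : (Fin k → ℝ) × (Fin k → Fin d → ℝ) | ω.1 ∈ A} ∩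
      {ω | ∀ ℓ j, ω.2 ℓ j / (ω.1 ℓ * w j + 1) ∈ B ℓ j}) := by
    refine (measurable_fst hA).inter ?_
    simp only [Set.ofPred_forall]
    refine MeasurableSet.iInter fun ℓ => MeasurableSet.iInter fun j => ?_
    have h1 : Measurable fun ω : (Fin k → ℝ) × (Fin k → Fin d → ℝ) =>
        ω.2 ℓ j / (ω.1 ℓ * w j + 1) := by fun_prop
    exact h1 (hB ℓ j)
  have hg : Measurable fun s : Fin k → ℝ => ∏ ℓ, ∏ j,
        gammaMeasure (φ + c ℓ j) (s ℓ * w j + 1) (B ℓ j) := by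
    refine Finset.measurable_prod _ fun ℓ _ => Finset.measurable_prod _ fun j _ => ?_
    have h1 : Measurable fun s : Fin k → ℝ => s ℓ * w j + 1 := by fun_prop
    exact (measurable_gammaMeasure_apply _ (hB ℓ j)).comp h1
  have hpos : ∀ᵐ s ∂(Measure.pi fun ℓ => fixedJumpLaw φ σ w (c ℓ)), ∀ ℓ, 0 < s ℓ := by
    rw [ae_all_iff]
    intro ℓ
    exact (measurePreserving_eval (fun ℓ => fixedJumpLaw φ σ w (c ℓ))
      ℓ).quasiMeasurePreserving.ae ae_pos_fixedJumpLaw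
  have hright : ∫⁻ ω in {ω | ω.1 ∈ A}, ∏ ℓ, ∏ j,
        gammaMeasure (φ + c ℓ j) (ω.1 ℓ * w j + 1) (B ℓ j) ∂(jumpModel φ σ w c) =
      ∫⁻ s in A, ∏ ℓ, ∏ j, gammaMeasure (φ + c ℓ j) (s ℓ * w j + 1) (B ℓ j)
        ∂(Measure.pi fun ℓ => fixedJumpLaw φ σ w (c ℓ)) :=
    measurePreserving_fst.setLIntegral_comp_preimage hA hg
  rw [hright, jumpModel, Measure.prod_apply hS, ← lintegral_indicator hA]
  refine lintegral_congr_ae ?_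
  filter_upwards [hpos] with s hs
  have hr : ∀ ℓ j, 0 < s ℓ * w j + 1 := fun ℓ j => by nlinarith [mul_pos (hs ℓ) (hw j)]
  by_cases h1 : s ∈ A
  · rw [indicator_of_mem h1]
    have h2 : Prod.mk s ⁻¹' ({ω : (Fin k → ℝ) × (Fin k → Fin d → ℝ) | ω.1 ∈ A} ∩
      {ω | ∀ ℓ j, ω.2 ℓ j / (ω.1 ℓ * w j + 1) ∈ B ℓ j}) =
      univ.pi fun ℓ => univ.pi fun j => (fun t => t / (s ℓ * w j + 1)) ⁻¹' B ℓ j := by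
      ext t
      simp [Set.mem_pi, h1]
    rw [h2, Measure.pi_pi]
    refine Finset.prod_congr rfl fun ℓ _ => ?_
    rw [Measure.pi_pi]
    refine Finset.prod_congr rfl fun j _ => ?_
    rw [← gammaMeasure_map_div (hr ℓ j), Measure.map_apply (by fun_prop) (hB ℓ j)]
  · rw [indicator_of_notMem h1]
    have h2 : Prod.mk s ⁻¹' ({ω : (Fin k → ℝ) × (Fin k → Fin d → ℝ) | ω.1 ∈ A} ∩
      {ω | ∀ ℓ j, ω.2 ℓ j / (ω.1 ℓ * w j + 1) ∈ B ℓ j}) = ∅ := by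
      ext t
      simp [h1]
    rw [h2, measure_empty]

/-- The standardized gamma variables are integrated out first, for fixed common variables.
Independence over the blocks then leaves one quotient of jump moments for each block. -/
theorem lintegral_jumpModel {c : Fin k → Fin d → ℕ} (hφ : 0 < φ) (hσ : σ ∈ Ioo (0 : ℝ) 1)
    (hw : ∀ j, 0 < w j) (hc : ∀ ℓ, c ℓ ≠ 0) {t : Fin k → Fin d → ℝ} (ht : ∀ ℓ j, 0 ≤ t ℓ j) :
    ∫⁻ ω, ∏ ℓ, ∏ j, expNeg (ENNReal.ofReal (ω.2 ℓ j / (ω.1 ℓ * w j + 1) * ω.1 ℓ) *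
        ENNReal.ofReal (t ℓ j)) ∂(jumpModel φ σ w c) =
      ∏ ℓ, ((ENNReal.ofReal (jumpMoment φ σ (c ℓ) w))⁻¹ *
        ENNReal.ofReal (jumpMoment φ σ (c ℓ) (w + t ℓ))) := by
  have hF : ∀ ℓ, IsProbabilityMeasure (fixedJumpLaw φ σ w (c ℓ)) := fun ℓ =>
    isProbabilityMeasure_fixedJumpLaw hφ hσ hw (hc ℓ)
  have hγ : ∀ ℓ j, IsProbabilityMeasure (gammaMeasure (φ + c ℓ j) 1) := fun ℓ j =>
    isProbabilityMeasure_gammaMeasure (by positivity) one_pos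
  have hpos : ∀ᵐ s ∂(Measure.pi fun ℓ => fixedJumpLaw φ σ w (c ℓ)), ∀ ℓ, 0 < s ℓ := by
    rw [ae_all_iff]
    intro ℓ
    exact (measurePreserving_eval (fun ℓ => fixedJumpLaw φ σ w (c ℓ))
      ℓ).quasiMeasurePreserving.ae ae_pos_fixedJumpLaw
  have hm : Measurable fun ω : (Fin k → ℝ) × (Fin k → Fin d → ℝ) => ∏ ℓ, ∏ j,
      expNeg (ENNReal.ofReal (ω.2 ℓ j / (ω.1 ℓ * w j + 1) * ω.1 ℓ) *
        ENNReal.ofReal (t ℓ j)) := by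
    refine Finset.measurable_prod _ fun ℓ _ => Finset.measurable_prod _ fun j _ =>
      measurable_expNeg.comp (Measurable.mul_const (Measurable.ennreal_ofReal ?_) _)
    fun_prop
  rw [jumpModel, lintegral_prod _ hm.aemeasurable]
  have h1 : ∀ᵐ s ∂(Measure.pi fun ℓ => fixedJumpLaw φ σ w (c ℓ)),
      ∫⁻ v, ∏ ℓ, ∏ j, expNeg (ENNReal.ofReal (v ℓ j / (s ℓ * w j + 1) * s ℓ) *
        ENNReal.ofReal (t ℓ j)) ∂(Measure.pi fun ℓ => Measure.pi fun j =>
          gammaMeasure (φ + c ℓ j) 1) =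
      ∏ ℓ, ∏ j, ENNReal.ofReal ((1 / (1 + s ℓ / (s ℓ * w j + 1) * t ℓ j)) ^ (φ + c ℓ j)) := by
    filter_upwards [hpos] with s hs
    have hr : ∀ ℓ j, 0 < s ℓ * w j + 1 := fun ℓ j => by nlinarith [mul_pos (hs ℓ) (hw j)]
    rw [lintegral_pi_prod (fun ℓ => Measure.pi fun j => gammaMeasure (φ + c ℓ j) 1)
      (fun ℓ (v : Fin d → ℝ) => ∏ j, expNeg (ENNReal.ofReal (v j / (s ℓ * w j + 1) * s ℓ) *
        ENNReal.ofReal (t ℓ j)))]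
    · refine Finset.prod_congr rfl fun ℓ _ => ?_
      rw [lintegral_pi_prod (fun j => gammaMeasure (φ + c ℓ j) 1)
        (fun j (v : ℝ) => expNeg (ENNReal.ofReal (v / (s ℓ * w j + 1) * s ℓ) *
          ENNReal.ofReal (t ℓ j)))]
      · refine Finset.prod_congr rfl fun j _ => ?_
        have hv : 0 ≤ s ℓ / (s ℓ * w j + 1) * t ℓ j :=
          mul_nonneg (div_nonneg (hs ℓ).le (hr ℓ j).le) (ht ℓ j)
        rw [← lintegral_expNeg_gammaMeasure (a := φ + c ℓ j) (by positivity) one_pos hv]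
        refine lintegral_congr fun v => ?_
        rw [← ENNReal.ofReal_mul' (ht ℓ j)]
        congr 2
        ring
      · intro j
        exact measurable_expNeg.comp (Measurable.mul_const (Measurable.ennreal_ofReal
          (by fun_prop)) _)
    · intro ℓ
      exact Finset.measurable_prod _ fun j _ => measurable_expNeg.comp
        (Measurable.mul_const (Measurable.ennreal_ofReal (by fun_prop)) _)
  rw [lintegral_congr_ae h1, lintegral_pi_prod (fun ℓ => fixedJumpLaw φ σ w (c ℓ))
    (fun ℓ (s : ℝ) => ∏ j, ENNReal.ofReal
      ((1 / (1 + s / (s * w j + 1) * t ℓ j)) ^ (φ + c ℓ j)))]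
  · exact Finset.prod_congr rfl fun ℓ _ => lintegral_fixedJumpLaw hφ hσ hw (hc ℓ) (ht ℓ)
  · intro ℓ
    refine Finset.measurable_prod _ fun j _ => Measurable.ennreal_ofReal ?_
    fun_prop

end FixedJumps

/-! ### A probability space that carries the representation -/

section Representation

variable {d : ℕ} {φ σ : ℝ}

theorem laplaceTest_mul_laplaceTest_const {X : Type*} [MeasurableSpace X] {f : Fin d → X → ℝ}
    (hf : IsTest f) {w : Fin d → ℝ} (hw : ∀ j, 0 ≤ w j) (ν : Fin d → Measure X) :
    laplaceTest f ν * laplaceTest (fun j _ => w j) ν = laplaceTest (fun j y => f j y + w j) ν := by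
  rw [laplaceTest_add_const hf hw]
  congr 1
  unfold laplaceTest
  rw [← expNeg_sum]
  simp_rw [lintegral_const]

theorem laplaceTest_add {X : Type*} [MeasurableSpace X] (f : Fin d → X → ℝ)
    (ν ν' : Fin d → Measure X) :
    laplaceTest f (fun j => ν j + ν' j) = laplaceTest f ν * laplaceTest f ν' := by
  unfold laplaceTest
  simp_rw [lintegral_add_measure]
  rw [Finset.sum_add_distrib, expNeg_add]

theorem laplaceTest_fixedPart {Ω X : Type*} [MeasurableSpace X] {k : ℕ} {f : Fin d → X → ℝ}
    (hf : ∀ j, Measurable (f j)) (y : Fin k → X) (s : Fin k → Ω → ℝ) (T : Fin k → Fin d → Ω → ℝ)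
    (ω : Ω) :
    laplaceTest f (fixedPart y s T ω) = ∏ ℓ, ∏ j,
      expNeg (ENNReal.ofReal (T ℓ j ω * s ℓ ω) * ENNReal.ofReal (f j (y ℓ))) := by
  unfold laplaceTest fixedPart
  rw [Finset.prod_comm, expNeg_sum]
  refine Finset.prod_congr rfl fun j _ => ?_
  rw [lintegral_finsetSum_measure, expNeg_sum]
  refine Finset.prod_congr rfl fun ℓ _ => ?_
  rw [lintegral_smul_measure, lintegral_dirac' _ (hf j).ennreal_ofReal, smul_eq_mul]

theorem measurable_fixedPart {Ω X : Type*} [MeasurableSpace Ω] [MeasurableSpace X] {k : ℕ}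
    (y : Fin k → X) {s : Fin k → Ω → ℝ} {T : Fin k → Fin d → Ω → ℝ} (hs : ∀ ℓ, Measurable (s ℓ))
    (hT : ∀ ℓ j, Measurable (T ℓ j)) : Measurable (fixedPart y s T) := by
  refine measurable_pi_lambda _ fun j => Measure.measurable_of_measurable_coe _ fun B hB => ?_
  simp only [fixedPart, Measure.finsetSum_apply, Measure.smul_apply, smul_eq_mul]
  exact Finset.measurable_sum _ fun ℓ _ => ((hT ℓ j).mul (hs ℓ)).ennreal_ofReal.mul_const _

theorem lintegral_laplaceTest_gamma_stable {Ω X : Type*} [MeasurableSpace Ω] [MeasurableSpace X]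
    {P : Measure Ω} [IsProbabilityMeasure P] (hφ : 0 < φ) (hσ : σ ∈ Ioo (0 : ℝ) 1)
    {α : Measure X} [IsProbabilityMeasure α]
    {J : ℕ → Ω → ℝ} {x : ℕ → Ω → X} {m : Fin d → ℕ → Ω → ℝ}
    (hc : IsCRM P ((stableLevy φ σ).prod α) J x)
    (hs : HasScores P (fun _ _ => gammaMeasure φ 1) J x m) {f : Fin d → X → ℝ} (hf : IsTest f) :
    ∫⁻ ω, laplaceTest f (compound J x m ω) ∂P =
      ENNReal.ofReal (Real.exp (-∫ y, levyExponent φ σ (fun j => f j y) ∂α)) := by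
  rw [lintegral_laplaceTest_compound hφ hc hs hf, lintegral_one_sub_expNeg_levelCost hφ hσ α hf,
    expNeg_ofReal (integral_nonneg fun y => levyExponent_nonneg hφ fun j => hf.nonneg j y)]

/-- The product of the tilted prior and the jump model. The Laplace functional is recorded along
with the representation, because it is what identifies the law of the sum with the kernel. -/
theorem exists_posteriorRepresentation {X : Type u} [MeasurableSpace X] {Ω : Type v}
    [MeasurableSpace Ω] {P : Measure Ω} [IsProbabilityMeasure P] (hφ : 0 < φ)
    (hσ : σ ∈ Ioo (0 : ℝ) 1) {α : Measure X} [IsProbabilityMeasure α]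
    {J : ℕ → Ω → ℝ} {x : ℕ → Ω → X} {m : Fin d → ℕ → Ω → ℝ}
    (hcrm : IsCRM P ((stableLevy φ σ).prod α) J x)
    (hs : HasScores P (fun _ _ => gammaMeasure φ 1) J x m) {w : Fin d → ℝ} (hw : ∀ j, 0 < w j)
    {k : ℕ} (y : Fin k → X) {c : Fin k → Fin d → ℕ} (hc : ∀ ℓ, c ℓ ≠ 0) :
    ∃ (Ω' : Type u) (_ : MeasurableSpace Ω') (P' : Measure Ω') (_ : IsProbabilityMeasure P')
      (J' : ℕ → Ω' → ℝ) (x' : ℕ → Ω' → X) (m' : Fin d → ℕ → Ω' → ℝ)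
      (s : Fin k → Ω' → ℝ) (T : Fin k → Fin d → Ω' → ℝ),
      IsPosteriorRepresentation P' α φ σ w c J' x' m' s T ∧
      Measurable (fun ω j => compound J' x' m' ω j + fixedPart y s T ω j) ∧
      ∀ f : Fin d → X → ℝ, IsTest f →
        ∫⁻ ω, laplaceTest f (fun j => compound J' x' m' ω j + fixedPart y s T ω j) ∂P' =
          (ENNReal.ofReal (Real.exp (-levyExponent φ σ w)))⁻¹ *
            ENNReal.ofReal (Real.exp (-∫ y, levyExponent φ σ (fun j => f j y + w j) ∂α)) *
            ∏ ℓ, ((ENNReal.ofReal (jumpMoment φ σ (c ℓ) w))⁻¹ *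
              ENNReal.ofReal (jumpMoment φ σ (c ℓ) (w + fun j => f j (y ℓ)))) := by
  have hw0 : ∀ j, 0 ≤ w j := fun j => (hw j).le
  have hwt : IsTest fun j (_ : X) => w j := IsTest.const hw0
  have hF : ∀ ℓ, IsProbabilityMeasure (fixedJumpLaw φ σ w (c ℓ)) := fun ℓ =>
    isProbabilityMeasure_fixedJumpLaw hφ hσ hw (hc ℓ)
  have hγ : ∀ ℓ j, IsProbabilityMeasure (gammaMeasure (φ + c ℓ j) 1) := fun ℓ j =>
    isProbabilityMeasure_gammaMeasure (by positivity) one_pos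
  have hJm : Measurable fun ω => compound J x m ω :=
    measurable_compound hcrm.measurable_height hcrm.measurable_location hs.measurable
  have hlw : Measurable fun ω => laplaceTest (fun j _ => w j) (compound J x m ω) :=
    (measurable_laplaceTest hwt).comp hJm
  let V : Ω → (ℕ → ℝ) × (ℕ → X) × (Fin d → ℕ → ℝ) := fun ω =>
    ((fun i => J i ω), (fun i => x i ω), fun j i => m j i ω)
  have hVm : Measurable V := (measurable_pi_lambda _ hcrm.measurable_height).prodMk
    ((measurable_pi_lambda _ hcrm.measurable_location).prodMk
      (measurable_pi_lambda _ fun j => measurable_pi_lambda _ (hs.measurable j)))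
  have hZ := lintegral_laplaceTest_gamma_stable hφ hσ hcrm hs hwt
  simp only [integral_const, probReal_univ, one_smul] at hZ
  set Z := ∫⁻ ω, laplaceTest (fun j _ => w j) (compound J x m ω) ∂P with hZdef
  have hZ0 : Z ≠ 0 := by rw [hZ]; exact (ENNReal.ofReal_pos.2 (Real.exp_pos _)).ne'
  have hZt : Z ≠ ∞ := by rw [hZ]; exact ENNReal.ofReal_ne_top
  -- The normalized tilt of P, transported to the space of sequences. That space lives in the
  -- universe of `X`, whatever the universe of `Ω`.
  let P₁ : Measure ((ℕ → ℝ) × (ℕ → X) × (Fin d → ℕ → ℝ)) :=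
    Z⁻¹ • (P.withDensity fun ω => laplaceTest (fun j _ => w j) (compound J x m ω)).map V
  have hP₁ : ∀ F : (ℕ → ℝ) × (ℕ → X) × (Fin d → ℕ → ℝ) → ℝ≥0∞, Measurable F →
      ∫⁻ q, F q ∂P₁ = Z⁻¹ * ∫⁻ ω, F (V ω) *
        laplaceTest (fun j _ => w j) (compound J x m ω) ∂P := fun F hF => by
    have hFV : Measurable fun ω => F (V ω) := hF.comp hVm
    simp only [P₁]
    rw [lintegral_smul_measure, smul_eq_mul, lintegral_map hF hVm,
      lintegral_withDensity_eq_lintegral_mul _ hlw hFV]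
    simp only [Pi.mul_apply, mul_comm]
  have hprob : IsProbabilityMeasure P₁ := ⟨by
    have := hP₁ (fun _ => 1) measurable_const
    rw [lintegral_one] at this
    simp only [one_mul] at this
    rw [this, ← hZdef, ENNReal.inv_mul_cancel hZ0 hZt]⟩
  have hjm : IsProbabilityMeasure (jumpModel φ σ w c) := by
    unfold jumpModel
    infer_instance
  let Ω' := ((ℕ → ℝ) × (ℕ → X) × (Fin d → ℕ → ℝ)) × ((Fin k → ℝ) × (Fin k → Fin d → ℝ))
  let P' : Measure Ω' := P₁.prod (jumpModel φ σ w c)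
  have hfst : MeasurePreserving (Prod.fst : Ω' → _) P' P₁ := measurePreserving_fst
  have hsnd : MeasurePreserving (Prod.snd : Ω' → _) P' (jumpModel φ σ w c) := measurePreserving_snd
  let J' : ℕ → Ω' → ℝ := fun i ω => ω.1.1 i
  let x' : ℕ → Ω' → X := fun i ω => ω.1.2.1 i
  let m' : Fin d → ℕ → Ω' → ℝ := fun j i ω => ω.1.2.2 j i
  let s : Fin k → Ω' → ℝ := fun ℓ ω => ω.2.1 ℓ
  let T : Fin k → Fin d → Ω' → ℝ := fun ℓ j ω => ω.2.2 ℓ j / (ω.2.1 ℓ * w j + 1)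
  have hJ' : ∀ i, Measurable (J' i) := fun i => by fun_prop
  have hx' : ∀ i, Measurable (x' i) := fun i => by fun_prop
  have hm' : ∀ j i, Measurable (m' j i) := fun j i => by fun_prop
  have hs' : ∀ ℓ, Measurable (s ℓ) := fun ℓ => by fun_prop
  have hT' : ∀ ℓ j, Measurable (T ℓ j) := fun ℓ j => by fun_prop
  have htilt : IsTilted P P' J x m J' x' m' w := fun F hF => by
    have h1 : ∫⁻ ω, F ((fun i => J' i ω), (fun i => x' i ω), fun j i => m' j i ω) ∂P' =
        ∫⁻ q, F q ∂P₁ := hfst.lintegral_comp hF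
    rw [h1, hP₁ F hF]
  have hcm : Measurable (compound J' x' m') := measurable_compound hJ' hx' hm'
  have hfm : Measurable (fixedPart y s T) := measurable_fixedPart y hs' hT'
  refine ⟨Ω', inferInstance, P', inferInstance, J', x', m', s, T, ?_, ?_, ?_⟩
  · refine ⟨htilt.isCRM hφ hσ hcrm hs hw0 hJ' hx', htilt.hasScores hφ hcrm.measurable_height
      hcrm.measurable_location hcrm.nonneg hs hw0 hJ' hx' hm', hT', hs', fun ℓ => ?_, ?_, ?_, ?_⟩
    · have h1 : MeasurePreserving (Prod.fst : (Fin k → ℝ) × (Fin k → Fin d → ℝ) → _)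
          (jumpModel φ σ w c) (Measure.pi fun ℓ => fixedJumpLaw φ σ w (c ℓ)) :=
        measurePreserving_fst
      have h2 := ((measurePreserving_eval (fun ℓ => fixedJumpLaw φ σ w (c ℓ)) ℓ).comp h1).comp hsnd
      exact ⟨(hs' ℓ).aemeasurable, h2.map_eq⟩
    · have h1 : MeasurePreserving (Prod.fst : (Fin k → ℝ) × (Fin k → Fin d → ℝ) → _)
          (jumpModel φ σ w c) (Measure.pi fun ℓ => fixedJumpLaw φ σ w (c ℓ)) :=
        measurePreserving_fst
      have h2 := h1.comp hsnd
      rw [iIndepFun_iff_map_fun_eq_pi_map fun ℓ => (hs' ℓ).aemeasurable]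
      have h3 : ∀ ℓ, P'.map (s ℓ) = fixedJumpLaw φ σ w (c ℓ) := fun ℓ =>
        ((measurePreserving_eval (fun ℓ => fixedJumpLaw φ σ w (c ℓ)) ℓ).comp h2).map_eq
      simp_rw [h3]
      exact h2.map_eq
    · intro A hA B hB
      have h1 := jumpModel_apply (c := c) hφ hσ hw hc hA hB
      have hS : MeasurableSet ({ω : (Fin k → ℝ) × (Fin k → Fin d → ℝ) | ω.1 ∈ A} ∩
          {ω | ∀ ℓ j, ω.2 ℓ j / (ω.1 ℓ * w j + 1) ∈ B ℓ j}) := by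
        refine (measurable_fst hA).inter ?_
        simp only [Set.ofPred_forall]
        refine MeasurableSet.iInter fun ℓ => MeasurableSet.iInter fun j => ?_
        have h1 : Measurable fun ω : (Fin k → ℝ) × (Fin k → Fin d → ℝ) =>
            ω.2 ℓ j / (ω.1 ℓ * w j + 1) := by fun_prop
        exact h1 (hB ℓ j)
      have hg : Measurable fun ω : (Fin k → ℝ) × (Fin k → Fin d → ℝ) => ∏ ℓ, ∏ j,
          gammaMeasure (φ + c ℓ j) (ω.1 ℓ * w j + 1) (B ℓ j) := by
        refine Finset.measurable_prod _ fun ℓ _ => Finset.measurable_prod _ fun j _ => ?_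
        have h1 : Measurable fun ω : (Fin k → ℝ) × (Fin k → Fin d → ℝ) => ω.1 ℓ * w j + 1 := by
          fun_prop
        exact (measurable_gammaMeasure_apply _ (hB ℓ j)).comp h1
      have h2 := hsnd.measure_preimage hS.nullMeasurableSet
      have h3 := hsnd.setLIntegral_comp_preimage (measurable_fst hA) hg
      exact h2.trans (h1.trans h3.symm)
    · have h1 := indepFun_prod (μ := P₁) (ν := jumpModel φ σ w c) (X := id)
        (Y := fun q => (q.1, fun ℓ j => q.2 ℓ j / (q.1 ℓ * w j + 1))) measurable_id (by fun_prop)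
      exact h1
  · refine measurable_pi_lambda _ fun j => Measure.measurable_of_measurable_coe _ fun B hB => ?_
    simp only [Measure.add_apply]
    exact ((measurable_apply_mass j hB).comp hcm).add ((measurable_apply_mass j hB).comp hfm)
  · intro f hf
    let A₁ : (ℕ → ℝ) × (ℕ → X) × (Fin d → ℕ → ℝ) → ℝ≥0∞ := fun q =>
      laplaceTest f (compound (fun i (q : (ℕ → ℝ) × (ℕ → X) × (Fin d → ℕ → ℝ)) => q.1 i)
        (fun i q => q.2.1 i) (fun j i q => q.2.2 j i) q)
    have hA₁ : Measurable A₁ := (measurable_laplaceTest hf).comp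
      (measurable_compound (fun i => by fun_prop) (fun i => by fun_prop) fun j i => by fun_prop)
    let A₂ : (Fin k → ℝ) × (Fin k → Fin d → ℝ) → ℝ≥0∞ := fun q => ∏ ℓ, ∏ j,
      expNeg (ENNReal.ofReal (q.2 ℓ j / (q.1 ℓ * w j + 1) * q.1 ℓ) * ENNReal.ofReal (f j (y ℓ)))
    have hA₂ : Measurable A₂ := by
      refine Finset.measurable_prod _ fun ℓ _ => Finset.measurable_prod _ fun j _ =>
        measurable_expNeg.comp (Measurable.mul_const (Measurable.ennreal_ofReal ?_) _)
      fun_prop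
    have h1 : ∀ ω, laplaceTest f (fun j => compound J' x' m' ω j + fixedPart y s T ω j) =
        A₁ ω.1 * A₂ ω.2 := fun ω => by
      rw [laplaceTest_add, laplaceTest_fixedPart hf.measurable]
      rfl
    simp_rw [h1]
    have h2 : ∫⁻ ω, A₁ ω.1 * A₂ ω.2 ∂P' = (∫⁻ q, A₁ q ∂P₁) * ∫⁻ q, A₂ q ∂(jumpModel φ σ w c) :=
      lintegral_prod_mul hA₁.aemeasurable hA₂.aemeasurable
    rw [h2, lintegral_jumpModel hφ hσ hw hc fun ℓ j => hf.nonneg j (y ℓ), hP₁ A₁ hA₁]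
    congr 1
    rw [← hZ, ← lintegral_laplaceTest_gamma_stable hφ hσ hcrm hs (hf.add_const hw0)]
    congr 1
    exact lintegral_congr fun ω => laplaceTest_mul_laplaceTest_const hf hw0 (compound J x m ω)

end Representation

/-! ### Assembling the posterior -/

theorem ae_latent_pos {X Ω : Type*} [MeasurableSpace X] [MeasurableSpace Ω] {d : ℕ}
    {n : Fin d → ℕ} {P : Measure Ω} {μ : Ω → Fin d → Measure X}
    {obs : Ω → (j : Fin d) → Fin (n j) → X} {G : Ω → Fin d → ℝ}
    (hG : IsGammaAuxiliary P μ n obs G) (hfin : ∀ᵐ ω ∂P, ∀ j, μ ω j univ ≠ ∞)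
    (hne : ∀ᵐ ω ∂P, ∀ j, μ ω j univ ≠ 0) : ∀ᵐ ω ∂P, ∀ j, 0 < latent μ G ω j := by
  have h1 : ∀ᵐ ω ∂P, ∀ j, 0 < G ω j := by
    rw [ae_all_iff]
    intro j
    have h2 := ae_pos_gammaMeasure (n j) 1
    rw [← (hG.law j).map_eq] at h2
    exact ae_of_ae_map (hG.law j).aemeasurable h2
  filter_upwards [h1, hfin, hne] with ω hω1 hω2 hω3 j
  exact div_pos (hω1 j) (ENNReal.toReal_pos (hω3 j) (hω2 j))

section Posterior

variable {X : Type*} {d : ℕ} {n : Fin d → ℕ} {φ σ : ℝ}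

theorem exists_listing (z : (j : Fin d) → Fin (n j) → X) :
    ∃ (k : ℕ) (y : Fin k → X), Function.Injective y ∧ range y = {a | ∃ j i, z j i = a} := by
  have hfin : {a | ∃ j i, z j i = a}.Finite := by
    have : {a | ∃ j i, z j i = a} = range fun p : (j : Fin d) × Fin (n j) => z p.1 p.2 := by
      ext a
      simp
    rw [this]
    exact finite_range _
  obtain ⟨k, y, hy, hr⟩ := hfin.fin_param
  exact ⟨k, y, hy, hr⟩

theorem freq_ne_zero (z : (j : Fin d) → Fin (n j) → X) {a : X} (h : ∃ j i, z j i = a) :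
    freq z a ≠ 0 := by
  obtain ⟨j, i, rfl⟩ := h
  intro h
  have h1 := congrFun h j
  rw [freq, Pi.zero_apply, Set.ncard_eq_zero] at h1
  have h2 : i ∈ {i' | z j i' = z j i} := rfl
  rw [h1] at h2
  exact h2

variable [MeasurableSpace X]

theorem jointDensity_zero_ne_zero (hφ : 0 < φ) (hσ : σ ∈ Ioo (0 : ℝ) 1) (α : Measure X)
    (z : (j : Fin d) → Fin (n j) → X) {w : Fin d → ℝ} (hw : ∀ j, 0 < w j) :
    jointDensity φ σ α n (fun _ _ => 0) (z, w) ≠ 0 := by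
  refine mul_ne_zero (Finset.prod_ne_zero_iff.2 fun j _ =>
    (ENNReal.ofReal_pos.2 (Real.exp_pos _)).ne') (mul_ne_zero
    (ENNReal.ofReal_pos.2 (Real.exp_pos _)).ne' (ENNReal.ofReal_pos.2 ?_).ne')
  exact blockMoment_pos hφ hσ _ _ fun y j => by simpa using hw j

theorem jointDensity_ne_top (α : Measure X) (f : Fin d → X → ℝ)
    (q : ((j : Fin d) → Fin (n j) → X) × (Fin d → ℝ)) : jointDensity φ σ α n f q ≠ ∞ :=
  ENNReal.mul_ne_top (ENNReal.prod_ne_top fun _ _ => ENNReal.ofReal_ne_top)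
    (ENNReal.mul_ne_top ENNReal.ofReal_ne_top ENNReal.ofReal_ne_top)

/-- The factors e^{u_j} are common to both densities. The rest splits into a quotient of
exponentials, for the part without fixed atoms, and one quotient of jump moments for each listed
value. -/
theorem jointDensity_zero_mul (hφ : 0 < φ) (hσ : σ ∈ Ioo (0 : ℝ) 1) (α : Measure X)
    [IsProbabilityMeasure α] (z : (j : Fin d) → Fin (n j) → X) {w : Fin d → ℝ} (hw : ∀ j, 0 < w j)
    {k : ℕ} {y : Fin k → X} (hy : Function.Injective y) (hr : range y = {a | ∃ j i, z j i = a})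
    {f : Fin d → X → ℝ} (hf : ∀ j y, 0 ≤ f j y) :
    jointDensity φ σ α n (fun _ _ => 0) (z, w) *
      ((ENNReal.ofReal (Real.exp (-levyExponent φ σ w)))⁻¹ *
            ENNReal.ofReal (Real.exp (-∫ y, levyExponent φ σ (fun j => f j y + w j) ∂α)) *
            ∏ ℓ, ((ENNReal.ofReal (jumpMoment φ σ (freq z (y ℓ)) w))⁻¹ *
              ENNReal.ofReal (jumpMoment φ σ (freq z (y ℓ)) (w + fun j => f j (y ℓ))))) =
      jointDensity φ σ α n f (z, w) := by
  have hc : ∀ ℓ, freq z (y ℓ) ≠ 0 := fun ℓ => by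
    refine freq_ne_zero z ?_
    have : y ℓ ∈ {a | ∃ j i, z j i = a} := hr ▸ mem_range_self ℓ
    exact this
  have hk : ∀ ℓ (t : Fin d → ℝ), (∀ j, 0 < t j) →
      ENNReal.ofReal (jumpMoment φ σ (freq z (y ℓ)) t) ≠ 0 := fun ℓ t ht =>
    (ENNReal.ofReal_pos.2 (jumpMoment_pos hφ hσ (hc ℓ) ht)).ne'
  have hE := (ENNReal.ofReal_pos.2 (Real.exp_pos (-levyExponent φ σ w))).ne'
  simp only [jointDensity, zero_add, integral_const, probReal_univ, one_smul]
  rw [blockMoment_flatten z (fun _ j => w j) hy hr,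
    blockMoment_flatten z (fun y j => f j y + w j) hy hr,
    ENNReal.ofReal_prod_of_nonneg fun ℓ _ => (jumpMoment_pos hφ hσ (hc ℓ) hw).le,
    ENNReal.ofReal_prod_of_nonneg fun ℓ _ => (jumpMoment_pos hφ hσ (hc ℓ) fun j =>
      add_pos_of_nonneg_of_pos (hf j (y ℓ)) (hw j)).le]
  have h1 : ∀ ℓ, (w + fun j => f j (y ℓ)) = fun j => f j (y ℓ) + w j := fun ℓ => by
    ext j
    rw [Pi.add_apply, add_comm]
  simp_rw [h1]
  have h2 : (∏ ℓ, ENNReal.ofReal (jumpMoment φ σ (freq z (y ℓ)) w)) *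
      ∏ ℓ, ((ENNReal.ofReal (jumpMoment φ σ (freq z (y ℓ)) w))⁻¹ *
        ENNReal.ofReal (jumpMoment φ σ (freq z (y ℓ)) fun j => f j (y ℓ) + w j)) =
      ∏ ℓ, ENNReal.ofReal (jumpMoment φ σ (freq z (y ℓ)) fun j => f j (y ℓ) + w j) := by
    rw [← Finset.prod_mul_distrib]
    refine Finset.prod_congr rfl fun ℓ _ => ?_
    rw [← mul_assoc, ENNReal.mul_inv_cancel (hk ℓ w hw) ENNReal.ofReal_ne_top, one_mul]
  rw [← h2]
  have h3 : ∀ W E F K L : ℝ≥0∞, E ≠ 0 → E ≠ ∞ →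
      W * (E * K) * (E⁻¹ * F * L) = W * (F * (K * L)) := fun W E F K L h h' => by
    calc W * (E * K) * (E⁻¹ * F * L) = (E * E⁻¹) * (W * (F * (K * L))) := by ring
      _ = _ := by rw [ENNReal.mul_inv_cancel h h', one_mul]
  exact h3 _ _ _ _ _ hE ENNReal.ofReal_ne_top

end Posterior

theorem corollary1
    {X : Type u} [TopologicalSpace X] [PolishSpace X] [MeasurableSpace X] [BorelSpace X]
    (α : Measure X) [IsProbabilityMeasure α] (hα : ∀ a, α {a} = 0)
    (φ σ : ℝ) (hφ : 0 < φ) (hσ : σ ∈ Ioo (0 : ℝ) 1)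
    (d : ℕ) (hd : 1 ≤ d) (n : Fin d → ℕ) (hn : ∀ j, 1 ≤ n j)
    {Ω : Type v} [MeasurableSpace Ω] (P : Measure Ω) [IsProbabilityMeasure P]
    -- the vector of compound random measures, with gamma scores and stable directing measure
    (J : ℕ → Ω → ℝ) (x : ℕ → Ω → X) (m : Fin d → ℕ → Ω → ℝ)
    (hcrm : IsCRM P ((stableLevy φ σ).prod α) J x)
    (hscores : HasScores P (fun _ _ => gammaMeasure φ 1) J x m)
    -- the samples and the latent variables
    (obs : Ω → (j : Fin d) → Fin (n j) → X)
    (hobs : IsNormalizedSample P (compound J x m) n obs)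
    (G : Ω → Fin d → ℝ)
    (hG : IsGammaAuxiliary P (compound J x m) n obs G) :
    (∀ᵐ ω ∂P, ∀ j, 0 < latent (compound J x m) G ω j) ∧
    ∃ (Q : Kernel (((j : Fin d) → Fin (n j) → X) × (Fin d → ℝ)) (Fin d → Measure X))
      (_ : IsMarkovKernel Q),
      -- `Q` is the conditional law of the vector of random measures given `(obs, U)`
      HasCondDistrib (compound J x m)
        (fun ω => (obs ω, latent (compound J x m) G ω)) Q P ∧
      -- and `Q (z, w)` is the law of the representation, for `y` listing the distinct values of `z`
      ∀ (z : (j : Fin d) → Fin (n j) → X) (w : Fin d → ℝ), (∀ j, 0 < w j) →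
        ∀ (k : ℕ) (y : Fin k → X), Function.Injective y → range y = {a | ∃ j i, z j i = a} →
          ∃ (Ω' : Type u) (_ : MeasurableSpace Ω') (P' : Measure Ω') (_ : IsProbabilityMeasure P')
            (J' : ℕ → Ω' → ℝ) (x' : ℕ → Ω' → X) (m' : Fin d → ℕ → Ω' → ℝ)
            (s : Fin k → Ω' → ℝ) (T : Fin k → Fin d → Ω' → ℝ),
            IsPosteriorRepresentation P' α φ σ w (fun ℓ => freq z (y ℓ)) J' x' m' s T ∧
            HasLaw (fun ω j => compound J' x' m' ω j + fixedPart y s T ω j) (Q (z, w)) P' := by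
  have hμ : Measurable (compound J x m) :=
    measurable_compound hcrm.measurable_height hcrm.measurable_location hscores.measurable
  have hL : ∀ θ : X → Fin d → ℝ, IsTest (fun j y => θ y j) →
      ∫⁻ ω, laplaceTest (fun j y => θ y j) (compound J x m ω) ∂P =
        ENNReal.ofReal (Real.exp (-∫ y, levyExponent φ σ (θ y) ∂α)) := fun θ hθ =>
    lintegral_laplaceTest_gamma_stable hφ hσ hcrm hscores hθ
  refine ⟨ae_latent_pos hG (ae_mass_ne_top hφ hσ hμ hL) (ae_mass_ne_zero hφ hσ hμ hL), ?_⟩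
  have hc : ∀ (z : (j : Fin d) → Fin (n j) → X) {k : ℕ} {y : Fin k → X},
      range y = {a | ∃ j i, z j i = a} → ∀ ℓ, freq z (y ℓ) ≠ 0 := fun z k y hr ℓ => by
    have h : y ℓ ∈ {a | ∃ j i, z j i = a} := hr ▸ mem_range_self ℓ
    exact freq_ne_zero z h
  -- For each value of (obs, U) a law is prescribed through its Laplace functional, in a form
  -- visibly measurable in q. Where some coordinate of u fails to be positive, the Dirac mass at 0
  -- is the default, with functional 1.
  have hrep : ∀ q : ((j : Fin d) → Fin (n j) → X) × (Fin d → ℝ),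
      ∃ ρ : Measure (Fin d → Measure X), IsProbabilityMeasure ρ ∧
        ∀ f : Fin d → X → ℝ, IsTest f → ∫⁻ ν, laplaceTest f ν ∂ρ =
          {q : ((j : Fin d) → Fin (n j) → X) × (Fin d → ℝ) | ∀ j, 0 < q.2 j}.indicator
            (fun q => (jointDensity φ σ α n (fun _ _ => 0) q)⁻¹ * jointDensity φ σ α n f q) q +
          {q : ((j : Fin d) → Fin (n j) → X) × (Fin d → ℝ) | ∀ j, 0 < q.2 j}ᶜ.indicator 1 q := by
    rintro ⟨z, w⟩
    by_cases hw : ∀ j, 0 < w j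
    · obtain ⟨k, y, hy, hr⟩ := exists_listing z
      obtain ⟨Ω', _, P', _, J', x', m', s, T, -, hm, hlap⟩ :=
        exists_posteriorRepresentation hφ hσ hcrm hscores hw y (hc z hr)
      refine ⟨P'.map fun ω j => compound J' x' m' ω j + fixedPart y s T ω j,
        Measure.isProbabilityMeasure_map hm.aemeasurable, fun f hf => ?_⟩
      rw [lintegral_map (measurable_laplaceTest hf) hm, hlap f hf, indicator_of_mem (by exact hw),
        indicator_of_notMem (by simpa using hw), add_zero,
        ← jointDensity_zero_mul hφ hσ α z hw hy hr hf.nonneg, ← mul_assoc, ENNReal.inv_mul_cancel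
          (jointDensity_zero_ne_zero hφ hσ α z hw) (jointDensity_ne_top α _ _), one_mul]
    · refine ⟨Measure.dirac 0, inferInstance, fun f hf => ?_⟩
      rw [lintegral_dirac' _ (measurable_laplaceTest hf), indicator_of_notMem (by exact hw),
        indicator_of_mem (by exact hw), zero_add, Pi.one_apply]
      simp [laplaceTest, expNeg_zero]
  choose ρ hρ hρf using hrep
  have hposm : MeasurableSet
      {q : ((j : Fin d) → Fin (n j) → X) × (Fin d → ℝ) | ∀ j, 0 < q.2 j} := by
    simp only [Set.ofPred_forall]
    exact MeasurableSet.iInter fun j =>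
      measurableSet_lt measurable_const ((measurable_pi_apply j).comp measurable_snd)
  -- The listing of the distinct values was chosen separately for each q, without measurability.
  -- This does no harm, because the Laplace functionals do not involve the listing.
  have hρm : Measurable ρ := by
    refine measurable_measure_of_laplaceTest ρ fun f hf => ?_
    simp_rw [hρf _ f hf]
    exact (((measurable_jointDensity φ σ α n fun _ => measurable_const).inv.mul
      (measurable_jointDensity φ σ α n hf.measurable)).indicator hposm).add
      (measurable_one.indicator hposm.compl)
  let Q : Kernel (((j : Fin d) → Fin (n j) → X) × (Fin d → ℝ)) (Fin d → Measure X) := ⟨ρ, hρm⟩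
  have hQM : IsMarkovKernel Q := ⟨hρ⟩
  have hQ : ∀ f : Fin d → X → ℝ, IsTest f → ∀ z w, (∀ j, 0 < w j) →
      jointDensity φ σ α n (fun _ _ => 0) (z, w) * ∫⁻ ν, laplaceTest f ν ∂(Q (z, w)) =
        jointDensity φ σ α n f (z, w) := fun f hf z w hw => by
    have h : ∫⁻ ν, laplaceTest f ν ∂(Q (z, w)) = _ := hρf (z, w) f hf
    rw [h, indicator_of_mem (by exact hw), indicator_of_notMem (by simpa using hw), add_zero,
      ← mul_assoc, ENNReal.mul_inv_cancel (jointDensity_zero_ne_zero hφ hσ α z hw)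
        (jointDensity_ne_top α _ _), one_mul]
  refine ⟨Q, hQM, hasCondDistrib_of_laplaceTest hφ hσ α hα hn hμ hL hobs hG Q hQ,
    fun z w hw k y hy hr => ?_⟩
  -- The given listing may differ from the one used to define the kernel; both representations have
  -- the same Laplace functional, hence the same law.
  obtain ⟨Ω', mΩ', P', hP', J', x', m', s, T, hpr, hm, hlap⟩ :=
    exists_posteriorRepresentation hφ hσ hcrm hscores hw y (hc z hr)
  refine ⟨Ω', mΩ', P', hP', J', x', m', s, T, hpr, hm.aemeasurable, ?_⟩
  have : IsProbabilityMeasure (P'.map fun ω j => compound J' x' m' ω j + fixedPart y s T ω j) :=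
    Measure.isProbabilityMeasure_map hm.aemeasurable
  refine measure_ext_of_laplaceTest _ _ fun f hf => ?_
  have h0 := jointDensity_zero_ne_zero hφ hσ α z hw
  refine (ENNReal.mul_right_inj h0 (jointDensity_ne_top α _ _)).1 ?_
  rw [hQ f hf z w hw, lintegral_map (measurable_laplaceTest hf) hm, hlap f hf,
    jointDensity_zero_mul hφ hσ α z hw hy hr hf.nonneg]
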